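/- Let $L>0$, let $\Lambda=[-L,L]^2$ with periodic boundary conditions (a flat torus), and fix $b_0\in\mathbb R$, $\alpha>1/2$ and $T>0$. **Notation.** For $k\ge 1$ let $\mathcal L^1_k$ be the space of trace class operators on $L^2(\Lambda^k)$. Let $(J^{(k)}_i)_{i\ge1}$ be any sequence of compact operators in the unit ball of $\mathcal K(L^2(\Lambda^k))$ that is dense in this ball, and let $\eta_k(\gamma,\bar\gamma)=\sum_{i\ge1}2^{-i}|\mathrm{Tr}\,J^{(k)}_i(\gamma-\bar\gamma)|$. Denote by $C([0,T],\mathcal L^1_k)$ the space of functions $[0,T]\to\mathcal L^1_k$ that are continuous with respect to $\eta_k$. Write $$\mathcal U^{(k)}(t)\gamma=e^{it\sum_{j\le k}\Delta_{x_j}}\,\gamma\, e^{-it\sum_{j\le k}\Delta_{x_j}},\qquad S^{(k,\alpha)}=\prod_{j=1}^k(1-\Delta_{x_j})^{\alpha/2}(1-\Delta_{x_j'})^{\alpha/2},$$ where $S^{(k,\alpha)}$ acts on kernels in the variables $(x_1,\dots,x_k;x_1',\dots,x_k')\in\Lambda^k\times\Lambda^k$. For $1\le j\le k$ the collision operator is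 $$B_{j,k+1}\gamma^{(k+1)}=\mathrm{Tr}_{k+1}\big[\delta(x_j-x_{k+1}),\gamma^{(k+1)}\big]=\lim_{n\to\infty}\mathrm{Tr}_{k+1}\big[\varphi_n(x_j-x_{k+1}),\gamma^{(k+1)}\big].$$ Here $(\varphi_n)$ is any fixed sequence of continuous probability densities on $\Lambda$ concentrating at $0$ (that is, $\int_{\Lambda\setminus U}\varphi_n\to0$ for every open $U\ni 0$), and the limit is taken in the sense of convergence of every Fourier coefficient of the kernel on $\Lambda^k\times\Lambda^k$. **Theorem.** Let $\Gamma=\{\gamma^{(k)}\}_{k\ge1}$ with $\gamma^{(k)}\in\mathcal L^1_k$. Then there is at most one family $\Gamma_t=\{\gamma^{(k)}_t\}_{k\ge1}\in\bigoplus_{k\ge1}C([0,T],\mathcal L^1_k)$ with the following properties: * each density is symmetric under permutations of the particles, i.e. $\gamma^{(k)}_t(x_{\sigma1},\dots,x_{\sigma k};x'_{\sigma1},\dots,x'_{\sigma k})=\gamma^{(k)}_t(x_1,\dots,x_k;x_1',\dots,x_k')$ for all $k\ge1$, $t\in[0,T]$ and all permutations $\sigma$ of $\{1,\dots,k\}$;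 * for all $k\ge1$, $1\le j\le k$ and $s\in[0,T]$, $B_{j,k+1}\gamma^{(k+1)}_s$ exists and $$\big\|S^{(k,\alpha)}B_{j,k+1}\gamma^{(k+1)}_s\big\|_{L^2(\Lambda^k\times\Lambda^k)}\le C^k$$ for some constant $C$ that does not depend on $k$, $j$, $s$ (it may depend on the family); * $\Gamma_{t=0}=\Gamma$ and, for all $k\ge1$ and $t\in[0,T]$, $$\gamma^{(k)}_t=\mathcal U^{(k)}(t)\gamma^{(k)}-ib_0\sum_{j=1}^k\int_0^t ds\;\mathcal U^{(k)}(t-s)\,B_{j,k+1}\gamma^{(k+1)}_s ,$$ where the integral is understood weakly: every Fourier coefficient of the integrand is integrable in $s$, and the identity holds for every Fourier coefficient of the kernels. -/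

import Mathlib

open MeasureTheory Filter Topology Set

open scoped ENNReal ComplexConjugate

noncomputable section

namespace GPHierarchy

instance factTwoMul (L : ℝ) [h : Fact (0 < L)] : Fact (0 < 2 * L) :=
  ⟨mul_pos two_pos h.out⟩

/-- The periodic square `Λ = [-L, L]²`: opposite sides are identified, and `volume` is Lebesgue
measure, of total mass `(2L)²`. -/
abbrev Box (L : ℝ) : Type := Fin 2 → AddCircle (2 * L)

/-- The configuration space `Λᵏ` of `k` particles. -/
abbrev Conf (L : ℝ) (k : ℕ) : Type := Fin k → Box L

instance borelSpaceConf (L : ℝ) (k : ℕ) : BorelSpace (Conf L k) := Pi.borelSpace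

instance borelSpaceConfProd (L : ℝ) (k : ℕ) : BorelSpace (Conf L k × Conf L k) :=
  Prod.borelSpace

/-- The `k`-particle space `L²(Λᵏ)`. -/
abbrev HSpace (L : ℝ) [Fact (0 < L)] (k : ℕ) : Type :=
  Lp ℂ 2 (volume : Measure (Conf L k))

/-- Bounded operators on `L²(Λᵏ)`. -/
abbrev Op (L : ℝ) [Fact (0 < L)] (k : ℕ) : Type := HSpace L k →L[ℂ] HSpace L k

/-- Indices of the plane waves on `Λᵏ`; the momentum of the particle `j` is `(π / L) p j`. -/
abbrev Mom (k : ℕ) : Type := Fin k → Fin 2 → ℤ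

/-! ### Trace class operators and the space `C([0,T], 𝓛¹ₖ)` -/

/-- Trace class operators on a Hilbert space: `A = ∑ₙ |fₙ⟩⟨gₙ|` with `∑ₙ ‖fₙ‖ ‖gₙ‖ < ∞`. -/
def IsTraceClass {H : Type*} [NormedAddCommGroup H] [InnerProductSpace ℂ H]
    (A : H →L[ℂ] H) : Prop :=
  ∃ f g : ℕ → H, Summable (fun n => ‖f n‖ * ‖g n‖) ∧
    ∀ x, HasSum (fun n => inner ℂ (g n) x • f n) (A x)

/-- The plane wave `e_p(x) = ∏ⱼ (2L)⁻¹ exp(i π pⱼ · xⱼ / L)`, as a function. -/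
def planeWaveFun (L : ℝ) {k : ℕ} (p : Mom k) : C(Conf L k, ℂ) where
  toFun x := ∏ j : Fin k, (((2 * L : ℝ) : ℂ)⁻¹ * ∏ c : Fin 2, fourier (p j c) (x j c))
  continuous_toFun := by fun_prop

/-- The plane wave `e_p` as an element of `L²(Λᵏ)`. -/
def planeWave (L : ℝ) [Fact (0 < L)] {k : ℕ} (p : Mom k) : HSpace L k :=
  ContinuousMap.toLp 2 volume ℂ (planeWaveFun L p)

variable {L : ℝ} [Fact (0 < L)] {k : ℕ}

/-- The matrix elements `⟨e_p, A e_{p'}⟩`, that is, the Fourier coefficients of the kernel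
`A(x; x') = ∑ ⟨e_p, A e_{p'}⟩ e_p(x) conj(e_{p'}(x'))`. -/
def matrixElement (A : Op L k) (p p' : Mom k) : ℂ :=
  inner ℂ (planeWave L p) (A (planeWave L p'))

/-- The trace, computed in the orthonormal basis of plane waves. -/
def trace (A : Op L k) : ℂ := ∑' p : Mom k, matrixElement A p p

/-- `J` is a sequence in the unit ball of the compact operators which is dense in this ball. -/
structure IsDenseInCompactBall (J : ℕ → Op L k) : Prop where
  compact : ∀ i, IsCompactOperator (J i)
  norm_le : ∀ i, ‖J i‖ ≤ 1
  dense : ∀ K : Op L k, IsCompactOperator K → ‖K‖ ≤ 1 → ∀ ε > 0, ∃ i, ‖J i - K‖ < ε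

/-- The metric `η(A, A') = ∑_{i ≥ 1} 2⁻ⁱ |Tr Jᵢ (A - A')|` on trace class operators. -/
def eta (J : ℕ → Op L k) (A A' : Op L k) : ℝ :=
  ∑' i : ℕ, (1 / 2 : ℝ) ^ (i + 1) * ‖trace (J i ∘L (A - A'))‖

/-- Membership in `C([0,T], 𝓛¹ₖ)`: a curve of trace class operators, continuous with respect to
the metric `η` given by `J`. -/
structure IsTraceClassCurve (T : ℝ) (J : ℕ → Op L k) (γ : ℝ → Op L k) : Prop where
  traceClass : ∀ t ∈ Icc 0 T, IsTraceClass (γ t)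
  continuous : ∀ t ∈ Icc 0 T, Tendsto (fun s => eta J (γ s) (γ t)) (𝓝[Icc 0 T] t) (𝓝 0)

/-! ### Permutation symmetry -/

theorem measurePreserving_perm (σ : Equiv.Perm (Fin k)) :
    MeasurePreserving (fun x : Conf L k => x ∘ σ) volume volume := by
  have h := volume_measurePreserving_piCongrLeft (fun _ : Fin k => Box L) σ.symm
  have e : (fun x : Conf L k => x ∘ σ)
      = MeasurableEquiv.piCongrLeft (fun _ : Fin k => Box L) σ.symm := by
    funext x i
    have := MeasurableEquiv.piCongrLeft_apply_apply (β := fun _ : Fin k => Box L) σ.symm x (σ i)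
    rw [Equiv.symm_apply_apply] at this
    exact this.symm
  rw [e]
  exact h

/-- The operator `(Θ_σ ψ)(x₁, …, x_k) = ψ(x_{σ 1}, …, x_{σ k})` on `L²(Λᵏ)`. -/
def permOp (σ : Equiv.Perm (Fin k)) : Op L k :=
  (Lp.compMeasurePreservingₗᵢ ℂ (fun x : Conf L k => x ∘ σ)
    (measurePreserving_perm σ)).toContinuousLinearMap

/-- Symmetry of a density under permutations of the particles: `Θ_σ A Θ_σ⁻¹ = A`, that is,
`A(x_{σ 1}, …, x_{σ k}; x'_{σ 1}, …, x'_{σ k}) = A(x₁, …, x_k; x'₁, …, x'_k)`. -/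
def IsPermSymmetric (A : Op L k) : Prop :=
  ∀ σ : Equiv.Perm (Fin k), permOp σ ∘L A = A ∘L permOp σ

/-! ### The collision operator -/

/-- An approximation of the delta function on `Λ` by continuous probability densities. -/
structure IsApproxDelta (φ : ℕ → C(Box L, ℝ)) : Prop where
  nonneg : ∀ n x, 0 ≤ φ n x
  integral_eq_one : ∀ n, ∫ x, φ n x = 1
  concentrates : ∀ U : Set (Box L), IsOpen U → 0 ∈ U →
    Tendsto (fun n => ∫ x in Uᶜ, φ n x) atTop (𝓝 0)

/-- The operator of multiplication by a continuous function on `L²(Λᵏ)`. -/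
def mulOp (f : C(Conf L k, ℂ)) : Op L k :=
  (ContinuousLinearMap.mul ℂ ℂ).holderL volume ∞ 2 2 (ContinuousMap.toLp ∞ volume ℂ f)

/-- The function `φ(x_j - x_{k+1})` on `Λᵏ⁺¹`. -/
def pairFun (φ : C(Box L, ℝ)) (j : Fin k) : C(Conf L (k + 1), ℂ) where
  toFun x := ((φ (x j.castSucc - x (Fin.last k)) : ℝ) : ℂ)
  continuous_toFun := by fun_prop

/-- The matrix elements of the partial trace `Tr_{k+1} A` over the last particle. -/
def partialTraceElement (A : Op L (k + 1)) (p p' : Mom k) : ℂ :=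
  ∑' q : Fin 2 → ℤ,
    matrixElement A (Fin.snoc (α := fun _ => Fin 2 → ℤ) p q)
      (Fin.snoc (α := fun _ => Fin 2 → ℤ) p' q)

/-- The matrix elements of `Tr_{k+1} [φ(x_j - x_{k+1}), A]`. -/
def regCollision (φ : C(Box L, ℝ)) (j : Fin k) (A : Op L (k + 1)) (p p' : Mom k) : ℂ :=
  partialTraceElement (mulOp (pairFun φ j) ∘L A - A ∘L mulOp (pairFun φ j)) p p'

/-- `B_{j,k+1} A` exists (as a distribution on `Λᵏ × Λᵏ`): all Fourier coefficients of
`Tr_{k+1} [φₙ(x_j - x_{k+1}), A]` converge when `φₙ` tends to the delta function. -/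
def CollisionExists (φ : ℕ → C(Box L, ℝ)) (j : Fin k) (A : Op L (k + 1)) : Prop :=
  ∀ p p' : Mom k, ∃ z : ℂ, Tendsto (fun n => regCollision (φ n) j A p p') atTop (𝓝 z)

/-- The Fourier coefficients of the kernel of
`B_{j,k+1} A = Tr_{k+1} [δ(x_j - x_{k+1}), A] = limₙ Tr_{k+1} [φₙ(x_j - x_{k+1}), A]`. -/
def collision (φ : ℕ → C(Box L, ℝ)) (j : Fin k) (A : Op L (k + 1)) (p p' : Mom k) : ℂ :=
  limUnder atTop (fun n => regCollision (φ n) j A p p')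

/-! ### Free evolution and Sobolev norms, on Fourier coefficients of kernels -/

/-- The eigenvalue `|π n / L|²` of `-Δ` on the plane wave `exp(i π n · x / L)` on `Λ`. -/
def laplaceEigenvalue (L : ℝ) (n : Fin 2 → ℤ) : ℝ := ∑ c : Fin 2, (Real.pi * n c / L) ^ 2

/-- The free evolution `𝒰(t) b = exp(it ∑ⱼ Δⱼ) b exp(-it ∑ⱼ Δⱼ)`, acting on the Fourier
coefficients of the kernel `b`. -/
def freeEvolution (L : ℝ) {k : ℕ} (t : ℝ) (b : Mom k → Mom k → ℂ) (p p' : Mom k) : ℂ :=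
  Complex.exp (-Complex.I * t *
    ((∑ j, laplaceEigenvalue L (p j) - ∑ j, laplaceEigenvalue L (p' j) : ℝ) : ℂ)) * b p p'

/-- The operator `S^{(k,α)} = ∏ⱼ (1 - Δ_{xⱼ})^{α/2} (1 - Δ_{x'ⱼ})^{α/2}`, acting on the Fourier
coefficients of the kernel `b`. -/
def sobolev (L : ℝ) {k : ℕ} (α : ℝ) (b : Mom k → Mom k → ℂ) (p p' : Mom k) : ℂ :=
  ((∏ j, ((1 + laplaceEigenvalue L (p j)) ^ (α / 2) *
    (1 + laplaceEigenvalue L (p' j)) ^ (α / 2)) : ℝ) : ℂ) * b p p'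

/-- The function `e_p(x) conj(e_{p'}(x'))` in `L²(Λᵏ × Λᵏ)`. -/
def kernelWave (p p' : Mom k) : Lp ℂ 2 (volume : Measure (Conf L k × Conf L k)) :=
  ContinuousMap.toLp 2 volume ℂ
    ⟨fun z => planeWaveFun L p z.1 * conj (planeWaveFun L p' z.2), by fun_prop⟩

/-- `b` is the family of Fourier coefficients of a kernel in `L²(Λᵏ × Λᵏ)` of norm at most `M`. -/
def HasL2NormLE (L : ℝ) [Fact (0 < L)] {k : ℕ} (b : Mom k → Mom k → ℂ) (M : ℝ) : Prop :=
  ∃ F : Lp ℂ 2 (volume : Measure (Conf L k × Conf L k)),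
    (∀ p p', inner ℂ (kernelWave p p') F = b p p') ∧ ‖F‖ ≤ M

/-! ### Solutions of the hierarchy -/

/-- `γ = (γ^{(k)})_{k ≥ 1}` belongs to `⨁_{k ≥ 1} C([0,T], 𝓛¹ₖ)`, consists of densities which are
symmetric under permutations, satisfies `‖S^{(k,α)} B_{j,k+1} γ^{(k+1)}_s‖_{L²} ≤ Cᵏ` for some `C`,
and solves the Gross-Pitaevskii hierarchy in Duhamel form on `[0,T]` with initial data `Γ`. -/
structure IsSolution (b₀ α T : ℝ) (J : ∀ k, ℕ → Op L k) (φ : ℕ → C(Box L, ℝ))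
    (Γ : ∀ k, Op L k) (γ : ∀ k, ℝ → Op L k) : Prop where
  curve : ∀ k, 1 ≤ k → IsTraceClassCurve T (J k) (γ k)
  symmetric : ∀ k, 1 ≤ k → ∀ t ∈ Icc 0 T, IsPermSymmetric (γ k t)
  collisionExists : ∀ k, 1 ≤ k → ∀ j : Fin k, ∀ s ∈ Icc 0 T, CollisionExists φ j (γ (k + 1) s)
  bound : ∃ C : ℝ, ∀ k, 1 ≤ k → ∀ j : Fin k, ∀ s ∈ Icc 0 T,
    HasL2NormLE L (sobolev L α (collision φ j (γ (k + 1) s))) (C ^ k)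
  initial : ∀ k, 1 ≤ k → γ k 0 = Γ k
  integrable : ∀ k, 1 ≤ k → ∀ j : Fin k, ∀ t ∈ Icc 0 T, ∀ p p' : Mom k,
    IntervalIntegrable
      (fun s => freeEvolution L (t - s) (collision φ j (γ (k + 1) s)) p p') volume 0 t
  duhamel : ∀ k, 1 ≤ k → ∀ t ∈ Icc 0 T, ∀ p p' : Mom k,
    matrixElement (γ k t) p p' = freeEvolution L t (matrixElement (Γ k)) p p'
      - Complex.I * b₀ * ∑ j : Fin k,
        ∫ s in (0 : ℝ)..t, freeEvolution L (t - s) (collision φ j (γ (k + 1) s)) p p'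

end GPHierarchy

end

/-!
Two solutions `γ`, `γ'` with the same initial data are compared through the Fourier coefficients of
their collision terms. A kernel on `Λᵏ × Λᵏ` is indexed by lists of `k` modes, a mode being the pair
of momenta of one particle in `x` and `x'`. In the interaction picture the free evolution
disappears, and after multiplication by the Sobolev weights the difference `h` of the collision
terms (`collisionFamily`) is a family of bounded functions of time whose `ℓ²` norm over the lists of
length `k` is at most `Mᵏ`, and which satisfies `h(s) = ε B(s) ∫₀ˢ h` with an explicit oscillating
collision kernel (`collisionKernel`). Permutation symmetry of the densities allows the particle
which is traced out to be put next to the one it collides with (`exists_perm_replacePair`), so that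
a collision replaces one entry of a list by two neighbouring ones.

*The space-time estimate.* A collision with fixed outgoing mode is an oscillating sum whose
frequencies are integer multiples of `2 (π / L)²`. By orthogonality in time, and the Cauchy-Schwarz
inequality on each frequency, its `L²` norm in time is controlled by the sum of
`⟨p⟩^{2α} / (⟨p₁⟩ ⟨p₂⟩ ⟨p₃⟩)^{2α}` over the momenta with `p₁ + p₂ = p + p₃` and a given value of
`(p - p₁) · (p - p₂)`. This sum is bounded as soon as `2α > 1` (`exists_sum_resonance_le`): the
largest of the three momenta cancels the numerator, and among the two others the larger one lies,
given the smaller one, on a line or on a circle. On lines one counts directly, gaining from the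
spacing of lattice points; on circles the divisor bound for Gaussian integers applies, since three
lattice points close to each other force the radius to be small (`exists_card_circle_le`).

*The Duhamel expansion.* For sums restricted to a finite set `K` of modes, iterating the equation
`m` times gives a sum over the forests of binary trees with `m` nodes. The restriction of the times
is that they decrease along the branches of each tree, so that the trees factorize and the factorial
number of time orderings never appears: induction on the tree, with one space-time estimate for each
node, bounds a tree with `m` nodes as an operator on `ℓ²` by `θᵐ` times a Catalan number, uniformly
in `K`, on intervals of length `δ` of the order of `θ²` (`treeKernelBound_and_treeDerivBound`,
`forestKernel_bound`).

*The limits.* The true collision terms are iterated limits of finite sums: over the exchanged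
momentum, over the momentum of the particle which is traced out, and as the approximations tend to
the delta function. The same space-time estimate and Fatou's lemma bound the error of the
restriction to `K` by the part of `h` which is not carried by `K` (`lintegral_collision_sub_le`),
hence it tends to zero as `K` increases. With `m` collisions there remains a bound
`(m + 1)ᵏ (4 θ ‖ε‖ M)ᵐ` up to a constant, which tends to zero with `m → ∞` if `θ`, hence `δ`, is
small (`exists_forall_integral_eq_zero`). The length `δ` depends on `M` only, and finitely many
steps cover `[0, T]` (`integral_collisionFamily_eq_zero`).
-/


namespace GPHierarchy

/-! ### The divisor bound for Gaussian integers -/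

theorem add_one_le_mul_rpow {ε : ℝ} (hε : 0 < ε) :
    ∃ C : ℝ, 1 ≤ C ∧ ∀ (a : ℕ) (x : ℝ), 2 ≤ x → (a + 1 : ℝ) ≤ C * x ^ (ε * a) := by
  have hl : 0 < Real.log 2 := Real.log_pos (by norm_num)
  refine ⟨max 1 (1 / (ε * Real.log 2)), le_max_left _ _, fun a x hx => ?_⟩
  set C := max 1 (1 / (ε * Real.log 2)) with hC
  have h1 : 1 ≤ C := le_max_left _ _
  have h2 : 1 ≤ C * (ε * Real.log 2) := by
    have := le_max_right 1 (1 / (ε * Real.log 2))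
    rwa [← hC, div_le_iff₀ (by positivity)] at this
  have h3 : 1 + ε * Real.log 2 * a ≤ x ^ (ε * a) := by
    calc 1 + ε * Real.log 2 * a ≤ Real.exp (ε * Real.log 2 * a) := by
          have := Real.add_one_le_exp (ε * Real.log 2 * a); linarith
      _ = 2 ^ (ε * a) := by
          rw [Real.rpow_def_of_pos (by norm_num)]; ring_nf
      _ ≤ x ^ (ε * a) := Real.rpow_le_rpow (by norm_num) hx (by positivity)
  calc (a + 1 : ℝ) ≤ C * (ε * Real.log 2) * a + C := by
        nlinarith [mul_le_mul_of_nonneg_right h2 (Nat.cast_nonneg (α := ℝ) a)]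
    _ = C * (1 + ε * Real.log 2 * a) := by ring
    _ ≤ C * x ^ (ε * a) := by gcongr

theorem finite_gaussianInt_norm_le (B : ℝ) : {z : GaussianInt | (z.norm : ℝ) ≤ B}.Finite := by
  obtain ⟨M, hM⟩ := exists_nat_ge B
  have hf : ((fun p : ℤ × ℤ => (⟨p.1, p.2⟩ : GaussianInt)) ''
      (Icc (-(M : ℤ)) M ×ˢ Icc (-(M : ℤ)) M)).Finite :=
    ((Set.finite_Icc _ _).prod (Set.finite_Icc _ _)).image _
  refine hf.subset fun z hz => ⟨(z.re, z.im), ?_, rfl⟩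
  have h : z.norm ≤ M := by
    have : (z.norm : ℝ) ≤ M := le_trans hz hM
    exact_mod_cast this
  rw [Zsqrtd.norm_def] at h
  simp only [mem_prod, mem_Icc]
  refine ⟨⟨?_, ?_⟩, ?_, ?_⟩ <;>
    nlinarith [Int.natCast_nonneg M, mul_self_nonneg z.re, mul_self_nonneg z.im]

/-- The divisor bound for multisets of Gaussian integers which are neither zero nor units. For
`z` of norm at least `2 ^ (1 / ε)` one has `a + 1 ≤ 2 ^ a ≤ N z ^ (ε a)` for every multiplicity
`a`, so that only the finitely many remaining `z` contribute to the constant. -/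
theorem exists_card_submultiset_le {ε : ℝ} (hε : 0 < ε) :
    ∃ C : ℝ, 1 ≤ C ∧ ∀ s : Multiset GaussianInt, (∀ z ∈ s, 2 ≤ z.norm) →
      (∏ z ∈ s.toFinset, ((s.count z : ℝ) + 1)) ≤ C * (s.prod.norm : ℝ) ^ ε := by
  obtain ⟨C₀, hC₀, h0⟩ := add_one_le_mul_rpow hε
  set B : ℝ := 2 ^ (1 / ε) with hB
  set small := (finite_gaussianInt_norm_le B).toFinset with hsmall
  refine ⟨C₀ ^ small.card, one_le_pow₀ hC₀, fun s hs => ?_⟩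
  have key : ∀ z ∈ s.toFinset, ((s.count z : ℝ) + 1) ≤
      (if z ∈ small then C₀ else 1) * (z.norm : ℝ) ^ (ε * s.count z) := by
    intro z hz
    have h2 : (2 : ℝ) ≤ z.norm := by exact_mod_cast hs z (Multiset.mem_toFinset.1 hz)
    split_ifs with h
    · exact h0 _ _ h2
    · have hb : B < z.norm := by
        simpa [hsmall] using h
      have h3 : (2 : ℝ) ≤ (z.norm : ℝ) ^ ε := by
        have : B ^ ε ≤ (z.norm : ℝ) ^ ε :=
          Real.rpow_le_rpow (by positivity) hb.le hε.le
        rwa [hB, ← Real.rpow_mul (by norm_num), one_div_mul_cancel hε.ne', Real.rpow_one] at this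
      rw [one_mul, Real.rpow_mul (by linarith), Real.rpow_natCast]
      have h4 : (s.count z : ℝ) + 1 ≤ 2 ^ s.count z := by
        exact_mod_cast Nat.succ_le_of_lt (Nat.lt_two_pow_self (n := s.count z))
      exact h4.trans (pow_le_pow_left₀ (by norm_num) h3 _)
  have hn : (s.prod.norm : ℝ) = ∏ z ∈ s.toFinset, (z.norm : ℝ) ^ (s.count z) := by
    have h1 : s.prod.norm = (s.map Zsqrtd.norm).prod :=
      map_multiset_prod (Zsqrtd.normMonoidHom (d := -1)) s
    rw [h1, Finset.prod_multiset_map_count]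
    push_cast
    rfl
  have hpos : ∀ z ∈ s.toFinset, (0 : ℝ) ≤ z.norm := fun z _ => by
    exact_mod_cast GaussianInt.norm_nonneg z
  calc (∏ z ∈ s.toFinset, ((s.count z : ℝ) + 1))
      ≤ ∏ z ∈ s.toFinset, ((if z ∈ small then C₀ else 1) * (z.norm : ℝ) ^ (ε * s.count z)) :=
        Finset.prod_le_prod (fun _ _ => by positivity) key
    _ = (∏ z ∈ s.toFinset, (if z ∈ small then C₀ else 1)) *
        ∏ z ∈ s.toFinset, (z.norm : ℝ) ^ (ε * s.count z) := Finset.prod_mul_distrib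
    _ ≤ C₀ ^ small.card * (s.prod.norm : ℝ) ^ ε := by
        gcongr
        · exact Finset.prod_nonneg fun z hz => Real.rpow_nonneg (hpos z hz) _
        · rw [← Finset.prod_filter, Finset.prod_const]
          exact pow_le_pow_right₀ hC₀ (Finset.card_le_card fun z hz => (Finset.mem_filter.1 hz).2)
        · rw [hn, ← Real.finsetProd_rpow _ _ fun z hz => pow_nonneg (hpos z hz) _]
          refine (Finset.prod_congr rfl fun z hz => ?_).le
          rw [mul_comm, Real.rpow_mul (hpos z hz), Real.rpow_natCast]

/-- The number of representations of `n` as a sum of two squares is `O(n ^ ε)`: a Gaussian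
integer of norm `n` divides `n`, and is determined up to a unit by its prime factors, which form
a submultiset of those of `n`. -/
theorem exists_card_norm_eq_le {ε : ℝ} (hε : 0 < ε) :
    ∃ C : ℝ, 1 ≤ C ∧ ∀ (n : ℤ) (S : Finset GaussianInt), 0 < n → (∀ z ∈ S, z.norm = n) →
      (S.card : ℝ) ≤ C * (n : ℝ) ^ ε := by
  classical
  let _ : StrongNormalizationMonoid GaussianInt :=
    UniqueFactorizationMonoid.strongNormalizationMonoid
  -- the norm of `n` as a Gaussian integer is `n ^ 2`, hence the exponent `ε / 2`
  obtain ⟨C, hC, h⟩ := exists_card_submultiset_le (half_pos hε)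
  refine ⟨9 * C, by linarith, fun n S hn hS => ?_⟩
  have hn0 : ((n : ℤ) : GaussianInt) ≠ 0 := by exact_mod_cast hn.ne'
  set F := UniqueFactorizationMonoid.normalizedFactors (n : GaussianInt) with hF
  have hz0 : ∀ z ∈ S, z ≠ 0 := by
    rintro z hz rfl
    have := hS 0 hz
    simp at this; omega
  -- a Gaussian integer of norm `n` divides `n`
  have himg : S.image UniqueFactorizationMonoid.normalizedFactors ⊆ Finset.Iic F := by
    intro m hm
    obtain ⟨z, hz, rfl⟩ := Finset.mem_image.1 hm
    rw [Finset.mem_Iic, hF,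
      ← UniqueFactorizationMonoid.dvd_iff_normalizedFactors_le_normalizedFactors (hz0 z hz) hn0]
    refine ⟨star z, ?_⟩
    rw [← hS z hz, Zsqrtd.norm_eq_mul_conj]
  -- units have coordinates in `{-1, 0, 1}`; this gives at most `9` of them
  have hfib : ∀ m ∈ S.image UniqueFactorizationMonoid.normalizedFactors,
      (S.filter fun x => UniqueFactorizationMonoid.normalizedFactors x = m).card ≤ 9 := by
    intro m hm
    obtain ⟨z, hz, rfl⟩ := Finset.mem_image.1 hm
    have hsub : (S.filter fun x => UniqueFactorizationMonoid.normalizedFactors x =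
        UniqueFactorizationMonoid.normalizedFactors z) ⊆
        (Finset.Icc (-1 : ℤ) 1 ×ˢ Finset.Icc (-1 : ℤ) 1).image
          (fun p => z * (⟨p.1, p.2⟩ : GaussianInt)) := by
      intro x hx
      obtain ⟨hxS, hx⟩ := Finset.mem_filter.1 hx
      have has : Associated z x :=
        ((UniqueFactorizationMonoid.associated_iff_normalizedFactors_eq_normalizedFactors
          (hz0 z hz) (hz0 x hxS)).2 hx.symm)
      obtain ⟨u, hu⟩ := has
      have hu1 : (u : GaussianInt).norm = 1 := by
        have h1 := congrArg Zsqrtd.norm hu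
        rw [Zsqrtd.norm_mul, hS z hz, hS x hxS] at h1
        exact mul_left_cancel₀ hn.ne' (by rw [h1, mul_one])
      refine Finset.mem_image.2 ⟨((u : GaussianInt).re, (u : GaussianInt).im), ?_, hu⟩
      rw [Zsqrtd.norm_def] at hu1
      simp only [Finset.mem_product, Finset.mem_Icc]
      refine ⟨⟨?_, ?_⟩, ?_, ?_⟩ <;>
        nlinarith [mul_self_nonneg (u : GaussianInt).re, mul_self_nonneg (u : GaussianInt).im]
    exact (Finset.card_le_card hsub).trans (Finset.card_image_le.trans (by simp))
  have h1 : (S.card : ℝ) ≤ 9 * (Finset.Iic F).card := by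
    exact_mod_cast (Finset.card_le_mul_card_image S 9 hfib).trans
      (Nat.mul_le_mul_left 9 (Finset.card_le_card himg))
  have h2 : ((Finset.Iic F).card : ℝ) ≤ C * ((F.prod).norm : ℝ) ^ (ε / 2) := by
    rw [Multiset.card_Iic]
    push_cast
    refine h F fun z hz => ?_
    have hp := UniqueFactorizationMonoid.prime_of_normalized_factor z hz
    have hp1 : 0 < z.norm := GaussianInt.norm_pos.2 hp.ne_zero
    have hp2 : z.norm ≠ 1 := fun h1 =>
      hp.not_isUnit ((Zsqrtd.norm_eq_one_iff' (by norm_num) z).1 h1)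
    omega
  have h3 : ((F.prod).norm : ℝ) = (n : ℝ) ^ (2 : ℝ) := by
    have hass := UniqueFactorizationMonoid.prod_normalizedFactors hn0
    obtain ⟨u, hu⟩ := hass
    have hu1 : (u : GaussianInt).norm = 1 := by
      exact (Zsqrtd.norm_eq_one_iff' (by norm_num) _).2 u.isUnit
    have h4 := congrArg Zsqrtd.norm hu
    rw [Zsqrtd.norm_mul, hu1, mul_one, Zsqrtd.norm_intCast] at h4
    rw [hF, h4]
    norm_cast
    ring
  rw [h3, ← Real.rpow_mul (by exact_mod_cast hn.le), mul_div_cancel₀ _ two_ne_zero] at h2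
  linarith

end GPHierarchy

namespace GPHierarchy

/-! ### Sums over lattice points in the plane and on lines -/

/-- The sup norm on `ℤ²`. -/
def supNorm (z : Fin 2 → ℤ) : ℕ := max (z 0).natAbs (z 1).natAbs

/-- The Japanese bracket `1 + |z|_∞` on `ℤ²`. -/
def bracket (z : Fin 2 → ℤ) : ℕ := 1 + supNorm z

theorem one_le_bracket (z : Fin 2 → ℤ) : 1 ≤ bracket z := by unfold bracket; omega

theorem bracket_pos (z : Fin 2 → ℤ) : (0 : ℝ) < bracket z := by
  exact_mod_cast one_le_bracket z

theorem abs_le_of_bracket_le {z : Fin 2 → ℤ} {X : ℕ} (h : bracket z ≤ X) (c : Fin 2) :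
    |z c| ≤ X := by
  unfold bracket supNorm at h
  have key : ∀ c, (z c).natAbs ≤ X := Fin.forall_fin_two.2 ⟨by omega, by omega⟩
  rw [Int.abs_eq_natAbs]
  exact_mod_cast key c

theorem supNorm_pos {e : Fin 2 → ℤ} (he : e ≠ 0) : 1 ≤ supNorm e := by
  by_contra h
  apply he
  unfold supNorm at h
  funext c
  fin_cases c <;> simp <;> omega

/-- Dyadic decomposition of a sum of negative powers of the bracket, over points outside a ball
of radius `r`. -/
theorem exists_sum_bracket_rpow_le_dyadic {s : ℝ} (hs : 0 ≤ s) {r : ℕ} (hr : 1 ≤ r)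
    (S : Finset (Fin 2 → ℤ)) (hS : ∀ z ∈ S, r ≤ bracket z) :
    ∃ n : ℕ, ∑ z ∈ S, (bracket z : ℝ) ^ (-s) ≤ ∑ j ∈ Finset.range n,
      ((S.filter fun z => bracket z ≤ 2 ^ (j + 1) * r).card : ℝ) *
        ((2 ^ j * r : ℕ) : ℝ) ^ (-s) := by
  set f : (Fin 2 → ℤ) → ℕ := fun z => Nat.log 2 (bracket z / r) with hf
  obtain ⟨n, hn⟩ : ∃ n, ∀ z ∈ S, f z < n := by
    refine ⟨S.sup f + 1, fun z hz => Nat.lt_succ_of_le (Finset.le_sup hz)⟩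
  refine ⟨n, ?_⟩
  have key : ∀ z ∈ S, (bracket z : ℝ) ^ (-s) ≤ ∑ j ∈ Finset.range n,
      if bracket z ≤ 2 ^ (j + 1) * r then ((2 ^ j * r : ℕ) : ℝ) ^ (-s) else 0 := by
    intro z hz
    have hq : bracket z / r ≠ 0 := (Nat.div_pos (hS z hz) hr).ne'
    have h1 : 2 ^ f z * r ≤ bracket z :=
      (Nat.le_div_iff_mul_le hr).1 (Nat.pow_log_le_self 2 hq)
    have h2 : bracket z ≤ 2 ^ (f z + 1) * r :=
      ((Nat.div_lt_iff_lt_mul hr).1 (Nat.lt_pow_succ_log_self (by norm_num) _)).le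
    have h3 : (bracket z : ℝ) ^ (-s) ≤ ((2 ^ f z * r : ℕ) : ℝ) ^ (-s) := by
      apply Real.rpow_le_rpow_of_nonpos
      · exact_mod_cast Nat.mul_pos (by positivity) hr
      · exact_mod_cast h1
      · linarith
    refine h3.trans ?_
    have := Finset.single_le_sum (f := fun j => if bracket z ≤ 2 ^ (j + 1) * r then
      ((2 ^ j * r : ℕ) : ℝ) ^ (-s) else 0) (fun j _ => by positivity)
      (Finset.mem_range.2 (hn z hz))
    simpa only [if_pos h2] using this
  refine (Finset.sum_le_sum key).trans ?_
  rw [Finset.sum_comm]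
  refine (Finset.sum_congr rfl fun j _ => ?_).le
  rw [← Finset.sum_filter, Finset.sum_const, nsmul_eq_mul]

theorem exists_dyadic_sum_le {s η : ℝ} (hη : η < s) :
    ∃ C : ℝ, 0 < C ∧ ∀ (r : ℕ) (n : ℕ), 1 ≤ r → ∑ j ∈ Finset.range n,
      ((2 ^ (j + 1) * r : ℕ) : ℝ) ^ η * ((2 ^ j * r : ℕ) : ℝ) ^ (-s) ≤ C * (r : ℝ) ^ (η - s) := by
  set q : ℝ := 2 ^ (η - s) with hq
  have hq0 : 0 < q := by positivity
  have hq1 : q < 1 := Real.rpow_lt_one_of_one_lt_of_neg (by norm_num) (by linarith)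
  refine ⟨2 ^ η / (1 - q), div_pos (by positivity) (by linarith), fun r n hr => ?_⟩
  have hr0 : (0 : ℝ) < r := by exact_mod_cast hr
  have h1 : ∀ j ∈ Finset.range n, ((2 ^ (j + 1) * r : ℕ) : ℝ) ^ η * ((2 ^ j * r : ℕ) : ℝ) ^ (-s)
      = 2 ^ η * (r : ℝ) ^ (η - s) * q ^ j := by
    intro j _
    have e1 : ((2 ^ (j + 1) * r : ℕ) : ℝ) = 2 * (2 ^ j * r) := by push_cast; ring
    have e2 : ((2 ^ j * r : ℕ) : ℝ) = 2 ^ j * r := by push_cast; ring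
    rw [e1, e2, Real.mul_rpow (by norm_num) (by positivity), mul_assoc,
      ← Real.rpow_add (by positivity), ← sub_eq_add_neg, Real.mul_rpow (by positivity) hr0.le, hq,
      ← Real.rpow_natCast, ← Real.rpow_natCast, ← Real.rpow_mul (by norm_num),
      ← Real.rpow_mul (by norm_num), mul_comm (j : ℝ)]
    ring
  rw [Finset.sum_congr rfl h1, ← Finset.mul_sum]
  have h2 : ∑ j ∈ Finset.range n, q ^ j ≤ 1 / (1 - q) := by
    rw [geom_sum_eq hq1.ne, le_div_iff₀ (by linarith), ← neg_div_neg_eq, neg_sub, neg_sub,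
      div_mul_cancel₀ _ (by linarith)]
    have : 0 ≤ q ^ n := by positivity
    linarith
  calc 2 ^ η * (r : ℝ) ^ (η - s) * ∑ j ∈ Finset.range n, q ^ j
      ≤ 2 ^ η * (r : ℝ) ^ (η - s) * (1 / (1 - q)) := by gcongr
    _ = _ := by ring

/-- Sums of negative powers of the bracket over a set with a polynomial counting function, outside
a ball of radius `r`. The second term of the counting function only serves lattice points on
lines, where it is `1 + X / |e|`. -/
theorem exists_sum_bracket_rpow_le {s η θ : ℝ} (hs : 0 ≤ s) (hη : η < s) (hθ : θ < s) :
    ∃ C : ℝ, 0 < C ∧ ∀ (A B : ℝ) (r : ℕ) (S : Finset (Fin 2 → ℤ)), 0 ≤ A → 0 ≤ B → 1 ≤ r →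
      (∀ z ∈ S, r ≤ bracket z) →
      (∀ X : ℕ, 1 ≤ X → ((S.filter fun z => bracket z ≤ X).card : ℝ)
        ≤ A * (X : ℝ) ^ η + B * (X : ℝ) ^ θ) →
      ∑ z ∈ S, (bracket z : ℝ) ^ (-s) ≤ C * (A * (r : ℝ) ^ (η - s) + B * (r : ℝ) ^ (θ - s)) := by
  obtain ⟨C₁, hC₁, h₁⟩ := exists_dyadic_sum_le hη
  obtain ⟨C₂, hC₂, h₂⟩ := exists_dyadic_sum_le hθ
  refine ⟨C₁ + C₂, by positivity, fun A B r S hA hB hr hS hc => ?_⟩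
  obtain ⟨n, hn⟩ := exists_sum_bracket_rpow_le_dyadic hs hr S hS
  have h3 : ∀ j ∈ Finset.range n, ((S.filter fun z => bracket z ≤ 2 ^ (j + 1) * r).card : ℝ) *
        ((2 ^ j * r : ℕ) : ℝ) ^ (-s) ≤
      A * (((2 ^ (j + 1) * r : ℕ) : ℝ) ^ η * ((2 ^ j * r : ℕ) : ℝ) ^ (-s)) +
      B * (((2 ^ (j + 1) * r : ℕ) : ℝ) ^ θ * ((2 ^ j * r : ℕ) : ℝ) ^ (-s)) := by
    intro j _
    have := hc (2 ^ (j + 1) * r) (Nat.mul_pos (by positivity) hr)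
    calc _ ≤ (A * ((2 ^ (j + 1) * r : ℕ) : ℝ) ^ η + B * ((2 ^ (j + 1) * r : ℕ) : ℝ) ^ θ) *
        ((2 ^ j * r : ℕ) : ℝ) ^ (-s) := by gcongr
      _ = _ := by ring
  refine hn.trans ((Finset.sum_le_sum h3).trans ?_)
  rw [Finset.sum_add_distrib, ← Finset.mul_sum, ← Finset.mul_sum]
  have h4 := mul_le_mul_of_nonneg_left (h₁ r n hr) hA
  have h5 := mul_le_mul_of_nonneg_left (h₂ r n hr) hB
  have h6 : 0 ≤ A * (r : ℝ) ^ (η - s) := by positivity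
  have h7 : 0 ≤ B * (r : ℝ) ^ (θ - s) := by positivity
  nlinarith [mul_nonneg hC₂.le h6, mul_nonneg hC₁.le h7]

theorem exists_sum_plane_le {t : ℝ} (ht : 2 < t) :
    ∃ C : ℝ, 0 < C ∧ ∀ S : Finset (Fin 2 → ℤ), ∑ z ∈ S, (bracket z : ℝ) ^ (-t) ≤ C := by
  obtain ⟨C, hC, h⟩ := exists_sum_bracket_rpow_le (s := t) (η := 2) (θ := 2)
    (by linarith) ht ht
  refine ⟨C * 9, by positivity, fun S => ?_⟩
  have := h 9 0 1 S (by norm_num) le_rfl le_rfl (fun z _ => one_le_bracket z) ?_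
  · simpa using this
  · intro X hX
    have hsub : ((S.filter fun z => bracket z ≤ X).card : ℝ) ≤ (2 * X + 1) * (2 * X + 1) := by
      have hinj : Function.Injective (fun z : Fin 2 → ℤ => (z 0, z 1)) := by
        intro z z' hz
        simp only [Prod.mk.injEq] at hz
        funext c
        fin_cases c
        · exact hz.1
        · exact hz.2
      have h1 : ((S.filter fun z => bracket z ≤ X).image (fun z => (z 0, z 1))) ⊆
          Finset.Icc (-(X : ℤ)) X ×ˢ Finset.Icc (-(X : ℤ)) X := by
        intro p hp
        obtain ⟨z, hz, rfl⟩ := Finset.mem_image.1 hp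
        have hz2 := (Finset.mem_filter.1 hz).2
        have h0 := abs_le.1 (abs_le_of_bracket_le hz2 0)
        have h1 := abs_le.1 (abs_le_of_bracket_le hz2 1)
        simp only [Finset.mem_product, Finset.mem_Icc]
        exact ⟨h0, h1⟩
      have h2 := Finset.card_le_card h1
      rw [Finset.card_image_of_injective _ hinj, Finset.card_product, Int.card_Icc] at h2
      have h3 : ((X : ℤ) + 1 - -(X : ℤ)).toNat = 2 * X + 1 := by omega
      rw [h3] at h2
      exact_mod_cast h2
    have hX' : (1 : ℝ) ≤ X := by exact_mod_cast hX
    rw [zero_mul, add_zero, Real.rpow_two]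
    nlinarith

theorem card_int_le_of_dist {T : Finset ℤ} {D : ℝ} (hD : 0 ≤ D)
    (h : ∀ m ∈ T, ∀ n ∈ T, ((n - m : ℤ) : ℝ) ≤ D) : (T.card : ℝ) ≤ D + 1 := by
  rcases T.eq_empty_or_nonempty with rfl | hT
  · simp; linarith
  have hsub : T ⊆ Finset.Icc (T.min' hT) (T.min' hT + ⌊D⌋) := by
    intro n hn
    rw [Finset.mem_Icc]
    refine ⟨T.min'_le n hn, ?_⟩
    have := Int.le_floor.2 (h _ (T.min'_mem hT) n hn)
    omega
  have h1 := Finset.card_le_card hsub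
  rw [Int.card_Icc] at h1
  have h2 : (T.card : ℤ) ≤ ⌊D⌋ + 1 := by
    have := Int.floor_nonneg.2 hD
    omega
  have h3 : (T.card : ℝ) ≤ (⌊D⌋ : ℝ) + 1 := by exact_mod_cast h2
  linarith [Int.floor_le D]

/-- The number of points `a + n e` of a line in a ball. -/
theorem card_line_le {a e : Fin 2 → ℤ} (he : e ≠ 0) (T : Finset (Fin 2 → ℤ)) (X : ℕ)
    (hline : ∀ z ∈ T, ∃ n : ℤ, z = a + n • e) (hX : ∀ z ∈ T, bracket z ≤ X) :
    (T.card : ℝ) ≤ 2 * X / supNorm e + 1 := by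
  choose! f hf using hline
  have hE : (0 : ℝ) < supNorm e := by exact_mod_cast supNorm_pos he
  have hinj : Set.InjOn f T := by
    intro z hz z' hz' h
    rw [hf z hz, hf z' hz', h]
  rw [← Finset.card_image_of_injOn hinj]
  apply card_int_le_of_dist (by positivity)
  intro m hm n hn
  obtain ⟨z, hz, rfl⟩ := Finset.mem_image.1 hm
  obtain ⟨z', hz', rfl⟩ := Finset.mem_image.1 hn
  obtain ⟨c, hc⟩ : ∃ c, |e c| = supNorm e := by
    rcases max_choice (e 0).natAbs (e 1).natAbs with h | h
    · exact ⟨0, by rw [supNorm, h]; simp⟩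
    · exact ⟨1, by rw [supNorm, h]; simp⟩
  have h1 : (f z' - f z) * e c = z' c - z c := by
    have h2 := congrFun (hf z hz) c
    have h3 := congrFun (hf z' hz') c
    simp only [Pi.add_apply, Pi.smul_apply, smul_eq_mul] at h2 h3
    rw [h2, h3]; ring
  have h4 : |f z' - f z| * (supNorm e : ℤ) ≤ 2 * X := by
    rw [← hc, ← abs_mul, h1]
    have h5 := abs_le.1 (abs_le_of_bracket_le (hX z hz) c)
    have h6 := abs_le.1 (abs_le_of_bracket_le (hX z' hz') c)
    rw [abs_le]; constructor <;> linarith [h5.1, h5.2, h6.1, h6.2]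
  rw [le_div_iff₀ hE]
  have h7 : (f z' - f z) * (supNorm e : ℤ) ≤ 2 * X :=
    le_trans (mul_le_mul_of_nonneg_right (le_abs_self _) (by positivity)) h4
  exact_mod_cast h7

theorem exists_sum_line_le {s : ℝ} (hs : 1 < s) :
    ∃ C : ℝ, 0 < C ∧ ∀ (a e : Fin 2 → ℤ) (r : ℕ) (S : Finset (Fin 2 → ℤ)), e ≠ 0 → 1 ≤ r →
      (∀ z ∈ S, ∃ n : ℤ, z = a + n • e) → (∀ z ∈ S, r ≤ bracket z) →
      ∑ z ∈ S, (bracket z : ℝ) ^ (-s) ≤ C * ((r : ℝ) ^ (-s) + (r : ℝ) ^ (1 - s) / supNorm e) := by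
  obtain ⟨C, hC, h⟩ := exists_sum_bracket_rpow_le (s := s) (η := 0) (θ := 1)
    (by linarith) (by linarith) hs
  refine ⟨C * 2, by positivity, fun a e r S he hr hl hS => ?_⟩
  have hE : (0 : ℝ) < supNorm e := by exact_mod_cast supNorm_pos he
  have := h 1 (2 / supNorm e) r S zero_le_one (by positivity) hr hS ?_
  · rw [zero_sub, one_mul] at this
    refine this.trans ?_
    have h1 : 0 ≤ (r : ℝ) ^ (-s) := by positivity
    have h2 : 2 / (supNorm e : ℝ) * (r : ℝ) ^ (1 - s) = 2 * ((r : ℝ) ^ (1 - s) / supNorm e) := by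
      ring
    rw [h2, mul_assoc]
    gcongr
    linarith
  · intro X hX
    have := card_line_le (a := a) he (S.filter fun z => bracket z ≤ X) X
      (fun z hz => hl z (Finset.mem_filter.1 hz).1) (fun z hz => (Finset.mem_filter.1 hz).2)
    rw [Real.rpow_zero, Real.rpow_one]
    calc _ ≤ _ := this
      _ = _ := by ring

/-- The primitive vector in the direction of `u`. -/
def primDir (u : Fin 2 → ℤ) : Fin 2 → ℤ := fun c => u c / (Int.gcd (u 0) (u 1) : ℤ)

theorem gcd_smul_primDir (u : Fin 2 → ℤ) : u = (Int.gcd (u 0) (u 1) : ℤ) • primDir u := by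
  funext c
  simp only [Pi.smul_apply, smul_eq_mul, primDir]
  rw [Int.mul_ediv_cancel']
  fin_cases c
  · exact Int.gcd_dvd_left ..
  · exact Int.gcd_dvd_right ..

theorem primDir_ne_zero {u : Fin 2 → ℤ} (hu : u ≠ 0) : primDir u ≠ 0 := by
  intro h
  apply hu
  rw [gcd_smul_primDir u, h, smul_zero]

theorem isCoprime_primDir {u : Fin 2 → ℤ} (hu : u ≠ 0) : IsCoprime (primDir u 0) (primDir u 1) := by
  have hg : 0 < Int.gcd (u 0) (u 1) := by
    rw [Nat.pos_iff_ne_zero]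
    intro h
    apply hu
    rw [gcd_smul_primDir u, h]
    simp
  exact Int.isCoprime_iff_gcd_eq_one.2 (Int.gcd_div_gcd_div_gcd hg)

/-- The lattice points perpendicular to `u` are the multiples of the rotated primitive vector. -/
theorem exists_eq_smul_perp {u w : Fin 2 → ℤ} (hu : u ≠ 0) (h : u 0 * w 0 + u 1 * w 1 = 0) :
    ∃ n : ℤ, w = n • ![-primDir u 1, primDir u 0] := by
  obtain ⟨a, b, hab⟩ := isCoprime_primDir hu
  have h0 : u 0 = (Int.gcd (u 0) (u 1) : ℤ) * primDir u 0 := congrFun (gcd_smul_primDir u) 0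
  have h1 : u 1 = (Int.gcd (u 0) (u 1) : ℤ) * primDir u 1 := congrFun (gcd_smul_primDir u) 1
  have hg : (Int.gcd (u 0) (u 1) : ℤ) ≠ 0 := by
    intro h
    apply hu
    rw [gcd_smul_primDir u, h, zero_smul]
  have he : primDir u 0 * w 0 + primDir u 1 * w 1 = 0 := by
    apply mul_left_cancel₀ hg
    linear_combination h - w 0 * h0 - w 1 * h1
  refine ⟨w 1 * a - w 0 * b, ?_⟩
  funext c
  fin_cases c
  · simp
    linear_combination (-(w 0)) * hab + a * he
  · simp
    linear_combination (-(w 1)) * hab + b * he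

theorem supNorm_perp (e : Fin 2 → ℤ) : supNorm ![-e 1, e 0] = supNorm e := by
  simp [supNorm, max_comm]

end GPHierarchy

namespace GPHierarchy

/-! ### Pairs of lattice points, the second on a line or a circle given by the first -/

/-- A finite sum over pairs as an iterated sum, where both summation sets come from the set of
pairs. -/
theorem exists_sum_pairs_eq {α β : Type*} (P : Finset (α × β)) (f : α → β → ℝ) :
    ∃ (S : Finset α) (T : α → Finset β), (∀ x ∈ S, ∃ y, (x, y) ∈ P) ∧
      (∀ x y, y ∈ T x → (x, y) ∈ P) ∧ ∑ z ∈ P, f z.1 z.2 = ∑ x ∈ S, ∑ y ∈ T x, f x y := by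
  classical
  have hT : ∀ x y, y ∈ (P.filter fun z => z.1 = x).image Prod.snd → (x, y) ∈ P := by
    intro x y h
    obtain ⟨z, hz, rfl⟩ := Finset.mem_image.1 h
    obtain ⟨h1, rfl⟩ := Finset.mem_filter.1 hz
    exact h1
  refine ⟨P.image Prod.fst, fun x => (P.filter fun z => z.1 = x).image Prod.snd, ?_, hT,
    Finset.sum_finset_product' P _ _ fun z => ⟨fun h => ⟨Finset.mem_image_of_mem _ h,
      Finset.mem_image.2 ⟨z, by simp [h], rfl⟩⟩, fun h => hT _ _ h.2⟩⟩
  intro x hx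
  obtain ⟨z, hz, rfl⟩ := Finset.mem_image.1 hx
  exact ⟨z.2, hz⟩

/-- The sum over the first point of a pair, after the second one has been summed over the line
`{y | (p - x) · y = κ x}`; the spacing of this line is the length of the primitive vector in the
direction of `p - x`, and the sum is reorganized according to this vector. -/
theorem exists_sum_primDir_le {s : ℝ} (hs : 1 < s) :
    ∃ C : ℝ, 0 < C ∧ ∀ (p : Fin 2 → ℤ) (S : Finset (Fin 2 → ℤ)), (∀ x ∈ S, x ≠ p) →
      ∑ x ∈ S, (bracket x : ℝ) ^ (1 - 2 * s) / supNorm (primDir (p - x)) ≤ C := by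
  obtain ⟨C₁, hC₁, h₁⟩ := exists_sum_plane_le (t := 2 * s) (by linarith)
  obtain ⟨C₂, hC₂, h₂⟩ := exists_sum_line_le (s := 2 * s - 1) (by linarith)
  refine ⟨C₁ + C₂ * 2 * (2 ^ (2 * s) * C₁), by positivity, fun p S hS => ?_⟩
  set e : (Fin 2 → ℤ) → (Fin 2 → ℤ) := fun x => primDir (p - x) with he
  have he0 : ∀ x ∈ S, e x ≠ 0 := fun x hx =>
    primDir_ne_zero (sub_ne_zero.2 (hS x hx).symm)
  -- if the primitive vector is longer than `x`, the exponent becomes `-2 s < -2`; otherwise all `x`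
  -- with the same primitive vector `v` lie on the line `p + ℤ v`, outside the ball of radius `|v|`,
  -- and the sum over this line is `O(|v| ^ (-2 s))`
  rw [← Finset.sum_filter_add_sum_filter_not S (fun x => bracket x ≤ supNorm (e x))]
  apply add_le_add
  · refine le_trans (Finset.sum_le_sum fun x hx => ?_)
      (h₁ (S.filter fun x => bracket x ≤ supNorm (e x)))
    have hb := bracket_pos x
    have h3 : (bracket x : ℝ) ≤ supNorm (e x) := by exact_mod_cast (Finset.mem_filter.1 hx).2
    rw [div_le_iff₀ (hb.trans_le h3)]
    calc (bracket x : ℝ) ^ (1 - 2 * s) = (bracket x : ℝ) ^ (-(2 * s)) * bracket x := by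
          rw [sub_eq_neg_add, Real.rpow_add hb, Real.rpow_one]
      _ ≤ _ := by gcongr
  · set S' := S.filter fun x => ¬ bracket x ≤ supNorm (e x) with hS'
    rw [← Finset.sum_fiberwise_of_maps_to (g := e) (t := S'.image e)
      (fun x hx => Finset.mem_image_of_mem _ hx)]
    have key : ∀ v ∈ S'.image e, ∑ x ∈ S' with e x = v,
        (bracket x : ℝ) ^ (1 - 2 * s) / supNorm (e x) ≤
        C₂ * 2 * (2 ^ (2 * s) * (bracket v : ℝ) ^ (-(2 * s))) := by
      intro v hv
      obtain ⟨x₀, hx₀, hv₀⟩ := Finset.mem_image.1 hv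
      have hv0 : v ≠ 0 := hv₀ ▸ he0 x₀ (Finset.mem_filter.1 hx₀).1
      have hE1 := supNorm_pos hv0
      have hE : (0 : ℝ) < supNorm v := by exact_mod_cast hE1
      have h3 : ∑ x ∈ S' with e x = v, (bracket x : ℝ) ^ (1 - 2 * s) / supNorm (e x)
          = (∑ x ∈ S' with e x = v, (bracket x : ℝ) ^ (-(2 * s - 1))) / supNorm v := by
        rw [Finset.sum_div]
        refine Finset.sum_congr rfl fun x hx => ?_
        rw [(Finset.mem_filter.1 hx).2, neg_sub]
      have h4 := h₂ p v (supNorm v) (S'.filter fun x => e x = v) hv0 hE1 (fun x hx => by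
          refine ⟨-(Int.gcd ((p - x) 0) ((p - x) 1) : ℤ), ?_⟩
          have h5 := gcd_smul_primDir (p - x)
          have h6 : primDir (p - x) = v := (Finset.mem_filter.1 hx).2
          rw [h6] at h5
          rw [neg_smul, ← h5]
          abel) (fun x hx => by
          have h7 := (Finset.mem_filter.1 (Finset.mem_filter.1 hx).1).2
          rw [(Finset.mem_filter.1 hx).2] at h7
          omega)
      rw [h3, div_le_iff₀ hE]
      refine h4.trans ?_
      have h8 : (supNorm v : ℝ) ^ (1 - (2 * s - 1)) / supNorm v =
          (supNorm v : ℝ) ^ (-(2 * s - 1)) := by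
        rw [div_eq_iff hE.ne']
        nth_rewrite 3 [← Real.rpow_one (supNorm v : ℝ)]
        rw [← Real.rpow_add hE]
        ring_nf
      have h9 : (supNorm v : ℝ) ^ (-(2 * s - 1)) = (supNorm v : ℝ) ^ (-(2 * s)) * supNorm v := by
        nth_rewrite 3 [← Real.rpow_one (supNorm v : ℝ)]
        rw [← Real.rpow_add hE]
        ring_nf
      have h10 : (supNorm v : ℝ) ^ (-(2 * s)) ≤ 2 ^ (2 * s) * (bracket v : ℝ) ^ (-(2 * s)) := by
        have h11 : (bracket v : ℝ) ≤ 2 * supNorm v := by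
          have : bracket v ≤ 2 * supNorm v := by unfold bracket; omega
          exact_mod_cast this
        have h12 : (2 * (supNorm v : ℝ)) ^ (-(2 * s)) ≤ (bracket v : ℝ) ^ (-(2 * s)) :=
          Real.rpow_le_rpow_of_nonpos (bracket_pos v) h11 (by linarith)
        rw [Real.mul_rpow (by norm_num) hE.le] at h12
        calc (supNorm v : ℝ) ^ (-(2 * s))
            = 2 ^ (2 * s) * (2 ^ (-(2 * s)) * (supNorm v : ℝ) ^ (-(2 * s))) := by
              rw [← mul_assoc, ← Real.rpow_add (by norm_num), add_neg_cancel, Real.rpow_zero,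
                one_mul]
          _ ≤ _ := by gcongr
      rw [h8, h9]
      calc C₂ * ((supNorm v : ℝ) ^ (-(2 * s)) * supNorm v +
            (supNorm v : ℝ) ^ (-(2 * s)) * supNorm v)
          = C₂ * 2 * (supNorm v : ℝ) ^ (-(2 * s)) * supNorm v := by ring
        _ ≤ _ := by gcongr
    refine (Finset.sum_le_sum key).trans ?_
    rw [← Finset.mul_sum, ← Finset.mul_sum]
    have := h₁ (S'.image e)
    gcongr

/-- Pairs of lattice points `(x, y)` with `|x| ≤ |y|` such that `y` lies on a line which is
determined by `x` and perpendicular to `p - x`. The sum over `y` is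
`O(|x| ^ (-s) + |x| ^ (1 - s) / |e|)`, where `e` is the primitive vector in the direction of
`p - x`. -/
theorem exists_sum_line_pairs_le {s : ℝ} (hs : 1 < s) :
    ∃ C : ℝ, 0 < C ∧ ∀ (p : Fin 2 → ℤ) (κ : (Fin 2 → ℤ) → ℤ)
      (P : Finset ((Fin 2 → ℤ) × (Fin 2 → ℤ))),
      (∀ x y, (x, y) ∈ P → x ≠ p ∧ bracket x ≤ bracket y ∧
        (p - x) 0 * y 0 + (p - x) 1 * y 1 = κ x) →
      ∑ z ∈ P, (bracket z.1 : ℝ) ^ (-s) * (bracket z.2 : ℝ) ^ (-s) ≤ C := by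
  obtain ⟨C₁, hC₁, h₁⟩ := exists_sum_plane_le (t := 2 * s) (by linarith)
  obtain ⟨C₂, hC₂, h₂⟩ := exists_sum_line_le hs
  obtain ⟨C₃, hC₃, h₃⟩ := exists_sum_primDir_le hs
  refine ⟨C₂ * (C₁ + C₃), by positivity, fun p κ P hP => ?_⟩
  obtain ⟨S, T, hS, hT, hsum⟩ := exists_sum_pairs_eq P
    fun x y => (bracket x : ℝ) ^ (-s) * (bracket y : ℝ) ^ (-s)
  rw [hsum]
  have key : ∀ x ∈ S, ∑ y ∈ T x,
      (bracket x : ℝ) ^ (-s) * (bracket y : ℝ) ^ (-s) ≤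
      C₂ * ((bracket x : ℝ) ^ (-(2 * s)) +
        (bracket x : ℝ) ^ (1 - 2 * s) / supNorm (primDir (p - x))) := by
    intro x hx
    obtain ⟨y₀, hz₀⟩ := hS x hx
    have hu : p - x ≠ 0 := sub_ne_zero.2 (hP _ _ hz₀).1.symm
    have hperp : ![-primDir (p - x) 1, primDir (p - x) 0] ≠ 0 := by
      intro h0
      have := supNorm_perp (primDir (p - x))
      rw [h0] at this
      have h1 := supNorm_pos (primDir_ne_zero hu)
      simp [supNorm] at this h1
      omega
    have h4 := h₂ y₀ _ (bracket x) (T x) hperp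
      (one_le_bracket x) (fun y hy => by
        have e1 := (hP _ _ hz₀).2.2
        have e2 := (hP _ _ (hT _ y hy)).2.2
        obtain ⟨n, hn⟩ := exists_eq_smul_perp (w := y - y₀) hu (by
          simp only [Pi.sub_apply] at e1 e2 ⊢
          linear_combination e2 - e1)
        exact ⟨n, by rw [← hn]; abel⟩) (fun y hy => (hP _ _ (hT _ y hy)).2.1)
    rw [supNorm_perp] at h4
    have hb := bracket_pos x
    rw [← Finset.mul_sum]
    refine (mul_le_mul_of_nonneg_left h4 (by positivity)).trans (le_of_eq ?_)
    have e3 : (bracket x : ℝ) ^ (-(2 * s)) = (bracket x : ℝ) ^ (-s) * (bracket x : ℝ) ^ (-s) := by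
      rw [← Real.rpow_add hb]; ring_nf
    have e4 : (bracket x : ℝ) ^ (1 - 2 * s) =
        (bracket x : ℝ) ^ (-s) * (bracket x : ℝ) ^ (1 - s) := by
      rw [← Real.rpow_add hb]; ring_nf
    rw [e3, e4]
    ring
  refine (Finset.sum_le_sum key).trans ?_
  rw [← Finset.mul_sum, Finset.sum_add_distrib]
  have h5 := h₁ S
  have h6 := h₃ p S (fun x hx => by
    obtain ⟨y, hy⟩ := hS x hx
    exact (hP x y hy).1)
  gcongr

/-- Three lattice points on a circle cannot be closer to each other than the cube root of the
radius; this is the statement for the points `Y`, `Y + 2 a`, `Y + 2 b` on a circle around `0`.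
The vectors `a` and `b` are linearly independent, their determinant is a nonzero integer, and
Cramer's rule computes `Y` from `Y · a = -|a| ^ 2` and `Y · b = -|b| ^ 2`. -/
theorem sq_norm_le_of_three_points {Y₀ Y₁ a₀ a₁ b₀ b₁ X : ℤ}
    (ha : Y₀ * a₀ + Y₁ * a₁ = -(a₀ ^ 2 + a₁ ^ 2)) (hb : Y₀ * b₀ + Y₁ * b₁ = -(b₀ ^ 2 + b₁ ^ 2))
    (ha0 : a₀ ^ 2 + a₁ ^ 2 ≠ 0) (hb0 : b₀ ^ 2 + b₁ ^ 2 ≠ 0)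
    (hab : (a₀ - b₀) ^ 2 + (a₁ - b₁) ^ 2 ≠ 0)
    (hXa₀ : |a₀| ≤ X) (hXa₁ : |a₁| ≤ X) (hXb₀ : |b₀| ≤ X) (hXb₁ : |b₁| ≤ X) :
    Y₀ ^ 2 + Y₁ ^ 2 ≤ 32 * X ^ 6 := by
  have hD : a₀ * b₁ - a₁ * b₀ ≠ 0 := by
    intro hD
    have h1 : b₀ ^ 2 + b₁ ^ 2 = a₀ * b₀ + a₁ * b₁ := by
      apply mul_left_cancel₀ ha0
      linear_combination (a₀ ^ 2 + a₁ ^ 2) * hb - (a₀ * b₀ + a₁ * b₁) * ha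
        - (Y₁ * a₀ - Y₀ * a₁) * hD
    have h2 : a₀ ^ 2 + a₁ ^ 2 = a₀ * b₀ + a₁ * b₁ := by
      apply mul_left_cancel₀ hb0
      linear_combination (b₀ ^ 2 + b₁ ^ 2) * ha - (a₀ * b₀ + a₁ * b₁) * hb
        + (Y₁ * b₀ - Y₀ * b₁) * hD
    exact hab (by linear_combination h1 + h2)
  have hX : 0 ≤ X := (abs_nonneg _).trans hXa₀
  have hsq : ∀ u : ℤ, |u| ≤ X → u ^ 2 ≤ X ^ 2 := fun u hu =>
    sq_le_sq' (abs_le.1 hu).1 (abs_le.1 hu).2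
  have hA : a₀ ^ 2 + a₁ ^ 2 ≤ 2 * X ^ 2 := by linarith [hsq _ hXa₀, hsq _ hXa₁]
  have hB : b₀ ^ 2 + b₁ ^ 2 ≤ 2 * X ^ 2 := by linarith [hsq _ hXb₀, hsq _ hXb₁]
  have hD1 : 1 ≤ |a₀ * b₁ - a₁ * b₀| := Int.one_le_abs hD
  have hbound : ∀ u v : ℤ, |u| ≤ X → |v| ≤ X →
      |(a₀ ^ 2 + a₁ ^ 2) * u - (b₀ ^ 2 + b₁ ^ 2) * v| ≤ 4 * X ^ 3 := by
    intro u v hu hv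
    calc |(a₀ ^ 2 + a₁ ^ 2) * u - (b₀ ^ 2 + b₁ ^ 2) * v|
        ≤ |(a₀ ^ 2 + a₁ ^ 2) * u| + |(b₀ ^ 2 + b₁ ^ 2) * v| := abs_sub _ _
      _ = (a₀ ^ 2 + a₁ ^ 2) * |u| + (b₀ ^ 2 + b₁ ^ 2) * |v| := by
          rw [abs_mul, abs_mul, abs_of_nonneg (a := a₀ ^ 2 + a₁ ^ 2) (by positivity),
            abs_of_nonneg (a := b₀ ^ 2 + b₁ ^ 2) (by positivity)]
      _ ≤ (2 * X ^ 2) * X + (2 * X ^ 2) * X := by gcongr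
      _ = 4 * X ^ 3 := by ring
  have hY : ∀ Y : ℤ, |Y * (a₀ * b₁ - a₁ * b₀)| ≤ 4 * X ^ 3 → Y ^ 2 ≤ 16 * X ^ 6 := by
    intro Y h
    rw [abs_mul] at h
    have h1 : |Y| ≤ 4 * X ^ 3 := le_trans (le_mul_of_one_le_right (abs_nonneg _) hD1) h
    calc Y ^ 2 = |Y| ^ 2 := (sq_abs Y).symm
      _ ≤ (4 * X ^ 3) ^ 2 := by gcongr
      _ = 16 * X ^ 6 := by ring
  have h0 := hY Y₀ (by
    have : Y₀ * (a₀ * b₁ - a₁ * b₀) = -((a₀ ^ 2 + a₁ ^ 2) * b₁ - (b₀ ^ 2 + b₁ ^ 2) * a₁) := by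
      linear_combination b₁ * ha - a₁ * hb
    rw [this, abs_neg]
    exact hbound _ _ hXb₁ hXa₁)
  have h1 := hY Y₁ (by
    have : Y₁ * (a₀ * b₁ - a₁ * b₀) = (a₀ ^ 2 + a₁ ^ 2) * b₀ - (b₀ ^ 2 + b₁ ^ 2) * a₀ := by
      linear_combination a₀ * hb - b₀ * ha
    rw [this]
    exact hbound _ _ hXb₀ hXa₀)
  linarith

theorem sq_add_sq_ne_zero {z z' : Fin 2 → ℤ} (h : z ≠ z') :
    (z' 0 - z 0) ^ 2 + (z' 1 - z 1) ^ 2 ≠ 0 := by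
  intro h0
  apply h
  have h1 : z' 0 - z 0 = 0 := by nlinarith [sq_nonneg (z' 0 - z 0), sq_nonneg (z' 1 - z 1)]
  have h2 : z' 1 - z 1 = 0 := by nlinarith [sq_nonneg (z' 0 - z 0), sq_nonneg (z' 1 - z 1)]
  funext c
  fin_cases c
  · simp; omega
  · simp; omega

/-- The number of lattice points in a ball of radius `X` on a circle is `O(X ^ η)`, uniformly
in the circle: if the radius is large compared with `X ^ 3` there are at most two of them,
otherwise the divisor bound applies. The equation says that `2 y - (w + p)`, as a Gaussian integer,
has norm `|p - w| ^ 2 - 4 σ`. -/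
theorem exists_card_circle_le {η : ℝ} (hη : 0 < η) :
    ∃ C : ℝ, 0 < C ∧ ∀ (w p : Fin 2 → ℤ) (σ : ℤ) (S : Finset (Fin 2 → ℤ)) (X : ℕ), 1 ≤ X →
      (∀ y ∈ S, (y - w) 0 * (p - y) 0 + (y - w) 1 * (p - y) 1 = σ) →
      (∀ y ∈ S, bracket y ≤ X) → (S.card : ℝ) ≤ C * (X : ℝ) ^ η := by
  -- the norm `n` is at most `2048 X ^ 6` if there are three points
  obtain ⟨C, hC, h⟩ := exists_card_norm_eq_le (ε := η / 6) (by linarith)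
  refine ⟨2 + C * 2048 ^ (η / 6), by positivity, fun w p σ S X hX hσ hSX => ?_⟩
  have hX' : (1 : ℝ) ≤ X := by exact_mod_cast hX
  have hXη : 1 ≤ (X : ℝ) ^ η := Real.one_le_rpow hX' hη.le
  rcases Nat.lt_or_ge 2 S.card with hcard | hcard
  swap
  · have h2 : (S.card : ℝ) ≤ 2 := by exact_mod_cast hcard
    have h3 : 0 ≤ C * 2048 ^ (η / 6) * (X : ℝ) ^ η := by positivity
    nlinarith
  obtain ⟨y₁, y₂, y₃, hy₁, hy₂, hy₃, h12, h13, h23⟩ := Finset.two_lt_card_iff.1 hcard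
  set n : ℤ := (p 0 - w 0) ^ 2 + (p 1 - w 1) ^ 2 - 4 * σ with hn
  set φ : (Fin 2 → ℤ) → GaussianInt := fun y => ⟨2 * y 0 - (w 0 + p 0), 2 * y 1 - (w 1 + p 1)⟩
    with hφ
  have hnorm : ∀ y ∈ S, (φ y).norm = n := by
    intro y hy
    have := hσ y hy
    simp only [Pi.sub_apply] at this
    rw [Zsqrtd.norm_def, hn, ← this]
    ring
  have hinj : Function.Injective φ := by
    intro y y' hyy
    have h1 := congrArg Zsqrtd.re hyy
    have h2 := congrArg Zsqrtd.im hyy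
    simp only [hφ] at h1 h2
    funext c
    fin_cases c
    · simp; omega
    · simp; omega
  have hn6 : n ≤ 2048 * (X : ℤ) ^ 6 := by
    have e1 := hnorm y₁ hy₁
    have e2 := hnorm y₂ hy₂
    have e3 := hnorm y₃ hy₃
    rw [Zsqrtd.norm_def] at e1 e2 e3
    simp only [hφ] at e1 e2 e3
    have hd : ∀ y ∈ S, ∀ y' ∈ S, ∀ c, |y' c - y c| ≤ 2 * (X : ℤ) := by
      intro y hy y' hy' c
      have h1 := abs_le_of_bracket_le (hSX y hy) c
      have h2 := abs_le_of_bracket_le (hSX y' hy') c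
      calc |y' c - y c| ≤ |y' c| + |y c| := abs_sub _ _
        _ ≤ _ := by linarith
    have := sq_norm_le_of_three_points (Y₀ := 2 * y₁ 0 - (w 0 + p 0))
      (Y₁ := 2 * y₁ 1 - (w 1 + p 1)) (a₀ := y₂ 0 - y₁ 0) (a₁ := y₂ 1 - y₁ 1)
      (b₀ := y₃ 0 - y₁ 0) (b₁ := y₃ 1 - y₁ 1) (X := 2 * X)
      (by linarith) (by linarith) (sq_add_sq_ne_zero h12) (sq_add_sq_ne_zero h13)
      (by
        have := sq_add_sq_ne_zero h23
        intro h0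
        apply this
        linear_combination h0)
      (hd _ hy₁ _ hy₂ 0) (hd _ hy₁ _ hy₂ 1) (hd _ hy₁ _ hy₃ 0) (hd _ hy₁ _ hy₃ 1)
    linarith
  have hn0 : 0 < n := by
    have hnn : 0 ≤ n := by
      rw [← hnorm y₁ hy₁]
      exact GaussianInt.norm_nonneg _
    rcases hnn.lt_or_eq with h0 | h0
    · exact h0
    · exfalso
      have e1 := hnorm y₁ hy₁
      have e2 := hnorm y₂ hy₂
      rw [← h0, GaussianInt.norm_eq_zero] at e1 e2
      exact h12 (hinj (e1.trans e2.symm))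
  have h4 := h n (S.image φ) hn0 (fun z hz => by
    obtain ⟨y, hy, rfl⟩ := Finset.mem_image.1 hz
    exact hnorm y hy)
  rw [Finset.card_image_of_injective _ hinj] at h4
  have h5 : (n : ℝ) ^ (η / 6) ≤ 2048 ^ (η / 6) * (X : ℝ) ^ η := by
    have h6 : (n : ℝ) ≤ 2048 * (X : ℝ) ^ (6 : ℕ) := by exact_mod_cast hn6
    calc (n : ℝ) ^ (η / 6) ≤ (2048 * (X : ℝ) ^ (6 : ℕ)) ^ (η / 6) :=
          Real.rpow_le_rpow (by exact_mod_cast hn0.le) h6 (by positivity)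
      _ = _ := by
          rw [Real.mul_rpow (by norm_num) (by positivity), ← Real.rpow_natCast,
            ← Real.rpow_mul (by positivity)]
          congr 2
          push_cast
          ring
  calc (S.card : ℝ) ≤ C * (n : ℝ) ^ (η / 6) := h4
    _ ≤ C * (2048 ^ (η / 6) * (X : ℝ) ^ η) := by gcongr
    _ ≤ _ := by nlinarith

/-- Pairs of lattice points `(w, y)` with `|w| ≤ |y|` such that `y` lies on a circle which is
determined by `w`. The sum over `y` is `O(|w| ^ (-1))`, by the counting exponent `s - 1`. -/
theorem exists_sum_circle_pairs_le {s : ℝ} (hs : 1 < s) :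
    ∃ C : ℝ, 0 < C ∧ ∀ (p : Fin 2 → ℤ) (σ : ℤ)
      (P : Finset ((Fin 2 → ℤ) × (Fin 2 → ℤ))),
      (∀ w y, (w, y) ∈ P → bracket w ≤ bracket y ∧
        (y - w) 0 * (p - y) 0 + (y - w) 1 * (p - y) 1 = σ) →
      ∑ z ∈ P, (bracket z.1 : ℝ) ^ (-s) * (bracket z.2 : ℝ) ^ (-s) ≤ C := by
  obtain ⟨C₁, hC₁, h₁⟩ := exists_sum_plane_le (t := s + 1) (by linarith)
  obtain ⟨C₂, hC₂, h₂⟩ := exists_card_circle_le (η := s - 1) (by linarith)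
  obtain ⟨C₃, hC₃, h₃⟩ := exists_sum_bracket_rpow_le (s := s) (η := s - 1) (θ := 0)
    (by linarith) (by linarith) (by linarith)
  refine ⟨C₃ * C₂ * C₁, by positivity, fun p σ P hP => ?_⟩
  obtain ⟨S, T, hS, hT, hsum⟩ := exists_sum_pairs_eq P
    fun x y => (bracket x : ℝ) ^ (-s) * (bracket y : ℝ) ^ (-s)
  rw [hsum]
  have key : ∀ w ∈ S, ∑ y ∈ T w,
      (bracket w : ℝ) ^ (-s) * (bracket y : ℝ) ^ (-s) ≤
      C₃ * C₂ * (bracket w : ℝ) ^ (-(s + 1)) := by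
    intro w _
    have h4 := h₃ C₂ 0 (bracket w) (T w) hC₂.le le_rfl
      (one_le_bracket w) (fun y hy => (hP _ _ (hT _ y hy)).1) (fun X hX => by
        have := h₂ w p σ ((T w).filter
          fun y => bracket y ≤ X) X hX
          (fun y hy => (hP _ _ (hT _ y (Finset.mem_filter.1 hy).1)).2)
          (fun y hy => (Finset.mem_filter.1 hy).2)
        simpa using this)
    have hb := bracket_pos w
    rw [← Finset.mul_sum]
    refine (mul_le_mul_of_nonneg_left h4 (by positivity)).trans (le_of_eq ?_)
    have e3 : (bracket w : ℝ) ^ (-(s + 1)) =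
        (bracket w : ℝ) ^ (-s) * (bracket w : ℝ) ^ (s - 1 - s) := by
      rw [← Real.rpow_add hb]; ring_nf
    rw [e3]
    ring
  refine (Finset.sum_le_sum key).trans ?_
  rw [← Finset.mul_sum]
  have h5 := h₁ S
  gcongr

end GPHierarchy

namespace GPHierarchy

/-! ### The resonance sum -/

/-- The summand of the resonance sum, for the momenta `p₁ + p₂ = p + p₃`. -/
noncomputable def resonanceTerm (s : ℝ) (p p₁ p₂ p₃ : Fin 2 → ℤ) : ℝ :=
  (bracket p : ℝ) ^ s * (bracket p₁ : ℝ) ^ (-s) * (bracket p₂ : ℝ) ^ (-s) *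
    (bracket p₃ : ℝ) ^ (-s)

theorem supNorm_le_of_add_eq {p p₁ p₂ p₃ : Fin 2 → ℤ} (h : p + p₃ = p₁ + p₂) :
    supNorm p ≤ supNorm p₁ + supNorm p₂ + supNorm p₃ := by
  have h0 := congrFun h 0
  have h1 := congrFun h 1
  simp only [Pi.add_apply] at h0 h1
  have k0 : (p 0).natAbs ≤ (p₁ 0).natAbs + (p₂ 0).natAbs + (p₃ 0).natAbs := by omega
  have k1 : (p 1).natAbs ≤ (p₁ 1).natAbs + (p₂ 1).natAbs + (p₃ 1).natAbs := by omega
  refine max_le (k0.trans ?_) (k1.trans ?_)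
  · exact add_le_add (add_le_add (le_max_left _ _) (le_max_left _ _)) (le_max_left _ _)
  · exact add_le_add (add_le_add (le_max_right _ _) (le_max_right _ _)) (le_max_right _ _)

/-- The largest of the momenta `p₁`, `p₂`, `p₃`, here called `q`, dominates `p` up to a factor `3`
and cancels against it; `x` and `y` stand for the other two momenta. -/
theorem resonanceTerm_le {s : ℝ} (hs : 0 ≤ s) {p p₁ p₂ p₃ q x y : Fin 2 → ℤ}
    (h : p + p₃ = p₁ + p₂)
    (h₁ : bracket p₁ ≤ bracket q) (h₂ : bracket p₂ ≤ bracket q) (h₃ : bracket p₃ ≤ bracket q)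
    (hxy : (bracket p₁ : ℝ) ^ (-s) * (bracket p₂ : ℝ) ^ (-s) * (bracket p₃ : ℝ) ^ (-s) =
      (bracket q : ℝ) ^ (-s) * ((bracket x : ℝ) ^ (-s) * (bracket y : ℝ) ^ (-s))) :
    resonanceTerm s p p₁ p₂ p₃ ≤
      3 ^ s * ((bracket x : ℝ) ^ (-s) * (bracket y : ℝ) ^ (-s)) := by
  have h4 : bracket p ≤ 3 * bracket q := by
    have := supNorm_le_of_add_eq h
    unfold bracket at *
    omega
  have hq := bracket_pos q
  have h5 : (bracket p : ℝ) ^ s ≤ 3 ^ s * (bracket q : ℝ) ^ s := by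
    rw [← Real.mul_rpow (by norm_num) hq.le]
    exact Real.rpow_le_rpow (bracket_pos p).le (by exact_mod_cast h4) hs
  have h6 : (bracket q : ℝ) ^ s * (bracket q : ℝ) ^ (-s) = 1 := by
    rw [← Real.rpow_add hq, add_neg_cancel, Real.rpow_zero]
  have h7 : resonanceTerm s p p₁ p₂ p₃ = (bracket p : ℝ) ^ s * ((bracket q : ℝ) ^ (-s) *
      ((bracket x : ℝ) ^ (-s) * (bracket y : ℝ) ^ (-s))) := by
    rw [resonanceTerm, ← hxy]; ring
  calc resonanceTerm s p p₁ p₂ p₃ ≤ 3 ^ s * (bracket q : ℝ) ^ s * ((bracket q : ℝ) ^ (-s) *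
      ((bracket x : ℝ) ^ (-s) * (bracket y : ℝ) ^ (-s))) := by rw [h7]; gcongr
    _ = 3 ^ s * ((bracket q : ℝ) ^ s * (bracket q : ℝ) ^ (-s)) *
      ((bracket x : ℝ) ^ (-s) * (bracket y : ℝ) ^ (-s)) := by ring
    _ = _ := by rw [h6, mul_one]

theorem resonanceTerm_self {s : ℝ} (p x : Fin 2 → ℤ) :
    resonanceTerm s p p x x = (bracket x : ℝ) ^ (-(2 * s)) := by
  have h6 : (bracket p : ℝ) ^ s * (bracket p : ℝ) ^ (-s) = 1 := by
    rw [← Real.rpow_add (bracket_pos p), add_neg_cancel, Real.rpow_zero]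
  rw [resonanceTerm, h6, one_mul, ← Real.rpow_add (bracket_pos x)]
  ring_nf

theorem resonanceTerm_comm {s : ℝ} (p p₁ p₂ p₃ : Fin 2 → ℤ) :
    resonanceTerm s p p₁ p₂ p₃ = resonanceTerm s p p₂ p₁ p₃ := by
  unfold resonanceTerm; ring

/-- The part of the resonance sum where `p₁ = p`, hence `p₃ = p₂`. The resonance condition is void
on this part, and the sum runs over the plane with exponent `2 s > 2`. -/
theorem exists_sum_resonance_self_le {s : ℝ} (hs : 1 < s) :
    ∃ C : ℝ, 0 < C ∧ ∀ (p : Fin 2 → ℤ) (Z : Finset ((Fin 2 → ℤ) × (Fin 2 → ℤ))),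
      (∀ z ∈ Z, z.1 = p) →
      ∑ z ∈ Z, resonanceTerm s p z.1 z.2 (z.1 + z.2 - p) ≤ C := by
  obtain ⟨C, hC, h⟩ := exists_sum_plane_le (t := 2 * s) (by linarith)
  refine ⟨C, hC, fun p Z hZ => ?_⟩
  refine le_trans (le_of_eq ?_) (h (Z.image Prod.snd))
  rw [Finset.sum_image]
  · refine Finset.sum_congr rfl fun z hz => ?_
    rw [hZ z hz, add_sub_cancel_left, resonanceTerm_self]
  · intro z hz z' hz' hzz
    exact Prod.ext ((hZ z hz).trans (hZ z' hz').symm) hzz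

/-- The part of the resonance sum where `|p₁| ≤ |p₂| ≤ |p₃|`. For given `p₁` the resonance condition
puts `p₂` on a line perpendicular to `p - p₁`. -/
theorem exists_sum_resonance_large_third_le {s : ℝ} (hs : 1 < s) :
    ∃ C : ℝ, 0 < C ∧ ∀ (p : Fin 2 → ℤ) (σ : ℤ) (Z : Finset ((Fin 2 → ℤ) × (Fin 2 → ℤ))),
      (∀ z ∈ Z, (p - z.1) 0 * (p - z.2) 0 + (p - z.1) 1 * (p - z.2) 1 = σ ∧ z.1 ≠ p ∧
        bracket z.1 ≤ bracket z.2 ∧ bracket z.2 ≤ bracket (z.1 + z.2 - p)) →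
      ∑ z ∈ Z, resonanceTerm s p z.1 z.2 (z.1 + z.2 - p) ≤ C := by
  obtain ⟨C, hC, h⟩ := exists_sum_line_pairs_le hs
  refine ⟨3 ^ s * C, by positivity, fun p σ Z hZ => ?_⟩
  have h1 := h p (fun x => (p - x) 0 * p 0 + (p - x) 1 * p 1 - σ) Z (fun x y hz => by
    obtain ⟨h1, h2, h3, -⟩ := hZ _ hz
    refine ⟨h2, h3, ?_⟩
    simp only [Pi.sub_apply] at h1 ⊢
    linear_combination -h1)
  refine le_trans (Finset.sum_le_sum fun z hz => ?_)
    ((Finset.mul_sum _ _ _).symm.le.trans (mul_le_mul_of_nonneg_left h1 (by positivity)))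
  obtain ⟨-, -, h3, h4⟩ := hZ z hz
  refine resonanceTerm_le (by linarith) (q := z.1 + z.2 - p) (by abel) (h3.trans h4) h4 le_rfl ?_
  ring

/-- The part of the resonance sum where `p₁` is the largest momentum. For given `p₂` the resonance
condition puts `p₃` on a line, for given `p₃` it puts `p₂` on a circle; the first is used if
`|p₂| ≤ |p₃|`, the second otherwise. -/
theorem exists_sum_resonance_large_first_le {s : ℝ} (hs : 1 < s) :
    ∃ C : ℝ, 0 < C ∧ ∀ (p : Fin 2 → ℤ) (σ : ℤ) (Z : Finset ((Fin 2 → ℤ) × (Fin 2 → ℤ))),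
      (∀ z ∈ Z, (p - z.1) 0 * (p - z.2) 0 + (p - z.1) 1 * (p - z.2) 1 = σ ∧ z.2 ≠ p ∧
        bracket z.2 ≤ bracket z.1 ∧ bracket (z.1 + z.2 - p) ≤ bracket z.1) →
      ∑ z ∈ Z, resonanceTerm s p z.1 z.2 (z.1 + z.2 - p) ≤ C := by
  obtain ⟨C₁, hC₁, h₁⟩ := exists_sum_line_pairs_le hs
  obtain ⟨C₂, hC₂, h₂⟩ := exists_sum_circle_pairs_le hs
  refine ⟨3 ^ s * C₁ + 3 ^ s * C₂, by positivity, fun p σ Z hZ => ?_⟩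
  rw [← Finset.sum_filter_add_sum_filter_not Z
    (fun z => bracket z.2 ≤ bracket (z.1 + z.2 - p))]
  apply add_le_add
  · set W := Z.filter fun z => bracket z.2 ≤ bracket (z.1 + z.2 - p) with hW
    have hinj : Set.InjOn (fun z : (Fin 2 → ℤ) × (Fin 2 → ℤ) => (z.2, z.1 + z.2 - p)) W := by
      intro z _ z' _ hzz
      simp only [Prod.mk.injEq] at hzz
      obtain ⟨h2, h3⟩ := hzz
      rw [h2] at h3
      exact Prod.ext (by simpa using h3) h2
    have h3 := h₁ p (fun x => (p - x) 0 * x 0 + (p - x) 1 * x 1 - σ)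
      (W.image fun z => (z.2, z.1 + z.2 - p)) (fun x y hz => by
        obtain ⟨z, hzW, hxy⟩ := Finset.mem_image.1 hz
        simp only [Prod.mk.injEq] at hxy
        obtain ⟨rfl, rfl⟩ := hxy
        obtain ⟨hz1, hz2⟩ := Finset.mem_filter.1 hzW
        obtain ⟨e1, e2, -, -⟩ := hZ z hz1
        refine ⟨e2, hz2, ?_⟩
        simp only [Pi.sub_apply, Pi.add_apply] at e1 ⊢
        linear_combination -e1)
    rw [Finset.sum_image hinj] at h3
    refine le_trans (Finset.sum_le_sum fun z hz => ?_)
      ((Finset.mul_sum _ _ _).symm.le.trans (mul_le_mul_of_nonneg_left h3 (by positivity)))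
    obtain ⟨-, -, h3, h4⟩ := hZ z (Finset.mem_filter.1 hz).1
    refine resonanceTerm_le (by linarith) (q := z.1) (by abel) le_rfl h3 h4 ?_
    ring
  · set W := Z.filter fun z => ¬ bracket z.2 ≤ bracket (z.1 + z.2 - p) with hW
    have hinj : Set.InjOn (fun z : (Fin 2 → ℤ) × (Fin 2 → ℤ) => (z.1 + z.2 - p, z.2)) W := by
      intro z _ z' _ hzz
      simp only [Prod.mk.injEq] at hzz
      obtain ⟨h3, h2⟩ := hzz
      rw [h2] at h3
      exact Prod.ext (by simpa using h3) h2
    have h3 := h₂ p σ (W.image fun z => (z.1 + z.2 - p, z.2)) (fun x y hz => by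
        obtain ⟨z, hzW, hxy⟩ := Finset.mem_image.1 hz
        simp only [Prod.mk.injEq] at hxy
        obtain ⟨rfl, rfl⟩ := hxy
        obtain ⟨hz1, hz2⟩ := Finset.mem_filter.1 hzW
        obtain ⟨e1, e2, -, -⟩ := hZ z hz1
        refine ⟨by omega, ?_⟩
        simp only [Pi.sub_apply, Pi.add_apply] at e1 ⊢
        linear_combination e1)
    rw [Finset.sum_image hinj] at h3
    refine le_trans (Finset.sum_le_sum fun z hz => ?_)
      ((Finset.mul_sum _ _ _).symm.le.trans (mul_le_mul_of_nonneg_left h3 (by positivity)))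
    obtain ⟨-, -, h3, h4⟩ := hZ z (Finset.mem_filter.1 hz).1
    refine resonanceTerm_le (by linarith) (q := z.1) (by abel) le_rfl h3 h4 ?_
    ring

/-- The resonance sum is bounded: `∑ ⟨p⟩ˢ / (⟨p₁⟩ ⟨p₂⟩ ⟨p₃⟩)ˢ` over the momenta with
`p₁ + p₂ = p + p₃` and a given value of `|p|² - |p₁|² - |p₂|² + |p₃|² = 2 (p - p₁) · (p - p₂)`. -/
theorem exists_sum_resonance_le {s : ℝ} (hs : 1 < s) :
    ∃ C : ℝ, 0 < C ∧ ∀ (p : Fin 2 → ℤ) (σ : ℤ) (Z : Finset ((Fin 2 → ℤ) × (Fin 2 → ℤ))),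
      (∀ z ∈ Z, (p - z.1) 0 * (p - z.2) 0 + (p - z.1) 1 * (p - z.2) 1 = σ) →
      ∑ z ∈ Z, resonanceTerm s p z.1 z.2 (z.1 + z.2 - p) ≤ C := by
  obtain ⟨C₁, hC₁, h₁⟩ := exists_sum_resonance_self_le hs
  obtain ⟨C₂, hC₂, h₂⟩ := exists_sum_resonance_large_third_le hs
  obtain ⟨C₃, hC₃, h₃⟩ := exists_sum_resonance_large_first_le hs
  -- one half of the sum: `p₁ = p`, or `|p₂| ≤ |p₁|` and `p₂ ≠ p`; the resonance condition is
  -- symmetric in `p₁` and `p₂`, and exchanging them covers the other half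
  have half : ∀ (p : Fin 2 → ℤ) (σ : ℤ) (Z : Finset ((Fin 2 → ℤ) × (Fin 2 → ℤ))),
      (∀ z ∈ Z, (p - z.1) 0 * (p - z.2) 0 + (p - z.1) 1 * (p - z.2) 1 = σ ∧
        (z.1 = p ∨ z.2 ≠ p ∧ bracket z.2 ≤ bracket z.1)) →
      ∑ z ∈ Z, resonanceTerm s p z.1 z.2 (z.1 + z.2 - p) ≤ C₁ + (C₂ + C₃) := by
    intro p σ Z hZ
    rw [← Finset.sum_filter_add_sum_filter_not Z (fun z => z.1 = p)]
    refine add_le_add (h₁ p _ fun z hz => (Finset.mem_filter.1 hz).2) ?_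
    rw [← Finset.sum_filter_add_sum_filter_not _ (fun z => bracket z.1 ≤ bracket (z.1 + z.2 - p))]
    apply add_le_add
    · have := h₂ p σ (((Z.filter fun z => ¬ z.1 = p).filter
        fun z => bracket z.1 ≤ bracket (z.1 + z.2 - p)).map
        (Equiv.prodComm _ _).toEmbedding) ?_
      · rw [Finset.sum_map] at this
        refine (Finset.sum_le_sum fun z _ => ?_).trans this
        rw [resonanceTerm_comm]
        simp [add_comm]
      · intro z hz
        obtain ⟨y, hy, rfl⟩ := Finset.mem_map.1 hz
        simp only [Finset.mem_filter] at hy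
        obtain ⟨⟨hy1, hy2⟩, hy3⟩ := hy
        obtain ⟨e1, e2⟩ := hZ y hy1
        obtain ⟨e3, e4⟩ := e2.resolve_left hy2
        simp only [Equiv.coe_toEmbedding, Equiv.prodComm_apply, Prod.fst_swap, Prod.snd_swap]
        exact ⟨by linear_combination e1, e3, e4, by rwa [add_comm]⟩
    · refine h₃ p σ _ fun z hz => ?_
      simp only [Finset.mem_filter] at hz
      obtain ⟨⟨hz1, hz2⟩, hz3⟩ := hz
      obtain ⟨e1, e2⟩ := hZ z hz1
      obtain ⟨e3, e4⟩ := e2.resolve_left hz2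
      exact ⟨e1, e3, e4, by omega⟩
  refine ⟨C₁ + (C₂ + C₃) + (C₁ + (C₂ + C₃)), by positivity, fun p σ Z hZ => ?_⟩
  rw [← Finset.sum_filter_add_sum_filter_not Z
    (fun z => z.1 = p ∨ z.2 ≠ p ∧ bracket z.2 ≤ bracket z.1)]
  apply add_le_add
  · refine half p σ _ fun z hz => ?_
    obtain ⟨h1, h2⟩ := Finset.mem_filter.1 hz
    exact ⟨hZ z h1, h2⟩
  · have := half p σ ((Z.filter fun z => ¬ (z.1 = p ∨ z.2 ≠ p ∧ bracket z.2 ≤ bracket z.1)).map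
        (Equiv.prodComm _ _).toEmbedding) ?_
    · rw [Finset.sum_map] at this
      refine (Finset.sum_le_sum fun z _ => ?_).trans this
      rw [resonanceTerm_comm]
      simp [add_comm]
    · intro z hz
      obtain ⟨y, hy, rfl⟩ := Finset.mem_map.1 hz
      obtain ⟨h1, h2⟩ := Finset.mem_filter.1 hy
      simp only [Equiv.coe_toEmbedding, Equiv.prodComm_apply, Prod.fst_swap, Prod.snd_swap]
      refine ⟨by linear_combination hZ y h1, ?_⟩
      push Not at h2
      by_cases h3 : y.2 = p
      · exact Or.inl h3
      · exact Or.inr ⟨h2.1, (h2.2 h3).le⟩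

end GPHierarchy

namespace GPHierarchy

/-! ### Lists with entries in a finite set -/

section Lists
variable {ι : Type*}

/-- The lists of length `n` with entries in `K`. -/
def listsOf (K : Finset ι) : ℕ → Finset (List ι)
  | 0 => {[]}
  | n + 1 => (K ×ˢ listsOf K n).map
      ⟨fun p => p.1 :: p.2, fun p q h => by
        simp only [List.cons.injEq] at h
        exact Prod.ext h.1 h.2⟩

theorem sum_listsOf_zero {M : Type*} [AddCommMonoid M] (K : Finset ι) (f : List ι → M) :
    ∑ l ∈ listsOf K 0, f l = f [] := by
  simp [listsOf]

theorem sum_listsOf_succ {M : Type*} [AddCommMonoid M] (K : Finset ι) (n : ℕ) (f : List ι → M) :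
    ∑ l ∈ listsOf K (n + 1), f l = ∑ q ∈ K, ∑ l ∈ listsOf K n, f (q :: l) := by
  rw [listsOf, Finset.sum_map, Finset.sum_product]
  rfl

theorem sum_listsOf_add {M : Type*} [AddCommMonoid M] (K : Finset ι) (n m : ℕ)
    (f : List ι → M) :
    ∑ l ∈ listsOf K (n + m), f l = ∑ l₁ ∈ listsOf K n, ∑ l₂ ∈ listsOf K m, f (l₁ ++ l₂) := by
  induction n generalizing f with
  | zero => simp [sum_listsOf_zero]
  | succ n ih =>
    rw [Nat.succ_add, sum_listsOf_succ, sum_listsOf_succ]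
    exact Finset.sum_congr rfl fun q _ => ih _

theorem sum_listsOf_one {M : Type*} [AddCommMonoid M] (K : Finset ι) (f : List ι → M) :
    ∑ l ∈ listsOf K 1, f l = ∑ q ∈ K, f [q] := by
  simp [sum_listsOf_succ, sum_listsOf_zero]

theorem mem_listsOf {K : Finset ι} {n : ℕ} {l : List ι} :
    l ∈ listsOf K n ↔ l.length = n ∧ ∀ x ∈ l, x ∈ K := by
  induction n generalizing l with
  | zero => simp +contextual [listsOf]
  | succ n ih =>
    cases l with
    | nil => simp [listsOf]
    | cons q l =>
      simp only [listsOf, Finset.mem_map, Finset.mem_product, Prod.exists, List.length_cons,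
        Nat.add_right_cancel_iff, List.mem_cons, forall_eq_or_imp]
      constructor
      · rintro ⟨a, b, ⟨ha, hb⟩, hab⟩
        obtain ⟨rfl, rfl⟩ := List.cons.inj hab
        exact ⟨(ih.1 hb).1, ha, (ih.1 hb).2⟩
      · rintro ⟨h1, h2, h3⟩
        exact ⟨q, l, ⟨h2, ih.2 ⟨h1, h3⟩⟩, rfl⟩

theorem length_of_mem_listsOf {K : Finset ι} {n : ℕ} {l : List ι} (h : l ∈ listsOf K n) :
    l.length = n :=
  (mem_listsOf.1 h).1

end Lists

/-! ### Integral inequalities on an interval -/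

/-- The Cauchy-Schwarz inequality on an interval of length `δ`, for a subinterval on the left; it
holds because the variance of `‖u‖` on the interval is nonnegative. -/
theorem sq_norm_intervalIntegral_le {u : ℝ → ℂ} {s t δ : ℝ} (hst : s ≤ t) (htδ : t ≤ s + δ)
    (hδ : 0 < δ) (hu : IntervalIntegrable u volume s (s + δ))
    (hu2 : IntervalIntegrable (fun r => ‖u r‖ ^ 2) volume s (s + δ)) :
    ‖∫ r in s..t, u r‖ ^ 2 ≤ δ * ∫ r in s..(s + δ), ‖u r‖ ^ 2 := by
  have hsδ : s ≤ s + δ := by linarith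
  set A := ∫ r in s..(s + δ), ‖u r‖ with hA
  have hA0 : 0 ≤ A := intervalIntegral.integral_nonneg hsδ fun _ _ => norm_nonneg _
  have h1 : ‖∫ r in s..t, u r‖ ≤ A := by
    refine (intervalIntegral.norm_integral_le_integral_norm hst).trans ?_
    exact intervalIntegral.integral_mono_interval le_rfl hst htδ
      (Eventually.of_forall fun _ => norm_nonneg _) hu.norm
  have h2 : 0 ≤ ∫ r in s..(s + δ), (‖u r‖ - A / δ) ^ 2 :=
    intervalIntegral.integral_nonneg hsδ fun _ _ => sq_nonneg _
  have h3 : ∫ r in s..(s + δ), (‖u r‖ - A / δ) ^ 2 =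
      (∫ r in s..(s + δ), ‖u r‖ ^ 2) - A ^ 2 / δ := by
    have e : ∀ r, (‖u r‖ - A / δ) ^ 2 = ‖u r‖ ^ 2 - 2 * (A / δ) * ‖u r‖ + (A / δ) ^ 2 := by
      intro r; ring
    simp only [e]
    rw [intervalIntegral.integral_add (hu2.sub (hu.norm.const_mul _)) intervalIntegrable_const,
      intervalIntegral.integral_sub hu2 (hu.norm.const_mul _),
      intervalIntegral.integral_const_mul, intervalIntegral.integral_const, ← hA]
    simp only [add_sub_cancel_left, smul_eq_mul]
    field_simp
    ring
  rw [h3, sub_nonneg, div_le_iff₀ hδ] at h2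
  calc ‖∫ r in s..t, u r‖ ^ 2 ≤ A ^ 2 := by gcongr
    _ ≤ _ := by linarith

theorem intervalIntegral_swap_of_continuous {Φ : ℝ → ℝ → ℝ}
    (hΦ : Continuous (Function.uncurry Φ)) {a b : ℝ} (hab : a ≤ b) :
    ∫ t in a..b, ∫ r in a..b, Φ t r = ∫ r in a..b, ∫ t in a..b, Φ t r := by
  simp only [intervalIntegral.integral_of_le hab]
  refine integral_integral_swap ?_
  rw [Measure.prod_restrict]
  exact (hΦ.continuousOn.integrableOn_compact (isCompact_Icc.prod isCompact_Icc)).mono_set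
    (Set.prod_mono Ioc_subset_Icc_self Ioc_subset_Icc_self)

/-- Fubini's theorem on a triangle. -/
theorem intervalIntegral_triangle {Φ : ℝ → ℝ → ℂ} (hΦ : Continuous (Function.uncurry Φ))
    {f : ℝ → ℂ} {a t : ℝ} (hat : a ≤ t) (hf : IntervalIntegrable f volume a t) :
    IntervalIntegrable (fun r => ∫ s in a..r, Φ r s * f s) volume a t ∧
      ∫ s in a..t, (∫ r in s..t, Φ r s) * f s = ∫ r in a..t, ∫ s in a..r, Φ r s * f s := by
  set μ := (volume : Measure ℝ).restrict (Ioc a t) with hμ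
  -- the integrand on the square, cut off to the triangle `s ≤ r`
  set Ψ : ℝ → ℝ → ℂ := fun r s => (Iic r).indicator (fun s => Φ r s * f s) s with hΨ
  have h1 : ∀ r ∈ Ioc a t, ∫ s in a..r, Φ r s * f s = ∫ s, Ψ r s ∂μ := by
    intro r hr
    rw [intervalIntegral.integral_of_le hr.1.le, hΨ]
    simp only
    rw [integral_indicator measurableSet_Iic, hμ, Measure.restrict_restrict measurableSet_Iic]
    congr 2
    ext x
    simp only [mem_Ioc, mem_inter_iff, mem_Iic]
    constructor
    · rintro ⟨h, h'⟩; exact ⟨h', h, h'.trans hr.2⟩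
    · rintro ⟨h', h, _⟩; exact ⟨h, h'⟩
  have h2 : ∀ s ∈ Ioc a t, (∫ r in s..t, Φ r s) * f s = ∫ r, Ψ r s ∂μ := by
    intro s hs
    rw [← intervalIntegral.integral_mul_const, intervalIntegral.integral_of_le hs.2,
      ← integral_Icc_eq_integral_Ioc, hμ]
    have e : ∀ r, Ψ r s = (Ici s).indicator (fun r => Φ r s * f s) r := by
      intro r
      simp only [hΨ, indicator, mem_Iic, mem_Ici]
    simp only [e]
    rw [integral_indicator measurableSet_Ici, Measure.restrict_restrict measurableSet_Ici]
    congr 2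
    ext x
    simp only [mem_Icc, mem_inter_iff, mem_Ici, mem_Ioc]
    constructor
    · rintro ⟨h, h'⟩; exact ⟨h, hs.1.trans_le h, h'⟩
    · rintro ⟨h, _, h'⟩; exact ⟨h, h'⟩
  have hfi : Integrable f μ := by
    rw [hμ]; exact (intervalIntegrable_iff_integrableOn_Ioc_of_le hat).1 hf
  obtain ⟨M, hM⟩ := (isCompact_Icc.prod isCompact_Icc).exists_bound_of_continuousOn
    (s := Icc a t ×ˢ Icc a t) (f := Function.uncurry Φ) hΦ.continuousOn
  have hset : MeasurableSet {p : ℝ × ℝ | p.1 ≤ p.2} :=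
    measurableSet_le measurable_fst measurable_snd
  have e : Function.uncurry (fun s r => Ψ r s) =
      {p : ℝ × ℝ | p.1 ≤ p.2}.indicator (fun p => Φ p.2 p.1 * f p.1) := by
    funext ⟨s, r⟩
    simp only [Function.uncurry, hΨ, indicator, mem_Iic, mem_ofPred_eq]
  have hint : Integrable (Function.uncurry fun s r => Ψ r s) (μ.prod μ) := by
    rw [e]
    refine Integrable.indicator ?_ hset
    have hprod : Integrable (fun p : ℝ × ℝ => f p.1) (μ.prod μ) := hfi.comp_fst μ
    refine Integrable.bdd_mul (c := M) hprod ?_ ?_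
    · exact (hΦ.comp (continuous_snd.prodMk continuous_fst)).aestronglyMeasurable
    · rw [hμ, Measure.prod_restrict]
      refine (ae_restrict_iff' (measurableSet_Ioc.prod measurableSet_Ioc)).2
        (Eventually.of_forall fun p hp => ?_)
      exact hM (p.2, p.1) ⟨Ioc_subset_Icc_self hp.2, Ioc_subset_Icc_self hp.1⟩
  refine ⟨?_, ?_⟩
  · rw [intervalIntegrable_iff_integrableOn_Ioc_of_le hat]
    exact (integrableOn_congr_fun h1 measurableSet_Ioc).2 hint.integral_prod_right
  · rw [intervalIntegral.integral_of_le hat, intervalIntegral.integral_of_le hat,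
      setIntegral_congr_fun measurableSet_Ioc h2, setIntegral_congr_fun measurableSet_Ioc h1]
    exact integral_integral_swap (f := fun s r => Ψ r s) hint

end GPHierarchy

namespace GPHierarchy

/-! ### Trees and forests of collisions -/

/-- The two ways of summing over the triples of natural numbers with sum `m`. -/
theorem sum_antidiagonal_assoc {M : Type*} [AddCommMonoid M] (m : ℕ) (F : ℕ → ℕ → ℕ → M) :
    ∑ p ∈ Finset.HasAntidiagonal.antidiagonal m,
        ∑ q ∈ Finset.HasAntidiagonal.antidiagonal p.1, F q.1 q.2 p.2 =
      ∑ p ∈ Finset.HasAntidiagonal.antidiagonal m,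
        ∑ q ∈ Finset.HasAntidiagonal.antidiagonal p.2, F p.1 q.1 q.2 := by
  rw [Finset.sum_sigma', Finset.sum_sigma']
  refine Finset.sum_nbij' (fun x => ⟨(x.2.1, x.2.2 + x.1.2), (x.2.2, x.1.2)⟩)
    (fun x => ⟨(x.1.1 + x.2.1, x.2.2), (x.1.1, x.2.1)⟩) ?_ ?_ ?_ ?_ ?_
  · rintro ⟨⟨a, b⟩, c, d⟩ h
    simp only [Finset.mem_sigma, Finset.HasAntidiagonal.mem_antidiagonal] at h ⊢
    obtain ⟨rfl, rfl⟩ := h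
    simp [add_assoc]
  · rintro ⟨⟨a, b⟩, c, d⟩ h
    simp only [Finset.mem_sigma, Finset.HasAntidiagonal.mem_antidiagonal] at h ⊢
    obtain ⟨rfl, rfl⟩ := h
    simp [add_assoc]
  · rintro ⟨⟨a, b⟩, c, d⟩ h
    simp only [Finset.mem_sigma, Finset.HasAntidiagonal.mem_antidiagonal] at h
    obtain ⟨rfl, rfl⟩ := h
    rfl
  · rintro ⟨⟨a, b⟩, c, d⟩ h
    simp only [Finset.mem_sigma, Finset.HasAntidiagonal.mem_antidiagonal] at h
    obtain ⟨rfl, rfl⟩ := h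
    rfl
  · rintro ⟨⟨a, b⟩, c, d⟩ h
    rfl

theorem continuous_integral_of_continuous_uncurry {Φ : ℝ → ℝ → ℂ}
    (hΦ : Continuous fun p : ℝ × ℝ => Φ p.1 p.2) :
    Continuous fun p : ℝ × ℝ => ∫ r in p.1..p.2, Φ p.1 r := by
  have e : ∀ p : ℝ × ℝ, ∫ r in p.1..p.2, Φ p.1 r =
      (∫ r in (0 : ℝ)..p.2, Φ p.1 r) - ∫ r in (0 : ℝ)..p.1, Φ p.1 r := by
    intro p
    have hc : Continuous fun r => Φ p.1 r := hΦ.comp (continuous_const.prodMk continuous_id)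
    rw [intervalIntegral.integral_interval_sub_left] <;> exact hc.intervalIntegrable _ _
  simp only [e]
  have h' : Continuous (Function.uncurry fun (p : ℝ × ℝ) r => Φ p.1 r) :=
    hΦ.comp ((continuous_fst.comp continuous_fst).prodMk continuous_snd)
  exact (intervalIntegral.continuous_parametric_intervalIntegral_of_continuous h'
    continuous_snd).sub
    (intervalIntegral.continuous_parametric_intervalIntegral_of_continuous h' continuous_fst)

theorem intervalIntegrable_finsetSum {κ E : Type*} [NormedAddCommGroup E] {S : Finset κ}
    {f : κ → ℝ → E} {a c : ℝ}
    (hf : ∀ i ∈ S, IntervalIntegrable (f i) volume a c) :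
    IntervalIntegrable (fun s => ∑ i ∈ S, f i s) volume a c := by
  simpa only [Finset.sum_fn] using IntervalIntegrable.sum S hf

noncomputable section Trees

variable {ι : Type*} (K : Finset ι) (b : ℝ → ι → ι → ι → ℂ)

/-- The collision part of the truncated hierarchy: every particle in turn is replaced by two
neighbouring ones. -/
def hierarchyOp (t : ℝ) (h : List ι → ℂ) (l : List ι) : ℂ :=
  ∑ i : Fin l.length, ∑ x ∈ K, ∑ y ∈ K, b t (l.get i) x y *
    h (l.take i ++ x :: y :: l.drop (i + 1))

theorem hierarchyOp_nil (t : ℝ) (h : List ι → ℂ) : hierarchyOp K b t h [] = 0 := by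
  simp [hierarchyOp]

theorem hierarchyOp_cons (t : ℝ) (h : List ι → ℂ) (q : ι) (l : List ι) :
    hierarchyOp K b t h (q :: l) = (∑ x ∈ K, ∑ y ∈ K, b t q x y * h (x :: y :: l)) +
      hierarchyOp K b t (fun l' => h (q :: l')) l := by
  rw [hierarchyOp, hierarchyOp]
  exact Fin.sum_univ_succ (n := l.length) _

theorem hierarchyOp_add (t : ℝ) (h h' : List ι → ℂ) (l : List ι) :
    hierarchyOp K b t (fun l' => h l' + h' l') l =
      hierarchyOp K b t h l + hierarchyOp K b t h' l := by
  simp only [hierarchyOp, mul_add, Finset.sum_add_distrib]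

theorem hierarchyOp_const_mul (t : ℝ) (c : ℂ) (h : List ι → ℂ) (l : List ι) :
    hierarchyOp K b t (fun l' => c * h l') l = c * hierarchyOp K b t h l := by
  simp only [hierarchyOp, Finset.mul_sum, mul_left_comm c]

theorem hierarchyOp_sum (t : ℝ) {κ : Type*} (S : Finset κ) (h : κ → List ι → ℂ) (l : List ι) :
    hierarchyOp K b t (fun l' => ∑ i ∈ S, h i l') l = ∑ i ∈ S, hierarchyOp K b t (h i) l := by
  classical
  induction S using Finset.induction_on with
  | empty => simp [hierarchyOp]
  | insert i S hi ih => simp only [Finset.sum_insert hi, hierarchyOp_add, ih]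

theorem hierarchyOp_congr (t : ℝ) {h h' : List ι → ℂ} {l : List ι} {k : ℕ}
    (hl : l ∈ listsOf K k) (H : ∀ l' ∈ listsOf K (k + 1), h l' = h' l') :
    hierarchyOp K b t h l = hierarchyOp K b t h' l := by
  obtain ⟨hlen, hK⟩ := mem_listsOf.1 hl
  refine Finset.sum_congr rfl fun i _ => Finset.sum_congr rfl fun x hx =>
    Finset.sum_congr rfl fun y hy => ?_
  rw [H]
  rw [mem_listsOf]
  have := i.2
  refine ⟨by simp; omega, fun z hz => ?_⟩
  simp only [List.mem_append, List.mem_cons] at hz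
  rcases hz with hz | rfl | rfl | hz
  · exact hK z (List.mem_of_mem_take hz)
  · exact hx
  · exact hy
  · exact hK z (List.mem_of_mem_drop hz)

variable {b} in
theorem intervalIntegral_hierarchyOp {a c : ℝ} {h : ℝ → List ι → ℂ}
    (hh : ∀ l, IntervalIntegrable (fun s => h s l) volume a c) (t : ℝ) (l : List ι) :
    ∫ s in a..c, hierarchyOp K b t (h s) l =
      hierarchyOp K b t (fun l' => ∫ s in a..c, h s l') l := by
  have hi : ∀ q x y l', IntervalIntegrable (fun s => b t q x y * h s l') volume a c :=
    fun q x y l' => (hh l').const_mul _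
  unfold hierarchyOp
  rw [intervalIntegral.integral_finsetSum]
  swap
  · exact fun i _ => intervalIntegrable_finsetSum fun x _ => intervalIntegrable_finsetSum
      fun y _ => hi _ _ _ _
  refine Finset.sum_congr rfl fun i _ => ?_
  rw [intervalIntegral.integral_finsetSum]
  swap
  · exact fun x _ => intervalIntegrable_finsetSum fun y _ => hi _ _ _ _
  refine Finset.sum_congr rfl fun x _ => ?_
  rw [intervalIntegral.integral_finsetSum]
  swap
  · exact fun y _ => hi _ _ _ _
  exact Finset.sum_congr rfl fun y _ => intervalIntegral.integral_const_mul _ _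

variable [DecidableEq ι]

/-- The contribution to one particle `q` at time `t` of all binary trees with `m` nodes and leaves
`l`, when the collision times are restricted to `[s, t]` and decrease from the root to the leaves.
A tree with `m` nodes has `m + 1` leaves; the value at lists of another length is immaterial. -/
def treeKernel (s : ℝ) : ℕ → ℝ → ι → List ι → ℂ
  | 0 => fun _ q l => if l = [q] then 1 else 0
  | m + 1 => fun t q l => ∫ r in s..t, ∑ i : Fin (m + 1), ∑ x ∈ K, ∑ y ∈ K,
      b r q x y * treeKernel s i r x (l.take (i + 1)) * treeKernel s (m - i) r y (l.drop (i + 1))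
  decreasing_by all_goals omega

/-- The time derivative of `treeKernel`. -/
def treeDeriv (s : ℝ) : ℕ → ℝ → ι → List ι → ℂ
  | 0 => fun _ _ _ => 0
  | m + 1 => fun t q l => ∑ ij ∈ Finset.HasAntidiagonal.antidiagonal m, ∑ x ∈ K, ∑ y ∈ K,
      b t q x y * treeKernel K b s ij.1 t x (l.take (ij.1 + 1)) *
        treeKernel K b s ij.2 t y (l.drop (ij.1 + 1))

/-- The contribution to the particles `qs` at time `t` of all forests of binary trees with `m` nodes
and leaves `l`. -/
def forestKernel (s : ℝ) : List ι → ℕ → ℝ → List ι → ℂ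
  | [] => fun m _ _ => if m = 0 then 1 else 0
  | q :: qs => fun m t l => ∑ ij ∈ Finset.HasAntidiagonal.antidiagonal m,
      treeKernel K b s ij.1 t q (l.take (ij.1 + 1)) *
        forestKernel s qs ij.2 t (l.drop (ij.1 + 1))

theorem treeKernel_zero (s t : ℝ) (q : ι) (l : List ι) :
    treeKernel K b s 0 t q l = if l = [q] then 1 else 0 := by
  rw [treeKernel]

theorem treeKernel_succ (s : ℝ) (m : ℕ) (t : ℝ) (q : ι) (l : List ι) :
    treeKernel K b s (m + 1) t q l = ∫ r in s..t, treeDeriv K b s (m + 1) r q l := by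
  rw [treeKernel]
  beta_reduce
  congr 1
  funext r
  rw [treeDeriv]
  beta_reduce
  rw [Finset.Nat.sum_antidiagonal_eq_sum_range_succ (fun i j => ∑ x ∈ K, ∑ y ∈ K,
      b r q x y * treeKernel K b s i r x (l.take (i + 1)) *
        treeKernel K b s j r y (l.drop (i + 1))), Finset.sum_range]

variable {b}

theorem continuous_treeKernel_uncurry (hb : ∀ q x y, Continuous fun t => b t q x y)
    (m : ℕ) : ∀ (q : ι) (l : List ι),
    Continuous fun p : ℝ × ℝ => treeKernel K b p.1 m p.2 q l := by
  induction m using Nat.strong_induction_on with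
  | _ m ih =>
    intro q l
    cases m with
    | zero => simp only [treeKernel_zero]; exact continuous_const
    | succ m =>
      have hD : Continuous fun p : ℝ × ℝ => treeDeriv K b p.1 (m + 1) p.2 q l := by
        simp only [treeDeriv]
        refine continuous_finsetSum _ fun ij hij => continuous_finsetSum _ fun x _ =>
          continuous_finsetSum _ fun y _ => ?_
        rw [Finset.HasAntidiagonal.mem_antidiagonal] at hij
        have h0 : Continuous fun p : ℝ × ℝ => b p.2 q x y := (hb q x y).comp continuous_snd
        have h1 := ih ij.1 (by omega) x (l.take (ij.1 + 1))
        have h2 := ih ij.2 (by omega) y (l.drop (ij.1 + 1))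
        exact (h0.mul h1).mul h2
      simp only [treeKernel_succ]
      exact continuous_integral_of_continuous_uncurry
        (Φ := fun s r => treeDeriv K b s (m + 1) r q l) hD

theorem continuous_treeKernel (hb : ∀ q x y, Continuous fun t => b t q x y)
    (s : ℝ) (m : ℕ) (q : ι) (l : List ι) :
    Continuous fun t => treeKernel K b s m t q l :=
  (continuous_treeKernel_uncurry K hb m q l).comp (continuous_const.prodMk continuous_id)

theorem continuous_treeDeriv (hb : ∀ q x y, Continuous fun t => b t q x y)
    (s : ℝ) (m : ℕ) (q : ι) (l : List ι) :
    Continuous fun t => treeDeriv K b s m t q l := by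
  cases m with
  | zero => exact continuous_const
  | succ m =>
    refine continuous_finsetSum _ fun ij _ => continuous_finsetSum _ fun x _ =>
      continuous_finsetSum _ fun y _ => ?_
    exact ((hb q x y).mul (continuous_treeKernel K hb s _ _ _)).mul
      (continuous_treeKernel K hb s _ _ _)

theorem continuous_forestKernel_uncurry (hb : ∀ q x y, Continuous fun t => b t q x y)
    (qs : List ι) : ∀ (m : ℕ) (l : List ι),
    Continuous fun p : ℝ × ℝ => forestKernel K b p.1 qs m p.2 l := by
  induction qs with
  | nil => intro m l; exact continuous_const
  | cons q qs ih =>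
    intro m l
    exact continuous_finsetSum _ fun ij _ =>
      (continuous_treeKernel_uncurry K hb _ _ _).mul (ih _ _)

theorem hasDerivAt_treeKernel (hb : ∀ q x y, Continuous fun t => b t q x y)
    (s : ℝ) (m : ℕ) (t : ℝ) (q : ι) (l : List ι) :
    HasDerivAt (fun t => treeKernel K b s m t q l) (treeDeriv K b s m t q l) t := by
  cases m with
  | zero => simp only [treeKernel_zero]; exact hasDerivAt_const _ _
  | succ m =>
    simp only [treeKernel_succ]
    have hc := continuous_treeDeriv K hb s (m + 1) q l
    exact intervalIntegral.integral_hasDerivAt_right (hc.intervalIntegrable _ _)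
      (hc.stronglyMeasurableAtFilter _ _) hc.continuousAt

theorem hasDerivAt_forestKernel_zero (s : ℝ) (qs : List ι) (t : ℝ) (l : List ι) :
    HasDerivAt (fun t => forestKernel K b s qs 0 t l) 0 t := by
  have : ∀ t, forestKernel K b s qs 0 t l = forestKernel K b s qs 0 s l := by
    intro t
    induction qs generalizing l with
    | nil => rfl
    | cons q qs ih => simp [forestKernel, treeKernel_zero, ih l.tail]
  simp only [this]
  exact hasDerivAt_const _ _

/-- The forest kernels solve the truncated hierarchy. The derivative of a product of trees is
the sum over the trees of the product with this tree differentiated, and the derivative of a tree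
splits its root into two trees. -/
theorem hasDerivAt_forestKernel_succ (hb : ∀ q x y, Continuous fun t => b t q x y)
    (s : ℝ) (qs : List ι) :
    ∀ (m : ℕ) (t : ℝ) (l : List ι), HasDerivAt (fun t => forestKernel K b s qs (m + 1) t l)
      (hierarchyOp K b t (fun qs' => forestKernel K b s qs' m t l) qs) t := by
  induction qs with
  | nil =>
    intro m t l
    rw [hierarchyOp_nil]
    exact hasDerivAt_const _ _
  | cons q qs ih =>
    intro m t l
    -- the derivative of the forests with `j` nodes on the remaining roots `qs`
    set D : ℕ → List ι → ℂ := fun j l' => match j with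
      | 0 => 0
      | j + 1 => hierarchyOp K b t (fun qs' => forestKernel K b s qs' j t l') qs with hD
    have hd : ∀ j l', HasDerivAt (fun t => forestKernel K b s qs j t l') (D j l') t := by
      intro j l'
      cases j with
      | zero => exact hasDerivAt_forestKernel_zero K s qs t l'
      | succ j => exact ih j t l'
    have h1 : HasDerivAt (fun t => forestKernel K b s (q :: qs) (m + 1) t l)
        (∑ ij ∈ Finset.HasAntidiagonal.antidiagonal (m + 1),
          (treeDeriv K b s ij.1 t q (l.take (ij.1 + 1)) *
            forestKernel K b s qs ij.2 t (l.drop (ij.1 + 1)) +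
          treeKernel K b s ij.1 t q (l.take (ij.1 + 1)) * D ij.2 (l.drop (ij.1 + 1)))) t :=
      HasDerivAt.fun_sum fun ij _ =>
        (hasDerivAt_treeKernel K hb s ij.1 t q _).mul (hd ij.2 _)
    convert h1 using 1
    rw [Finset.sum_add_distrib, hierarchyOp_cons, Finset.Nat.sum_antidiagonal_succ,
      Finset.Nat.sum_antidiagonal_succ']
    simp only [hD, mul_zero]
    congr 1
    -- the part where the first tree is differentiated: its root splits into two
    · rw [treeDeriv, zero_mul, zero_add]
      have e1 : ∀ ij ∈ Finset.HasAntidiagonal.antidiagonal m,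
          treeDeriv K b s (ij.1 + 1) t q (l.take (ij.1 + 1 + 1)) *
            forestKernel K b s qs ij.2 t (l.drop (ij.1 + 1 + 1)) =
          ∑ ac ∈ Finset.HasAntidiagonal.antidiagonal ij.1, ∑ x ∈ K, ∑ y ∈ K, b t q x y *
            (treeKernel K b s ac.1 t x (l.take (ac.1 + 1)) *
            (treeKernel K b s ac.2 t y ((l.drop (ac.1 + 1)).take (ac.2 + 1)) *
            forestKernel K b s qs ij.2 t ((l.drop (ac.1 + 1)).drop (ac.2 + 1)))) := by
        intro ij _
        rw [treeDeriv, Finset.sum_mul]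
        refine Finset.sum_congr rfl fun ac hac => ?_
        rw [Finset.HasAntidiagonal.mem_antidiagonal] at hac
        simp only [Finset.sum_mul]
        refine Finset.sum_congr rfl fun x _ => Finset.sum_congr rfl fun y _ => ?_
        have l1 : (l.take (ij.1 + 1 + 1)).take (ac.1 + 1) = l.take (ac.1 + 1) := by
          rw [List.take_take, min_eq_left (by omega)]
        have l2 : (l.take (ij.1 + 1 + 1)).drop (ac.1 + 1) =
            (l.drop (ac.1 + 1)).take (ac.2 + 1) := by
          rw [List.drop_take]
          congr 1
          omega
        have l3 : l.drop (ij.1 + 1 + 1) = (l.drop (ac.1 + 1)).drop (ac.2 + 1) := by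
          rw [List.drop_drop]
          congr 1
          omega
        rw [l1, l2, l3]
        ring
      rw [Finset.sum_congr rfl e1]
      rw [sum_antidiagonal_assoc m (fun a c j => ∑ x ∈ K, ∑ y ∈ K, b t q x y *
            (treeKernel K b s a t x (l.take (a + 1)) *
            (treeKernel K b s c t y ((l.drop (a + 1)).take (c + 1)) *
            forestKernel K b s qs j t ((l.drop (a + 1)).drop (c + 1)))))]
      simp only [forestKernel, Finset.mul_sum]
      simp only [Finset.sum_comm (s := K) (t := Finset.HasAntidiagonal.antidiagonal _)]
    -- the part where one of the other trees is differentiated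
    · simp only [forestKernel, hierarchyOp_sum, hierarchyOp_const_mul, zero_add]

/-- At the initial time there are no forests with a collision. -/
theorem forestKernel_succ_self (s : ℝ) (qs : List ι) : ∀ (m : ℕ) (l : List ι),
    forestKernel K b s qs (m + 1) s l = 0 := by
  induction qs with
  | nil => intro m l; simp [forestKernel]
  | cons q qs ih =>
    intro m l
    refine Finset.sum_eq_zero fun ij hij => ?_
    rw [Finset.HasAntidiagonal.mem_antidiagonal] at hij
    rcases h : ij.1 with _ | i
    · have : ij.2 = m + 1 := by omega
      rw [this, ih, mul_zero]
    · rw [treeKernel_succ, intervalIntegral.integral_same, zero_mul]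

theorem continuous_hierarchyOp_forestKernel (hb : ∀ q x y, Continuous fun t => b t q x y)
    (qs : List ι) (m : ℕ) (l : List ι) :
    Continuous fun p : ℝ × ℝ =>
      hierarchyOp K b p.2 (fun qs' => forestKernel K b p.1 qs' m p.2 l) qs :=
  continuous_finsetSum _ fun _ _ => continuous_finsetSum _ fun _ _ =>
    continuous_finsetSum _ fun _ _ => ((hb _ _ _).comp continuous_snd).mul
      (continuous_forestKernel_uncurry K hb _ _ _)

theorem forestKernel_succ_eq_integral (hb : ∀ q x y, Continuous fun t => b t q x y)
    (s : ℝ) (qs : List ι) (m : ℕ) (t : ℝ) (l : List ι) :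
    forestKernel K b s qs (m + 1) t l =
      ∫ r in s..t, hierarchyOp K b r (fun qs' => forestKernel K b s qs' m r l) qs := by
  rw [intervalIntegral.integral_eq_sub_of_hasDerivAt
    (fun r _ => hasDerivAt_forestKernel_succ K hb s qs m r l), forestKernel_succ_self K, sub_zero]
  exact Continuous.intervalIntegrable ((continuous_hierarchyOp_forestKernel K hb qs m l).comp
    (continuous_const.prodMk continuous_id)) _ _

end Trees

end GPHierarchy

namespace GPHierarchy

/-! ### Operator bounds for trees and forests -/

noncomputable section TreeBounds

/-- The bound for the trees with `m` nodes: `θ` for each node, and the number of binary trees. -/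
def treeBound (θ : ℝ) (m : ℕ) : ℝ := θ ^ m * catalan m

theorem treeBound_zero (θ : ℝ) : treeBound θ 0 = 1 := by simp [treeBound]

/-- The recursion of the Catalan numbers. -/
theorem treeBound_succ (θ : ℝ) (m : ℕ) : treeBound θ (m + 1) =
    θ * ∑ ij ∈ Finset.HasAntidiagonal.antidiagonal m, treeBound θ ij.1 * treeBound θ ij.2 := by
  rw [treeBound, catalan_succ', pow_succ', mul_assoc]
  congr 1
  push_cast
  rw [Finset.mul_sum]
  refine Finset.sum_congr rfl fun ij hij => ?_
  rw [Finset.HasAntidiagonal.mem_antidiagonal] at hij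
  rw [treeBound, treeBound, ← hij, pow_add]
  ring

theorem treeBound_pos {θ : ℝ} (hθ : 0 < θ) (m : ℕ) : 0 < treeBound θ m := by
  have h : 0 < catalan m := by
    have := succ_mul_catalan_eq_centralBinom m
    have := Nat.centralBinom_pos m
    by_contra h0
    have : catalan m = 0 := by omega
    simp_all
  unfold treeBound
  positivity

theorem treeBound_le {θ : ℝ} (hθ : 0 < θ) (m : ℕ) : treeBound θ m ≤ (4 * θ) ^ m := by
  have h : catalan m ≤ 4 ^ m := by
    rw [catalan_eq_centralBinom_div]
    exact (Nat.div_le_self _ _).trans (Nat.centralBinom_le_four_pow m)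
  rw [mul_pow, mul_comm, treeBound]
  gcongr
  exact_mod_cast h

/-- The Cauchy-Schwarz inequality with weights. -/
theorem sq_norm_sum_le_weighted {κ : Type*} (S : Finset κ) (w : κ → ℝ) (z : κ → ℂ)
    (hw : ∀ i ∈ S, 0 < w i) :
    ‖∑ i ∈ S, z i‖ ^ 2 ≤ (∑ i ∈ S, w i) * ∑ i ∈ S, ‖z i‖ ^ 2 / w i := by
  calc ‖∑ i ∈ S, z i‖ ^ 2 ≤ (∑ i ∈ S, ‖z i‖) ^ 2 := by
        gcongr
        exact norm_sum_le _ _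
    _ ≤ _ := by
        refine Finset.sum_sq_le_sum_mul_sum_of_sq_le_mul S (fun i hi => (hw i hi).le)
          (fun i hi => div_nonneg (sq_nonneg _) (hw i hi).le) fun i hi => ?_
        rw [mul_div_cancel₀ _ (hw i hi).ne']

theorem integral_sum_of_continuous {κ E : Type*} [NormedAddCommGroup E] [NormedSpace ℝ E]
    {S : Finset κ} {f : κ → ℝ → E} {a c : ℝ} (hf : ∀ i ∈ S, Continuous (f i)) :
    ∫ t in a..c, ∑ i ∈ S, f i t = ∑ i ∈ S, ∫ t in a..c, f i t :=
  intervalIntegral.integral_finsetSum fun i hi => (hf i hi).intervalIntegrable _ _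

variable {ι : Type*} [DecidableEq ι] (K : Finset ι) {b : ℝ → ι → ι → ι → ℂ} {s δ θ C : ℝ}

variable (b s δ θ) in
/-- The trees with `m` nodes define operators on `ℓ²` of norm at most `treeBound θ m`. -/
def TreeKernelBound (m : ℕ) : Prop :=
  ∀ t ∈ Icc s (s + δ), ∀ h : List ι → ℂ,
    ∑ q ∈ K, ‖∑ l ∈ listsOf K (m + 1), treeKernel K b s m t q l * h l‖ ^ 2 ≤
      treeBound θ m ^ 2 * ∑ l ∈ listsOf K (m + 1), ‖h l‖ ^ 2

variable (b s δ θ) in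
/-- The `L²` bound in time for the derivatives of trees with `m` nodes, from which
`TreeKernelBound` follows by the Cauchy-Schwarz inequality. -/
def TreeDerivBound (m : ℕ) : Prop :=
  ∀ h : List ι → ℂ,
    δ * ∫ t in s..(s + δ), ∑ q ∈ K, ‖∑ l ∈ listsOf K (m + 1), treeDeriv K b s m t q l * h l‖ ^ 2 ≤
      treeBound θ m ^ 2 * ∑ l ∈ listsOf K (m + 1), ‖h l‖ ^ 2

theorem treeKernelBound_zero : TreeKernelBound K b s δ θ 0 := by
  intro t _ h
  refine le_of_eq ?_
  rw [treeBound_zero, one_pow, one_mul, zero_add, sum_listsOf_one]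
  refine Finset.sum_congr rfl fun q hq => ?_
  rw [sum_listsOf_one]
  simp only [treeKernel_zero, List.cons.injEq, and_true, ite_mul, one_mul, zero_mul]
  rw [Finset.sum_ite_eq' K q, if_pos hq]

theorem treeDerivBound_zero : TreeDerivBound K b s δ θ 0 := by
  intro h
  simp only [treeDeriv, zero_mul, Finset.sum_const_zero, norm_zero]
  simp
  positivity

theorem continuous_sum_treeDeriv (hb : ∀ q x y, Continuous fun t => b t q x y) (m : ℕ) (q : ι)
    (L : Finset (List ι)) (h : List ι → ℂ) :
    Continuous fun t => ∑ l ∈ L, treeDeriv K b s m t q l * h l :=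
  continuous_finsetSum _ fun l _ => (continuous_treeDeriv K hb s m q l).mul continuous_const

theorem treeKernelBound_of_treeDerivBound (hb : ∀ q x y, Continuous fun t => b t q x y)
    (hδ : 0 < δ) {m : ℕ} (H : TreeDerivBound K b s δ θ (m + 1)) :
    TreeKernelBound K b s δ θ (m + 1) := by
  intro t ht h
  refine le_trans ?_ (H h)
  have hc := fun q => continuous_sum_treeDeriv K (s := s) hb (m + 1) q (listsOf K (m + 1 + 1)) h
  rw [integral_sum_of_continuous, Finset.mul_sum]
  swap
  · exact fun q _ => (hc q).norm.pow 2
  refine Finset.sum_le_sum fun q _ => ?_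
  have e : ∑ l ∈ listsOf K (m + 1 + 1), treeKernel K b s (m + 1) t q l * h l =
      ∫ r in s..t, ∑ l ∈ listsOf K (m + 1 + 1), treeDeriv K b s (m + 1) r q l * h l := by
    rw [integral_sum_of_continuous]
    swap
    · exact fun l _ => (continuous_treeDeriv K hb s (m + 1) q l).mul continuous_const
    refine Finset.sum_congr rfl fun l _ => ?_
    rw [intervalIntegral.integral_mul_const, treeKernel_succ]
  rw [e]
  exact sq_norm_intervalIntegral_le ht.1 ht.2 hδ ((hc q).intervalIntegrable _ _)
    (((hc q).norm.pow 2).intervalIntegrable _ _)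

variable (b s) in
/-- Two trees with `i` and `j` nodes applied to `h`. -/
def treePair (i j : ℕ) (h : List ι → ℂ) (t : ℝ) (x y : ι) : ℂ :=
  ∑ l₁ ∈ listsOf K (i + 1), ∑ l₂ ∈ listsOf K (j + 1),
    treeKernel K b s i t x l₁ * treeKernel K b s j t y l₂ * h (l₁ ++ l₂)

variable (b s) in
/-- The part of the derivative of `treePair` where the first tree is differentiated. -/
def treePairDerivLeft (i j : ℕ) (h : List ι → ℂ) (t : ℝ) (x y : ι) : ℂ :=
  ∑ l₁ ∈ listsOf K (i + 1), ∑ l₂ ∈ listsOf K (j + 1),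
    treeDeriv K b s i t x l₁ * treeKernel K b s j t y l₂ * h (l₁ ++ l₂)

variable (b s) in
/-- The part of the derivative of `treePair` where the second tree is differentiated. -/
def treePairDerivRight (i j : ℕ) (h : List ι → ℂ) (t : ℝ) (x y : ι) : ℂ :=
  ∑ l₁ ∈ listsOf K (i + 1), ∑ l₂ ∈ listsOf K (j + 1),
    treeKernel K b s i t x l₁ * treeDeriv K b s j t y l₂ * h (l₁ ++ l₂)

theorem continuous_treePairDerivLeft (hb : ∀ q x y, Continuous fun t => b t q x y) (i j : ℕ)
    (h : List ι → ℂ) (x y : ι) : Continuous fun t => treePairDerivLeft K b s i j h t x y :=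
  continuous_finsetSum _ fun _ _ => continuous_finsetSum _ fun _ _ =>
    ((continuous_treeDeriv K hb s i x _).mul (continuous_treeKernel K hb s j y _)).mul
      continuous_const

theorem continuous_treePairDerivRight (hb : ∀ q x y, Continuous fun t => b t q x y) (i j : ℕ)
    (h : List ι → ℂ) (x y : ι) : Continuous fun t => treePairDerivRight K b s i j h t x y :=
  continuous_finsetSum _ fun _ _ => continuous_finsetSum _ fun _ _ =>
    ((continuous_treeKernel K hb s i x _).mul (continuous_treeDeriv K hb s j y _)).mul
      continuous_const

theorem hasDerivAt_treePair (hb : ∀ q x y, Continuous fun t => b t q x y) (i j : ℕ)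
    (h : List ι → ℂ) (t : ℝ) (x y : ι) : HasDerivAt (fun t => treePair K b s i j h t x y)
      (treePairDerivLeft K b s i j h t x y + treePairDerivRight K b s i j h t x y) t := by
  have h1 : HasDerivAt (fun t => treePair K b s i j h t x y)
      (∑ l₁ ∈ listsOf K (i + 1), ∑ l₂ ∈ listsOf K (j + 1),
        (treeDeriv K b s i t x l₁ * treeKernel K b s j t y l₂ +
          treeKernel K b s i t x l₁ * treeDeriv K b s j t y l₂) * h (l₁ ++ l₂)) t :=
    HasDerivAt.fun_sum fun l₁ _ => HasDerivAt.fun_sum fun l₂ _ =>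
      ((hasDerivAt_treeKernel K hb s i t x l₁).mul
        (hasDerivAt_treeKernel K hb s j t y l₂)).mul_const _
  convert h1 using 1
  simp only [treePairDerivLeft, treePairDerivRight, add_mul, Finset.sum_add_distrib]

theorem treePair_self_of_ne_zero {i j : ℕ} (hij : i ≠ 0 ∨ j ≠ 0) (h : List ι → ℂ) (x y : ι) :
    treePair K b s i j h s x y = 0 := by
  refine Finset.sum_eq_zero fun l₁ _ => Finset.sum_eq_zero fun l₂ _ => ?_
  rcases hij with hi | hj
  · obtain ⟨i, rfl⟩ := Nat.exists_eq_succ_of_ne_zero hi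
    rw [treeKernel_succ, intervalIntegral.integral_same, zero_mul, zero_mul]
  · obtain ⟨j, rfl⟩ := Nat.exists_eq_succ_of_ne_zero hj
    rw [treeKernel_succ K b s j, intervalIntegral.integral_same, mul_zero, zero_mul]

theorem integral_treePairDerivLeft_le (hb : ∀ q x y, Continuous fun t => b t q x y)
    (hδ : 0 < δ) {i j : ℕ} (Hi : TreeDerivBound K b s δ θ i) (Hj : TreeKernelBound K b s δ θ j)
    (h : List ι → ℂ) :
    δ * ∫ t in s..(s + δ), ∑ x ∈ K, ∑ y ∈ K, ‖treePairDerivLeft K b s i j h t x y‖ ^ 2 ≤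
      (treeBound θ i * treeBound θ j) ^ 2 * ∑ l ∈ listsOf K (i + 1 + (j + 1)), ‖h l‖ ^ 2 := by
  have hc := fun x l₂ => continuous_sum_treeDeriv K (s := s) hb i x (listsOf K (i + 1))
    (fun l₁ => h (l₁ ++ l₂))
  have h1 : ∀ t ∈ Icc s (s + δ), ∑ x ∈ K, ∑ y ∈ K, ‖treePairDerivLeft K b s i j h t x y‖ ^ 2 ≤
      treeBound θ j ^ 2 * ∑ l₂ ∈ listsOf K (j + 1), ∑ x ∈ K,
        ‖∑ l₁ ∈ listsOf K (i + 1), treeDeriv K b s i t x l₁ * h (l₁ ++ l₂)‖ ^ 2 := by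
    intro t ht
    rw [Finset.sum_comm (s := listsOf K (j + 1)), Finset.mul_sum]
    refine Finset.sum_le_sum fun x _ => ?_
    refine le_trans (le_of_eq ?_) (Hj t ht fun l₂ =>
      ∑ l₁ ∈ listsOf K (i + 1), treeDeriv K b s i t x l₁ * h (l₁ ++ l₂))
    refine Finset.sum_congr rfl fun y _ => ?_
    rw [treePairDerivLeft, Finset.sum_comm]
    congr 2
    refine Finset.sum_congr rfl fun l₂ _ => ?_
    rw [Finset.mul_sum]
    exact Finset.sum_congr rfl fun l₁ _ => by ring
  have h2 : ∫ t in s..(s + δ), ∑ x ∈ K, ∑ y ∈ K, ‖treePairDerivLeft K b s i j h t x y‖ ^ 2 ≤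
      ∫ t in s..(s + δ), treeBound θ j ^ 2 * ∑ l₂ ∈ listsOf K (j + 1), ∑ x ∈ K,
        ‖∑ l₁ ∈ listsOf K (i + 1), treeDeriv K b s i t x l₁ * h (l₁ ++ l₂)‖ ^ 2 := by
    refine intervalIntegral.integral_mono_on (by linarith) ?_ ?_ h1
    · exact Continuous.intervalIntegrable (continuous_finsetSum _ fun x _ =>
        continuous_finsetSum _ fun y _ =>
          (continuous_treePairDerivLeft K hb i j h x y).norm.pow 2) _ _
    · exact Continuous.intervalIntegrable (continuous_const.mul (continuous_finsetSum _ fun l₂ _ =>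
        continuous_finsetSum _ fun x _ => (hc x l₂).norm.pow 2)) _ _
  refine (mul_le_mul_of_nonneg_left h2 hδ.le).trans ?_
  rw [intervalIntegral.integral_const_mul, integral_sum_of_continuous,
    mul_left_comm, Finset.mul_sum, sum_listsOf_add K (i + 1) (j + 1), Finset.sum_comm, mul_pow,
    mul_comm (treeBound θ i ^ 2), mul_assoc]
  swap
  · exact fun l₂ _ => continuous_finsetSum _ fun x _ => (hc x l₂).norm.pow 2
  refine mul_le_mul_of_nonneg_left ?_ (sq_nonneg _)
  rw [Finset.mul_sum]
  refine Finset.sum_le_sum fun l₂ _ => ?_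
  exact Hi fun l₁ => h (l₁ ++ l₂)

theorem integral_treePairDerivRight_le (hb : ∀ q x y, Continuous fun t => b t q x y)
    (hδ : 0 < δ) {i j : ℕ} (Hi : TreeKernelBound K b s δ θ i) (Hj : TreeDerivBound K b s δ θ j)
    (h : List ι → ℂ) :
    δ * ∫ t in s..(s + δ), ∑ x ∈ K, ∑ y ∈ K, ‖treePairDerivRight K b s i j h t x y‖ ^ 2 ≤
      (treeBound θ i * treeBound θ j) ^ 2 * ∑ l ∈ listsOf K (i + 1 + (j + 1)), ‖h l‖ ^ 2 := by
  have hc := fun y l₁ => continuous_sum_treeDeriv K (s := s) hb j y (listsOf K (j + 1))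
    (fun l₂ => h (l₁ ++ l₂))
  have h1 : ∀ t ∈ Icc s (s + δ), ∑ x ∈ K, ∑ y ∈ K, ‖treePairDerivRight K b s i j h t x y‖ ^ 2 ≤
      treeBound θ i ^ 2 * ∑ l₁ ∈ listsOf K (i + 1), ∑ y ∈ K,
        ‖∑ l₂ ∈ listsOf K (j + 1), treeDeriv K b s j t y l₂ * h (l₁ ++ l₂)‖ ^ 2 := by
    intro t ht
    rw [Finset.sum_comm (s := listsOf K (i + 1)), Finset.mul_sum, Finset.sum_comm]
    refine Finset.sum_le_sum fun y _ => ?_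
    refine le_trans (le_of_eq ?_) (Hi t ht fun l₁ =>
      ∑ l₂ ∈ listsOf K (j + 1), treeDeriv K b s j t y l₂ * h (l₁ ++ l₂))
    refine Finset.sum_congr rfl fun x _ => ?_
    rw [treePairDerivRight]
    congr 2
    refine Finset.sum_congr rfl fun l₁ _ => ?_
    rw [Finset.mul_sum]
    exact Finset.sum_congr rfl fun l₂ _ => by ring
  have h2 : ∫ t in s..(s + δ), ∑ x ∈ K, ∑ y ∈ K, ‖treePairDerivRight K b s i j h t x y‖ ^ 2 ≤
      ∫ t in s..(s + δ), treeBound θ i ^ 2 * ∑ l₁ ∈ listsOf K (i + 1), ∑ y ∈ K,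
        ‖∑ l₂ ∈ listsOf K (j + 1), treeDeriv K b s j t y l₂ * h (l₁ ++ l₂)‖ ^ 2 := by
    refine intervalIntegral.integral_mono_on (by linarith) ?_ ?_ h1
    · exact Continuous.intervalIntegrable (continuous_finsetSum _ fun x _ =>
        continuous_finsetSum _ fun y _ =>
          (continuous_treePairDerivRight K hb i j h x y).norm.pow 2) _ _
    · exact Continuous.intervalIntegrable (continuous_const.mul (continuous_finsetSum _ fun l₁ _ =>
        continuous_finsetSum _ fun y _ => (hc y l₁).norm.pow 2)) _ _
  refine (mul_le_mul_of_nonneg_left h2 hδ.le).trans ?_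
  rw [intervalIntegral.integral_const_mul, integral_sum_of_continuous,
    mul_left_comm, Finset.mul_sum, sum_listsOf_add K (i + 1) (j + 1), mul_pow,
    mul_assoc]
  swap
  · exact fun l₁ _ => continuous_finsetSum _ fun y _ => (hc y l₁).norm.pow 2
  refine mul_le_mul_of_nonneg_left ?_ (sq_nonneg _)
  rw [Finset.mul_sum]
  refine Finset.sum_le_sum fun l₁ _ => ?_
  exact Hj fun l₂ => h (l₁ ++ l₂)

variable (b δ C) in
/-- The space-time estimate on time intervals of length `δ`, for the collision of one particle and
functions `F` which do not depend on time. -/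
def SpaceTimeBound : Prop :=
  ∀ (s : ℝ) (F : ι → ι → ℂ),
    ∫ t in s..(s + δ), ∑ q ∈ K, ‖∑ x ∈ K, ∑ y ∈ K, b t q x y * F x y‖ ^ 2 ≤
      C * ∑ x ∈ K, ∑ y ∈ K, ‖F x y‖ ^ 2

theorem sq_norm_add_le (z w : ℂ) : ‖z + w‖ ^ 2 ≤ 2 * ‖z‖ ^ 2 + 2 * ‖w‖ ^ 2 := by
  have h := norm_add_le z w
  have h0 := norm_nonneg (z + w)
  nlinarith [sq_nonneg (‖z‖ - ‖w‖)]

/-- The space-time estimate applied to two trees. It is stated for functions which do not depend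
on time, and the time dependence of the trees is removed by writing them as integrals of their
derivatives. -/
theorem integral_collision_treePair_le (hb : ∀ q x y, Continuous fun t => b t q x y)
    (hδ : 0 < δ) (hC : 0 ≤ C) (hST : SpaceTimeBound K b δ C) {i j : ℕ}
    (Ki : TreeKernelBound K b s δ θ i) (Kj : TreeKernelBound K b s δ θ j)
    (Di : TreeDerivBound K b s δ θ i) (Dj : TreeDerivBound K b s δ θ j) (h : List ι → ℂ) :
    ∫ t in s..(s + δ), ∑ q ∈ K, ‖∑ x ∈ K, ∑ y ∈ K, b t q x y * treePair K b s i j h t x y‖ ^ 2 ≤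
      4 * C * (treeBound θ i * treeBound θ j) ^ 2 *
        ∑ l ∈ listsOf K (i + 1 + (j + 1)), ‖h l‖ ^ 2 := by
  have hsδ : s ≤ s + δ := by linarith
  by_cases hij : i ≠ 0 ∨ j ≠ 0
  swap
  -- no collisions: `treePair` does not depend on time
  · push Not at hij
    obtain ⟨rfl, rfl⟩ := hij
    have e : ∀ t, ∀ x ∈ K, ∀ y ∈ K, treePair K b s 0 0 h t x y = h [x, y] := by
      intro t x hx y hy
      rw [treePair]
      simp only [zero_add, sum_listsOf_one, treeKernel_zero, List.cons.injEq, and_true]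
      simp [hx, hy]
    have e1 : ∀ t q, ∑ x ∈ K, ∑ y ∈ K, b t q x y * treePair K b s 0 0 h t x y =
        ∑ x ∈ K, ∑ y ∈ K, b t q x y * h [x, y] := fun t q =>
      Finset.sum_congr rfl fun x hx => Finset.sum_congr rfl fun y hy => by rw [e t x hx y hy]
    simp only [e1]
    refine (hST s fun x y => h [x, y]).trans ?_
    have e2 : ∑ l ∈ listsOf K (0 + 1 + (0 + 1)), ‖h l‖ ^ 2 =
        ∑ x ∈ K, ∑ y ∈ K, ‖h [x, y]‖ ^ 2 := by
      rw [sum_listsOf_add]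
      simp [sum_listsOf_one]
    rw [e2, treeBound_zero, one_mul, one_pow, mul_one]
    have : 0 ≤ ∑ x ∈ K, ∑ y ∈ K, ‖h [x, y]‖ ^ 2 := by positivity
    nlinarith [mul_nonneg hC this]
  · set D : ℝ → ι → ι → ℂ := fun r x y =>
      treePairDerivLeft K b s i j h r x y + treePairDerivRight K b s i j h r x y with hD
    have hDc : ∀ x y, Continuous fun r => D r x y := fun x y =>
      (continuous_treePairDerivLeft K hb i j h x y).add
        (continuous_treePairDerivRight K hb i j h x y)
    have hΦ : ∀ q, Continuous fun p : ℝ × ℝ => ∑ x ∈ K, ∑ y ∈ K, b p.1 q x y * D p.2 x y :=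
      fun q => continuous_finsetSum _ fun x _ => continuous_finsetSum _ fun y _ =>
        ((hb q x y).comp continuous_fst).mul ((hDc x y).comp continuous_snd)
    have e1 : ∀ t q, ∑ x ∈ K, ∑ y ∈ K, b t q x y * treePair K b s i j h t x y =
        ∫ r in s..t, ∑ x ∈ K, ∑ y ∈ K, b t q x y * D r x y := by
      intro t q
      rw [integral_sum_of_continuous]
      swap
      · exact fun x _ => continuous_finsetSum _ fun y _ => continuous_const.mul (hDc x y)
      refine Finset.sum_congr rfl fun x _ => ?_
      rw [integral_sum_of_continuous]
      swap
      · exact fun y _ => continuous_const.mul (hDc x y)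
      refine Finset.sum_congr rfl fun y _ => ?_
      rw [intervalIntegral.integral_const_mul, intervalIntegral.integral_eq_sub_of_hasDerivAt
        (fun r _ => hasDerivAt_treePair K hb i j h r x y) ((hDc x y).intervalIntegrable _ _),
        treePair_self_of_ne_zero K hij, sub_zero]
    have hΨ : Continuous (Function.uncurry fun t r =>
        ∑ q ∈ K, ‖∑ x ∈ K, ∑ y ∈ K, b t q x y * D r x y‖ ^ 2) :=
      continuous_finsetSum _ fun q _ => (hΦ q).norm.pow 2
    -- the Cauchy-Schwarz inequality in `r` replaces the upper limit `t` of the integral by `s + δ`,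
    -- after which the integrals over `t` and `r` can be exchanged
    have h1 : ∫ t in s..(s + δ), ∑ q ∈ K,
          ‖∑ x ∈ K, ∑ y ∈ K, b t q x y * treePair K b s i j h t x y‖ ^ 2 ≤
        ∫ t in s..(s + δ), δ * ∫ r in s..(s + δ),
          ∑ q ∈ K, ‖∑ x ∈ K, ∑ y ∈ K, b t q x y * D r x y‖ ^ 2 := by
      have hF : ∀ x y, Continuous fun t => treePair K b s i j h t x y := fun x y =>
        continuous_iff_continuousAt.2 fun t => (hasDerivAt_treePair K hb i j h t x y).continuousAt
      refine intervalIntegral.integral_mono_on hsδ ?_ ?_ fun t ht => ?_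
      · exact Continuous.intervalIntegrable (continuous_finsetSum _ fun q _ =>
          (continuous_finsetSum _ fun x _ => continuous_finsetSum _ fun y _ =>
            (hb q x y).mul (hF x y)).norm.pow 2) _ _
      · exact Continuous.intervalIntegrable (continuous_const.mul
          (intervalIntegral.continuous_parametric_intervalIntegral_of_continuous' hΨ _ _)) _ _
      · have hcq : ∀ q, Continuous fun r => ∑ x ∈ K, ∑ y ∈ K, b t q x y * D r x y := fun q =>
          (hΦ q).comp (continuous_const.prodMk continuous_id)
        rw [integral_sum_of_continuous, Finset.mul_sum]
        swap
        · exact fun q _ => (hcq q).norm.pow 2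
        refine Finset.sum_le_sum fun q _ => ?_
        rw [e1]
        exact sq_norm_intervalIntegral_le ht.1 ht.2 hδ ((hcq q).intervalIntegrable _ _)
          (((hcq q).norm.pow 2).intervalIntegrable _ _)
    rw [intervalIntegral.integral_const_mul, intervalIntegral_swap_of_continuous hΨ hsδ] at h1
    have hL : Continuous fun r =>
        ∑ x ∈ K, ∑ y ∈ K, ‖treePairDerivLeft K b s i j h r x y‖ ^ 2 :=
      continuous_finsetSum _ fun x _ => continuous_finsetSum _ fun y _ =>
        (continuous_treePairDerivLeft K hb i j h x y).norm.pow 2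
    have hR : Continuous fun r =>
        ∑ x ∈ K, ∑ y ∈ K, ‖treePairDerivRight K b s i j h r x y‖ ^ 2 :=
      continuous_finsetSum _ fun x _ => continuous_finsetSum _ fun y _ =>
        (continuous_treePairDerivRight K hb i j h x y).norm.pow 2
    have h2 : ∫ r in s..(s + δ), ∫ t in s..(s + δ),
          ∑ q ∈ K, ‖∑ x ∈ K, ∑ y ∈ K, b t q x y * D r x y‖ ^ 2 ≤
        ∫ r in s..(s + δ), C *
          (2 * (∑ x ∈ K, ∑ y ∈ K, ‖treePairDerivLeft K b s i j h r x y‖ ^ 2) +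
            2 * ∑ x ∈ K, ∑ y ∈ K, ‖treePairDerivRight K b s i j h r x y‖ ^ 2) := by
      refine intervalIntegral.integral_mono_on hsδ ?_ ?_ fun r _ => ?_
      · refine Continuous.intervalIntegrable ?_ _ _
        have hΨ' : Continuous (Function.uncurry fun r t =>
            ∑ q ∈ K, ‖∑ x ∈ K, ∑ y ∈ K, b t q x y * D r x y‖ ^ 2) :=
          continuous_finsetSum _ fun q _ =>
            ((hΦ q).comp (continuous_snd.prodMk continuous_fst)).norm.pow 2
        exact intervalIntegral.continuous_parametric_intervalIntegral_of_continuous' hΨ' _ _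
      · exact Continuous.intervalIntegrable (continuous_const.mul
          ((continuous_const.mul hL).add (continuous_const.mul hR))) _ _
      · refine (hST s (D r)).trans (mul_le_mul_of_nonneg_left ?_ hC)
        simp only [Finset.mul_sum, ← Finset.sum_add_distrib]
        exact Finset.sum_le_sum fun x _ => Finset.sum_le_sum fun y _ => sq_norm_add_le _ _
    rw [intervalIntegral.integral_const_mul, intervalIntegral.integral_add
      (Continuous.intervalIntegrable (by fun_prop) _ _)
      (Continuous.intervalIntegrable (by fun_prop) _ _), intervalIntegral.integral_const_mul,
      intervalIntegral.integral_const_mul] at h2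
    have h3 := integral_treePairDerivLeft_le K hb hδ Di Kj h
    have h4 := integral_treePairDerivRight_le K hb hδ Ki Dj h
    have h5 := mul_le_mul_of_nonneg_left h2 hδ.le
    have h6 := mul_le_mul_of_nonneg_left h3 hC
    have h7 := mul_le_mul_of_nonneg_left h4 hC
    linarith

/-- The induction step: a tree with `m + 1` nodes consists of its root and two trees with `m` nodes
altogether. -/
theorem treeDerivBound_succ (hb : ∀ q x y, Continuous fun t => b t q x y)
    (hδ : 0 < δ) (hC : 0 ≤ C) (hST : SpaceTimeBound K b δ C) (hθ : 0 < θ)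
    (hθC : 4 * C * δ ≤ θ ^ 2) {m : ℕ} (HK : ∀ i ≤ m, TreeKernelBound K b s δ θ i)
    (HD : ∀ i ≤ m, TreeDerivBound K b s δ θ i) : TreeDerivBound K b s δ θ (m + 1) := by
  intro h
  set A := Finset.HasAntidiagonal.antidiagonal m with hA
  -- with these weights in the Cauchy-Schwarz inequality the sum over the splittings gives
  -- `(∑ w) ^ 2`, which is the square of the Catalan recursion
  set w : ℕ × ℕ → ℝ := fun ij => treeBound θ ij.1 * treeBound θ ij.2 with hw
  have hw0 : ∀ ij ∈ A, 0 < w ij := fun ij _ =>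
    mul_pos (treeBound_pos hθ _) (treeBound_pos hθ _)
  set N := ∑ l ∈ listsOf K (m + 1 + 1), ‖h l‖ ^ 2 with hN
  set Z : ℕ × ℕ → ℝ → ι → ℂ := fun ij t q =>
    ∑ x ∈ K, ∑ y ∈ K, b t q x y * treePair K b s ij.1 ij.2 h t x y with hZ
  have hZc : ∀ ij q, Continuous fun t => Z ij t q := fun ij q =>
    continuous_finsetSum _ fun x _ => continuous_finsetSum _ fun y _ => (hb q x y).mul
      (continuous_iff_continuousAt.2 fun t => (hasDerivAt_treePair K hb _ _ h t x y).continuousAt)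
  have e : ∀ t q, ∑ l ∈ listsOf K (m + 1 + 1), treeDeriv K b s (m + 1) t q l * h l =
      ∑ ij ∈ A, Z ij t q := by
    intro t q
    simp only [treeDeriv, Finset.sum_mul]
    rw [Finset.sum_comm]
    refine Finset.sum_congr rfl fun ij hij => ?_
    rw [Finset.HasAntidiagonal.mem_antidiagonal] at hij
    have hm : m + 1 + 1 = ij.1 + 1 + (ij.2 + 1) := by omega
    rw [hm, sum_listsOf_add K (ij.1 + 1) (ij.2 + 1)]
    simp only [hZ, treePair, Finset.mul_sum]
    have e1 : ∀ l₁ ∈ listsOf K (ij.1 + 1), ∀ l₂ : List ι,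
        (l₁ ++ l₂).take (ij.1 + 1) = l₁ ∧ (l₁ ++ l₂).drop (ij.1 + 1) = l₂ := fun l₁ h₁ l₂ =>
      ⟨List.take_left' (length_of_mem_listsOf h₁), List.drop_left' (length_of_mem_listsOf h₁)⟩
    have e2 : ∀ l₁ ∈ listsOf K (ij.1 + 1), ∑ l₂ ∈ listsOf K (ij.2 + 1), ∑ x ∈ K, ∑ y ∈ K,
        b t q x y * treeKernel K b s ij.1 t x ((l₁ ++ l₂).take (ij.1 + 1)) *
          treeKernel K b s ij.2 t y ((l₁ ++ l₂).drop (ij.1 + 1)) * h (l₁ ++ l₂) =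
        ∑ x ∈ K, ∑ y ∈ K, ∑ l₂ ∈ listsOf K (ij.2 + 1), b t q x y *
          (treeKernel K b s ij.1 t x l₁ * treeKernel K b s ij.2 t y l₂ * h (l₁ ++ l₂)) := by
      intro l₁ h₁
      rw [Finset.sum_comm]
      refine Finset.sum_congr rfl fun x _ => ?_
      rw [Finset.sum_comm]
      refine Finset.sum_congr rfl fun y _ => Finset.sum_congr rfl fun l₂ _ => ?_
      rw [(e1 l₁ h₁ l₂).1, (e1 l₁ h₁ l₂).2]
      ring
    rw [Finset.sum_congr rfl e2, Finset.sum_comm]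
    exact Finset.sum_congr rfl fun x _ => Finset.sum_comm
  have h1 : ∀ ij ∈ A, ∫ t in s..(s + δ), ∑ q ∈ K, ‖Z ij t q‖ ^ 2 ≤ 4 * C * w ij ^ 2 * N := by
    intro ij hij
    have hij' := Finset.HasAntidiagonal.mem_antidiagonal.1 hij
    have hm : m + 1 + 1 = ij.1 + 1 + (ij.2 + 1) := by omega
    rw [hN, hm]
    exact integral_collision_treePair_le K hb hδ hC hST (HK _ (by omega)) (HK _ (by omega))
      (HD _ (by omega)) (HD _ (by omega)) h
  have h2 : ∫ t in s..(s + δ), ∑ q ∈ K, ‖∑ ij ∈ A, Z ij t q‖ ^ 2 ≤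
      ∫ t in s..(s + δ), (∑ ij ∈ A, w ij) * ∑ ij ∈ A, (∑ q ∈ K, ‖Z ij t q‖ ^ 2) / w ij := by
    refine intervalIntegral.integral_mono_on (by linarith) ?_ ?_ fun t _ => ?_
    · exact Continuous.intervalIntegrable (continuous_finsetSum _ fun q _ =>
        (continuous_finsetSum _ fun ij _ => hZc ij q).norm.pow 2) _ _
    · exact Continuous.intervalIntegrable (continuous_const.mul (continuous_finsetSum _ fun ij _ =>
        (continuous_finsetSum _ fun q _ => (hZc ij q).norm.pow 2).div_const _)) _ _
    · simp only [Finset.sum_div]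
      rw [Finset.sum_comm (s := A), Finset.mul_sum]
      exact Finset.sum_le_sum fun q _ => sq_norm_sum_le_weighted A w _ hw0
  have h3 : ∫ t in s..(s + δ), (∑ ij ∈ A, w ij) * ∑ ij ∈ A, (∑ q ∈ K, ‖Z ij t q‖ ^ 2) / w ij ≤
      (∑ ij ∈ A, w ij) * (4 * C * N * ∑ ij ∈ A, w ij) := by
    have hcZ : ∀ ij, Continuous fun t => ∑ q ∈ K, ‖Z ij t q‖ ^ 2 := fun ij =>
      continuous_finsetSum _ fun q _ => (hZc ij q).norm.pow 2
    rw [intervalIntegral.integral_const_mul, integral_sum_of_continuous]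
    swap
    · exact fun ij _ => (hcZ ij).div_const _
    refine mul_le_mul_of_nonneg_left ?_ (Finset.sum_nonneg fun ij hij => (hw0 ij hij).le)
    rw [Finset.mul_sum]
    refine Finset.sum_le_sum fun ij hij => ?_
    rw [intervalIntegral.integral_div, div_le_iff₀ (hw0 ij hij)]
    refine (h1 ij hij).trans (le_of_eq (by ring))
  simp only [e]
  have h4 := mul_le_mul_of_nonneg_left (h2.trans h3) hδ.le
  refine h4.trans ?_
  have hN0 : 0 ≤ N := by positivity
  rw [treeBound_succ]
  calc δ * ((∑ ij ∈ A, w ij) * (4 * C * N * ∑ ij ∈ A, w ij))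
      = 4 * C * δ * ((∑ ij ∈ A, w ij) ^ 2 * N) := by ring
    _ ≤ θ ^ 2 * ((∑ ij ∈ A, w ij) ^ 2 * N) := by gcongr
    _ = _ := by ring

/-- The tree bounds on a time interval whose length is limited by the constant of the space-time
estimate only. -/
theorem treeKernelBound_and_treeDerivBound (hb : ∀ q x y, Continuous fun t => b t q x y)
    (hδ : 0 < δ) (hC : 0 ≤ C) (hST : SpaceTimeBound K b δ C) (hθ : 0 < θ)
    (hθC : 4 * C * δ ≤ θ ^ 2) (m : ℕ) :
    TreeKernelBound K b s δ θ m ∧ TreeDerivBound K b s δ θ m := by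
  induction m using Nat.strong_induction_on with
  | _ m ih =>
    cases m with
    | zero => exact ⟨treeKernelBound_zero K, treeDerivBound_zero K⟩
    | succ m =>
      have h := treeDerivBound_succ (s := s) K hb hδ hC hST hθ hθC
        (fun i hi => (ih i (Nat.lt_succ_of_le hi)).1) (fun i hi => (ih i (Nat.lt_succ_of_le hi)).2)
      exact ⟨treeKernelBound_of_treeDerivBound K hb hδ h, h⟩

/-- Forests with `m` nodes on `k` roots define operators of norm at most `(m + 1) ^ k (4 θ) ^ m`
on `ℓ²`; in contrast to the number of orderings of the collisions, the number of forests does not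
grow factorially with `m`. -/
theorem forestKernel_bound (hθ : 0 < θ) (H : ∀ m, TreeKernelBound K b s δ θ m) {t : ℝ}
    (ht : t ∈ Icc s (s + δ)) (k : ℕ) : ∀ (m : ℕ) (f : List ι → ℂ),
    ∑ qs ∈ listsOf K k, ‖∑ l ∈ listsOf K (k + m), forestKernel K b s qs m t l * f l‖ ^ 2 ≤
      ((m + 1) ^ k * (4 * θ) ^ m) ^ 2 * ∑ l ∈ listsOf K (k + m), ‖f l‖ ^ 2 := by
  induction k with
  | zero =>
    intro m f
    rw [sum_listsOf_zero]
    simp only [forestKernel]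
    rcases m with _ | m
    · simp [sum_listsOf_zero]
    · simp
      positivity
  | succ k ih =>
    intro m f
    set A := Finset.HasAntidiagonal.antidiagonal m with hA
    set N := ∑ l ∈ listsOf K (k + 1 + m), ‖f l‖ ^ 2 with hN
    set Y : ℕ × ℕ → ι → List ι → ℂ := fun ij q l₂ =>
      ∑ l₁ ∈ listsOf K (ij.1 + 1), treeKernel K b s ij.1 t q l₁ * f (l₁ ++ l₂) with hY
    set Z : ℕ × ℕ → ι → List ι → ℂ := fun ij q qs =>
      ∑ l₂ ∈ listsOf K (k + ij.2), forestKernel K b s qs ij.2 t l₂ * Y ij q l₂ with hZ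
    -- the first tree has `ij.1` nodes, the other `k` trees have `ij.2`
    have e : ∀ q qs, ∑ l ∈ listsOf K (k + 1 + m), forestKernel K b s (q :: qs) m t l * f l =
        ∑ ij ∈ A, Z ij q qs := by
      intro q qs
      simp only [forestKernel, Finset.sum_mul]
      rw [Finset.sum_comm]
      refine Finset.sum_congr rfl fun ij hij => ?_
      have hij' := Finset.HasAntidiagonal.mem_antidiagonal.1 hij
      have hm : k + 1 + m = ij.1 + 1 + (k + ij.2) := by omega
      rw [hm, sum_listsOf_add K (ij.1 + 1) (k + ij.2), Finset.sum_comm]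
      simp only [hZ, hY, Finset.mul_sum]
      refine Finset.sum_congr rfl fun l₂ _ => Finset.sum_congr rfl fun l₁ h₁ => ?_
      rw [List.take_left' (length_of_mem_listsOf h₁), List.drop_left' (length_of_mem_listsOf h₁)]
      ring
    have h1 : ∀ ij ∈ A, ∑ q ∈ K, ∑ qs ∈ listsOf K k, ‖Z ij q qs‖ ^ 2 ≤
        ((m + 1) ^ k * (4 * θ) ^ m) ^ 2 * N := by
      intro ij hij
      have hij' := Finset.HasAntidiagonal.mem_antidiagonal.1 hij
      have hm : k + 1 + m = ij.1 + 1 + (k + ij.2) := by omega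
      calc ∑ q ∈ K, ∑ qs ∈ listsOf K k, ‖Z ij q qs‖ ^ 2
          ≤ ∑ q ∈ K, ((ij.2 + 1) ^ k * (4 * θ) ^ ij.2) ^ 2 *
            ∑ l₂ ∈ listsOf K (k + ij.2), ‖Y ij q l₂‖ ^ 2 :=
            Finset.sum_le_sum fun q _ => ih ij.2 (Y ij q)
        _ = ((ij.2 + 1) ^ k * (4 * θ) ^ ij.2) ^ 2 *
            ∑ l₂ ∈ listsOf K (k + ij.2), ∑ q ∈ K, ‖Y ij q l₂‖ ^ 2 := by
            rw [← Finset.mul_sum, Finset.sum_comm]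
        _ ≤ ((ij.2 + 1) ^ k * (4 * θ) ^ ij.2) ^ 2 * ∑ l₂ ∈ listsOf K (k + ij.2),
            (treeBound θ ij.1 ^ 2 * ∑ l₁ ∈ listsOf K (ij.1 + 1), ‖f (l₁ ++ l₂)‖ ^ 2) := by
            gcongr with l₂ _
            exact H ij.1 t ht fun l₁ => f (l₁ ++ l₂)
        _ = ((ij.2 + 1) ^ k * (4 * θ) ^ ij.2) ^ 2 * treeBound θ ij.1 ^ 2 * N := by
            rw [hN, hm, sum_listsOf_add K (ij.1 + 1) (k + ij.2), Finset.sum_comm, ← Finset.mul_sum]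
            ring
        _ ≤ ((m + 1) ^ k * (4 * θ) ^ ij.2) ^ 2 * ((4 * θ) ^ ij.1) ^ 2 * N := by
            have hb := treeBound_le hθ ij.1
            have hb0 := (treeBound_pos hθ ij.1).le
            have hc : (ij.2 : ℝ) ≤ m := by
              have : ij.2 ≤ m := by omega
              exact_mod_cast this
            gcongr
        _ = _ := by
            rw [← hij', pow_add]
            ring
    rw [sum_listsOf_succ]
    simp only [e]
    calc ∑ q ∈ K, ∑ qs ∈ listsOf K k, ‖∑ ij ∈ A, Z ij q qs‖ ^ 2
        ≤ ∑ q ∈ K, ∑ qs ∈ listsOf K k, (m + 1) * ∑ ij ∈ A, ‖Z ij q qs‖ ^ 2 := by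
          refine Finset.sum_le_sum fun q _ => Finset.sum_le_sum fun qs _ => ?_
          have := sq_norm_sum_le_weighted A (fun _ => 1) (fun ij => Z ij q qs)
            (fun _ _ => one_pos)
          simpa [hA] using this
      _ = (m + 1) * ∑ ij ∈ A, ∑ q ∈ K, ∑ qs ∈ listsOf K k, ‖Z ij q qs‖ ^ 2 := by
          simp only [← Finset.mul_sum]
          congr 1
          rw [Finset.sum_comm (s := A)]
          exact Finset.sum_congr rfl fun q _ => Finset.sum_comm
      _ ≤ (m + 1) * ∑ ij ∈ A, ((m + 1) ^ k * (4 * θ) ^ m) ^ 2 * N := by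
          gcongr with ij hij
          exact h1 ij hij
      _ = _ := by
          rw [Finset.sum_const, hA, Finset.Nat.card_antidiagonal]
          simp only [nsmul_eq_mul]
          push_cast
          ring

end TreeBounds

end GPHierarchy

namespace GPHierarchy

/-! ### The Duhamel expansion -/

noncomputable section Duhamel

variable {ι : Type*} [DecidableEq ι] (K : Finset ι) (b : ℝ → ι → ι → ι → ℂ)

/-- The `m`-fold iterated Duhamel integral, started at time `a`, for `k` particles: the sum over all
forests with `m` nodes. -/
def duhamelIter (a : ℝ) (k m : ℕ) (f : ℝ → List ι → ℂ) (t : ℝ) (qs : List ι) : ℂ :=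
  ∫ s in a..t, ∑ l ∈ listsOf K (k + m), forestKernel K b s qs m t l * f s l

variable {b}

theorem forestKernel_zero (s t : ℝ) {qs : List ι} : ∀ {l : List ι}, l ∈ listsOf K qs.length →
    forestKernel K b s qs 0 t l = if l = qs then 1 else 0 := by
  induction qs with
  | nil =>
    intro l hl
    have := List.length_eq_zero_iff.1 (length_of_mem_listsOf hl)
    simp [forestKernel, this]
  | cons q qs ih =>
    intro l hl
    obtain ⟨h1, h2⟩ := mem_listsOf.1 hl
    cases l with
    | nil => simp at h1
    | cons x l =>
      have : l ∈ listsOf K qs.length :=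
        mem_listsOf.2 ⟨by simpa using h1, fun y hy => h2 y (List.mem_cons_of_mem _ hy)⟩
      by_cases hx : x = q <;> simp [forestKernel, treeKernel_zero, ih this, hx]

theorem duhamelIter_zero (a : ℝ) {k : ℕ} (f : ℝ → List ι → ℂ) (t : ℝ) {qs : List ι}
    (hqs : qs ∈ listsOf K k) : duhamelIter K b a k 0 f t qs = ∫ s in a..t, f s qs := by
  have hk := length_of_mem_listsOf hqs
  subst hk
  refine intervalIntegral.integral_congr fun s _ => ?_
  change ∑ l ∈ listsOf K qs.length, forestKernel K b s qs 0 t l * f s l = f s qs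
  rw [Finset.sum_congr rfl fun l hl => by rw [forestKernel_zero K s t hl], Finset.sum_eq_single qs]
  · simp
  · intro l _ hl
    simp [hl]
  · exact fun h => absurd hqs h

theorem intervalIntegrable_forestKernel_mul (hb : ∀ q x y, Continuous fun t => b t q x y)
    {a c : ℝ} {f : ℝ → List ι → ℂ} (hf : ∀ l, IntervalIntegrable (fun s => f s l) volume a c)
    (qs : List ι) (m : ℕ) (t : ℝ) (l : List ι) :
    IntervalIntegrable (fun s => forestKernel K b s qs m t l * f s l) volume a c :=
  (hf l).continuousOn_mul (Continuous.continuousOn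
    ((continuous_forestKernel_uncurry K hb qs m l).comp (continuous_id.prodMk continuous_const)))

theorem hierarchyOp_duhamelIter (hb : ∀ q x y, Continuous fun t => b t q x y) {a r : ℝ}
    (k m : ℕ) {f : ℝ → List ι → ℂ} (hf : ∀ l, IntervalIntegrable (fun s => f s l) volume a r)
    (qs : List ι) : hierarchyOp K b r (duhamelIter K b a k m f r) qs =
      ∑ l ∈ listsOf K (k + m), ∫ s in a..r,
        hierarchyOp K b r (fun qs' => forestKernel K b s qs' m r l) qs * f s l := by
  have h1 : duhamelIter K b a k m f r = fun qs' => ∑ l ∈ listsOf K (k + m),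
      ∫ s in a..r, f s l * forestKernel K b s qs' m r l := by
    funext qs'
    simp only [duhamelIter, mul_comm (f _ _)]
    exact intervalIntegral.integral_finsetSum fun l _ =>
      intervalIntegrable_forestKernel_mul K hb hf qs' m r l
  rw [h1, hierarchyOp_sum]
  refine Finset.sum_congr rfl fun l _ => ?_
  rw [← intervalIntegral_hierarchyOp K (h := fun s qs' => f s l * forestKernel K b s qs' m r l)]
  · refine intervalIntegral.integral_congr fun s _ => ?_
    rw [mul_comm]
    exact hierarchyOp_const_mul K b r (f s l) _ qs
  · intro qs'
    simp only [mul_comm (f _ _)]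
    exact intervalIntegrable_forestKernel_mul K hb hf qs' m r l

/-- The recursion of the iterated Duhamel integrals: peeling off the first collision. -/
theorem duhamelIter_succ (hb : ∀ q x y, Continuous fun t => b t q x y) {a t : ℝ} (hat : a ≤ t)
    (k m : ℕ) {f : ℝ → List ι → ℂ} (hf : ∀ l, IntervalIntegrable (fun s => f s l) volume a t)
    (qs : List ι) :
    IntervalIntegrable (fun r => hierarchyOp K b r (duhamelIter K b a (k + 1) m f r) qs)
        volume a t ∧
      duhamelIter K b a k (m + 1) f t qs =
        ∫ r in a..t, hierarchyOp K b r (duhamelIter K b a (k + 1) m f r) qs := by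
  have hkm : k + (m + 1) = k + 1 + m := by ring
  have hc : ∀ l, Continuous (Function.uncurry fun r s : ℝ =>
      hierarchyOp K b r (fun qs' => forestKernel K b s qs' m r l) qs) := fun l =>
    Continuous.comp (g := fun p : ℝ × ℝ =>
        hierarchyOp K b p.2 (fun qs' => forestKernel K b p.1 qs' m p.2 l) qs)
      (f := fun p : ℝ × ℝ => (p.2, p.1))
      (continuous_hierarchyOp_forestKernel K hb qs m l) (continuous_snd.prodMk continuous_fst)
  have htri := fun l => intervalIntegral_triangle (hc l) hat (hf l)
  have he : EqOn (fun r => ∑ l ∈ listsOf K (k + 1 + m), ∫ s in a..r,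
        hierarchyOp K b r (fun qs' => forestKernel K b s qs' m r l) qs * f s l)
      (fun r => hierarchyOp K b r (duhamelIter K b a (k + 1) m f r) qs) (uIcc a t) := fun r hr =>
    (hierarchyOp_duhamelIter K hb (k + 1) m
      (fun l => (hf l).mono_set (uIcc_subset_uIcc left_mem_uIcc hr)) qs).symm
  constructor
  · exact (intervalIntegrable_finsetSum fun l _ => (htri l).1).congr (he.mono uIoc_subset_uIcc)
  · rw [← intervalIntegral.integral_congr he, duhamelIter, hkm,
      intervalIntegral.integral_finsetSum fun l _ =>
        intervalIntegrable_forestKernel_mul K hb hf qs _ t l,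
      intervalIntegral.integral_finsetSum fun l _ => (htri l).1]
    refine Finset.sum_congr rfl fun l _ => ?_
    rw [← (htri l).2]
    exact intervalIntegral.integral_congr fun s _ => by
      simp only [forestKernel_succ_eq_integral K hb]

/-- The remainder left in the Duhamel formula for `∫ h` when the sums in the collision operator
are restricted to the finite set `K`. -/
def duhamelError (b : ℝ → ι → ι → ι → ℂ) (ε : ℂ) (a : ℝ) (h : ℝ → List ι → ℂ) (t : ℝ)
    (qs : List ι) : ℂ :=
  h t qs - ε * hierarchyOp K b t (fun l => ∫ s in a..t, h s l) qs

/-- The Duhamel expansion with `m` collisions. If the integral of `h` solved the truncated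
hierarchy, `duhamelError` would vanish and only the last term would remain. -/
theorem integral_eq_sum_duhamelIter (hb : ∀ q x y, Continuous fun t => b t q x y) (ε : ℂ)
    {a c : ℝ} {h : ℝ → List ι → ℂ} (hh : ∀ l, IntervalIntegrable (fun s => h s l) volume a c)
    (he : ∀ l, IntervalIntegrable (fun s => duhamelError K b ε a h s l) volume a c) (m : ℕ) :
    ∀ (k : ℕ) (qs : List ι), qs ∈ listsOf K k → ∀ t ∈ Icc a c,
      ∫ s in a..t, h s qs =
        (∑ i ∈ Finset.range m, ε ^ i * duhamelIter K b a k i (duhamelError K b ε a h) t qs) +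
          ε ^ m * duhamelIter K b a k m h t qs := by
  induction m with
  | zero =>
    intro k qs hqs t _
    rw [Finset.range_zero, Finset.sum_empty, duhamelIter_zero K a h t hqs]
    ring
  | succ m ih =>
    intro k qs hqs t ht
    have hsub : ∀ r ∈ uIcc a t, r ∈ Icc a c := fun r hr => by
      rw [uIcc_of_le ht.1] at hr
      exact ⟨hr.1, hr.2.trans ht.2⟩
    have hh' := fun l => (hh l).mono_set (uIcc_subset_uIcc left_mem_uIcc
      (by rw [uIcc_of_le (ht.1.trans ht.2)]; exact ht) : uIcc a t ⊆ uIcc a c)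
    have he' := fun l => (he l).mono_set (uIcc_subset_uIcc left_mem_uIcc
      (by rw [uIcc_of_le (ht.1.trans ht.2)]; exact ht) : uIcc a t ⊆ uIcc a c)
    set e := duhamelError K b ε a h with hedef
    have h1 : EqOn (fun r => h r qs) (fun r => e r qs +
        ((∑ i ∈ Finset.range m,
            ε ^ (i + 1) * hierarchyOp K b r (duhamelIter K b a (k + 1) i e r) qs) +
          ε ^ (m + 1) * hierarchyOp K b r (duhamelIter K b a (k + 1) m h r) qs)) (uIcc a t) := by
      intro r hr
      have h2 : hierarchyOp K b r (fun l => ∫ s in a..r, h s l) qs =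
          (∑ i ∈ Finset.range m, ε ^ i * hierarchyOp K b r (duhamelIter K b a (k + 1) i e r) qs) +
          ε ^ m * hierarchyOp K b r (duhamelIter K b a (k + 1) m h r) qs := by
        rw [hierarchyOp_congr K b r hqs fun l hl => ih (k + 1) l hl r (hsub r hr), hierarchyOp_add,
          hierarchyOp_sum]
        simp only [hierarchyOp_const_mul]
      have h3 : h r qs = e r qs + ε * hierarchyOp K b r (fun l => ∫ s in a..r, h s l) qs := by
        rw [hedef, duhamelError]
        ring
      simp only
      rw [h3, h2, mul_add, Finset.mul_sum]
      simp only [pow_succ' ε, mul_assoc]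
    have hi := fun i => (duhamelIter_succ K hb ht.1 k i he' qs).1
    have him := (duhamelIter_succ K hb ht.1 k m hh' qs).1
    have hsum : IntervalIntegrable (fun r => ∑ i ∈ Finset.range m,
        ε ^ (i + 1) * hierarchyOp K b r (duhamelIter K b a (k + 1) i e r) qs) volume a t :=
      intervalIntegrable_finsetSum fun i _ => (hi i).const_mul _
    rw [intervalIntegral.integral_congr h1, intervalIntegral.integral_add (he' qs)
      (hsum.add (him.const_mul _)), intervalIntegral.integral_add hsum (him.const_mul _),
      intervalIntegral.integral_finsetSum fun i _ => (hi i).const_mul _,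
      intervalIntegral.integral_const_mul, ← (duhamelIter_succ K hb ht.1 k m hh' qs).2,
      Finset.sum_range_succ', duhamelIter_zero K a e t hqs]
    simp only [intervalIntegral.integral_const_mul]
    rw [Finset.sum_congr rfl fun i _ => by rw [← (duhamelIter_succ K hb ht.1 k i he' qs).2]]
    ring

/-- The forest bound under the time integral of the iterated Duhamel integral. -/
theorem norm_duhamelIter_le (hb : ∀ q x y, Continuous fun t => b t q x y) {a δ θ : ℝ}
    (hδ : 0 < δ) (hθ : 0 < θ) (H : ∀ s m, TreeKernelBound K b s δ θ m) {f : ℝ → List ι → ℂ}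
    (hf : ∀ l, IntervalIntegrable (fun s => f s l) volume a (a + δ))
    (hf2 : ∀ l, IntervalIntegrable (fun s => ‖f s l‖ ^ 2) volume a (a + δ)) (k m : ℕ)
    {qs : List ι} (hqs : qs ∈ listsOf K k) {t : ℝ} (ht : t ∈ Icc a (a + δ)) :
    ‖duhamelIter K b a k m f t qs‖ ≤ (m + 1) ^ k * (4 * θ) ^ m *
      √(δ * ∫ s in a..(a + δ), ∑ l ∈ listsOf K (k + m), ‖f s l‖ ^ 2) := by
  set D : ℝ := (m + 1) ^ k * (4 * θ) ^ m with hD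
  have hD0 : 0 ≤ D := by positivity
  have hmem : t ∈ uIcc a (a + δ) := by
    rw [uIcc_of_le (ht.1.trans ht.2)]; exact ht
  have hsub : uIcc a t ⊆ uIcc a (a + δ) := uIcc_subset_uIcc left_mem_uIcc hmem
  set u : ℝ → ℂ := fun s => ∑ l ∈ listsOf K (k + m), forestKernel K b s qs m t l * f s l with hu
  set N : ℝ → ℝ := fun s => ∑ l ∈ listsOf K (k + m), ‖f s l‖ ^ 2 with hN
  have hNi : IntervalIntegrable N volume a (a + δ) := by
    simpa only [hN, Finset.sum_fn] using IntervalIntegrable.sum _ fun l _ => hf2 l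
  have hui : IntervalIntegrable u volume a t := intervalIntegrable_finsetSum fun l _ =>
    intervalIntegrable_forestKernel_mul K hb (fun l => (hf l).mono_set hsub) qs m t l
  have hle : ∀ s ∈ Icc a t, ‖u s‖ ^ 2 ≤ D ^ 2 * N s := by
    intro s hs
    have h1 := forestKernel_bound K hθ (H s) (t := t) ⟨hs.2, by linarith [hs.1, ht.2]⟩ k m (f s)
    exact (Finset.single_le_sum (f := fun qs => ‖∑ l ∈ listsOf K (k + m),
      forestKernel K b s qs m t l * f s l‖ ^ 2) (fun _ _ => sq_nonneg _) hqs).trans h1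
  have hu2 : IntervalIntegrable (fun s => ‖u s‖ ^ 2) volume a t := by
    rw [intervalIntegrable_iff_integrableOn_Ioc_of_le ht.1] at hui ⊢
    have hg := ((hNi.mono_set hsub).const_mul (D ^ 2)).1
    refine Integrable.mono' hg (hui.aestronglyMeasurable.norm.pow 2) ?_
    refine (ae_restrict_iff' measurableSet_Ioc).2 (Eventually.of_forall fun s hs => ?_)
    rw [Real.norm_of_nonneg (sq_nonneg _)]
    exact hle s (Ioc_subset_Icc_self hs)
  -- an interval of length zero is not covered by the Cauchy-Schwarz inequality below
  rcases ht.1.eq_or_lt with rfl | hlt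
  · rw [duhamelIter, intervalIntegral.integral_same, norm_zero]
    positivity
  have h1 : ‖duhamelIter K b a k m f t qs‖ ^ 2 ≤ D ^ 2 * (δ * ∫ s in a..(a + δ), N s) := by
    have h2 := sq_norm_intervalIntegral_le (u := u) (δ := t - a) hlt.le (by linarith)
      (by linarith) (by rwa [add_sub_cancel]) (by rwa [add_sub_cancel])
    rw [add_sub_cancel] at h2
    refine h2.trans ?_
    have h3 : ∫ s in a..t, ‖u s‖ ^ 2 ≤ D ^ 2 * ∫ s in a..t, N s := by
      rw [← intervalIntegral.integral_const_mul]
      exact intervalIntegral.integral_mono_on hlt.le hu2 ((hNi.mono_set hsub).const_mul _) hle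
    have hN0 : ∀ s, 0 ≤ N s := fun s => by positivity
    have h4 : ∫ s in a..t, N s ≤ ∫ s in a..(a + δ), N s :=
      intervalIntegral.integral_mono_interval le_rfl hlt.le ht.2
        (Eventually.of_forall hN0) hNi
    have h5 : 0 ≤ ∫ s in a..t, N s := intervalIntegral.integral_nonneg hlt.le fun s _ => hN0 s
    have h6 : t - a ≤ δ := by linarith [ht.2]
    calc (t - a) * ∫ s in a..t, ‖u s‖ ^ 2 ≤ δ * (D ^ 2 * ∫ s in a..(a + δ), N s) := by
          refine mul_le_mul h6 (h3.trans (by gcongr)) ?_ hδ.le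
          exact intervalIntegral.integral_nonneg hlt.le fun s _ => sq_nonneg _
      _ = _ := by ring
  have h2 := Real.sqrt_le_sqrt h1
  rwa [Real.sqrt_sq (norm_nonneg _), Real.sqrt_mul (sq_nonneg _), Real.sqrt_sq hD0] at h2

/-- The bound for `∫ h` that results from the Duhamel expansion with `m` collisions. -/
theorem norm_integral_le_of_treeKernelBound (hb : ∀ q x y, Continuous fun t => b t q x y) (ε : ℂ)
    {a δ θ : ℝ} (hδ : 0 < δ) (hθ : 0 < θ) (H : ∀ s m, TreeKernelBound K b s δ θ m)
    {h : ℝ → List ι → ℂ} (hh : ∀ l, IntervalIntegrable (fun s => h s l) volume a (a + δ))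
    (hh2 : ∀ l, IntervalIntegrable (fun s => ‖h s l‖ ^ 2) volume a (a + δ))
    (he : ∀ l, IntervalIntegrable (fun s => duhamelError K b ε a h s l) volume a (a + δ))
    (he2 : ∀ l, IntervalIntegrable (fun s => ‖duhamelError K b ε a h s l‖ ^ 2) volume a (a + δ))
    (m k : ℕ) {qs : List ι} (hqs : qs ∈ listsOf K k) {t : ℝ} (ht : t ∈ Icc a (a + δ)) :
    ‖∫ s in a..t, h s qs‖ ≤
      (∑ i ∈ Finset.range m, ‖ε‖ ^ i * ((i + 1) ^ k * (4 * θ) ^ i *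
        √(δ * ∫ s in a..(a + δ), ∑ l ∈ listsOf K (k + i), ‖duhamelError K b ε a h s l‖ ^ 2))) +
      ‖ε‖ ^ m * ((m + 1) ^ k * (4 * θ) ^ m *
        √(δ * ∫ s in a..(a + δ), ∑ l ∈ listsOf K (k + m), ‖h s l‖ ^ 2)) := by
  rw [integral_eq_sum_duhamelIter K hb ε hh he m k qs hqs t ht]
  refine (norm_add_le _ _).trans (add_le_add ((norm_sum_le _ _).trans
    (Finset.sum_le_sum fun i _ => ?_)) ?_)
  · rw [norm_mul, norm_pow]
    gcongr
    exact norm_duhamelIter_le K hb hδ hθ H he he2 k i hqs ht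
  · rw [norm_mul, norm_pow]
    gcongr
    exact norm_duhamelIter_le K hb hδ hθ H hh hh2 k m hqs ht

end Duhamel

end GPHierarchy

namespace GPHierarchy

/-! ### Oscillating sums -/

theorem integral_exp_int_mul {ω : ℝ} (hω : 0 < ω) (s : ℝ) (n : ℤ) :
    ∫ t in s..(s + 2 * Real.pi / ω), Complex.exp (Complex.I * t * (ω * n : ℝ)) =
      if n = 0 then ((2 * Real.pi / ω : ℝ) : ℂ) else 0 := by
  split_ifs with h
  · subst h
    simp
  · have hn : (n : ℂ) ≠ 0 := by exact_mod_cast h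
    have hω' : (ω : ℂ) ≠ 0 := by exact_mod_cast hω.ne'
    have hc : Complex.I * ((ω * n : ℝ) : ℂ) ≠ 0 := by
      push_cast
      exact mul_ne_zero Complex.I_ne_zero (mul_ne_zero hω' hn)
    have e : ∀ t : ℝ, Complex.exp (Complex.I * t * (ω * n : ℝ)) =
        Complex.exp (Complex.I * ((ω * n : ℝ) : ℂ) * t) := fun t => by ring_nf
    simp only [e]
    rw [integral_exp_mul_complex hc]
    have e2 : Complex.I * ((ω * n : ℝ) : ℂ) * ((s + 2 * Real.pi / ω : ℝ) : ℂ) =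
        Complex.I * ((ω * n : ℝ) : ℂ) * s + n * (2 * Real.pi * Complex.I) := by
      push_cast
      field_simp
    rw [e2, Complex.exp_add, Complex.exp_int_mul_two_pi_mul_I, mul_one, sub_self, zero_div]

/-- The `L²` norm of a trigonometric polynomial, on an interval not longer than a period. -/
theorem integral_sq_norm_trigPoly_le {ω : ℝ} (hω : 0 < ω) (S : Finset ℤ) (A : ℤ → ℂ) (s : ℝ)
    {δ : ℝ} (hδ : 0 ≤ δ) (hδω : δ ≤ 2 * Real.pi / ω) :
    ∫ t in s..(s + δ), ‖∑ n ∈ S, A n * Complex.exp (Complex.I * t * (ω * n : ℝ))‖ ^ 2 ≤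
      2 * Real.pi / ω * ∑ n ∈ S, ‖A n‖ ^ 2 := by
  have hc : Continuous fun t : ℝ =>
      ‖∑ n ∈ S, A n * Complex.exp (Complex.I * t * (ω * n : ℝ))‖ ^ 2 := by fun_prop
  calc _ ≤ ∫ t in s..(s + 2 * Real.pi / ω),
        ‖∑ n ∈ S, A n * Complex.exp (Complex.I * t * (ω * n : ℝ))‖ ^ 2 :=
        intervalIntegral.integral_mono_interval le_rfl (by linarith) (by linarith)
          (Eventually.of_forall fun _ => sq_nonneg _) (hc.intervalIntegrable _ _)
    _ = _ := ?_
  rw [← Complex.ofReal_inj, ← intervalIntegral.integral_ofReal]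
  have e : ∀ t : ℝ, ((‖∑ n ∈ S, A n * Complex.exp (Complex.I * t * (ω * n : ℝ))‖ ^ 2 : ℝ) : ℂ) =
      ∑ n ∈ S, ∑ m ∈ S, A n * conj (A m) *
        Complex.exp (Complex.I * t * (ω * (n - m : ℤ) : ℝ)) := by
    intro t
    push_cast
    rw [← Complex.mul_conj', map_sum, Finset.sum_mul_sum]
    refine Finset.sum_congr rfl fun n _ => Finset.sum_congr rfl fun m _ => ?_
    rw [map_mul, ← Complex.exp_conj, mul_mul_mul_comm, ← Complex.exp_add]
    congr 2
    simp only [map_mul, Complex.conj_I, Complex.conj_ofReal, map_intCast]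
    ring
  simp only [e]
  rw [integral_sum_of_continuous fun n _ => by fun_prop]
  rw [Complex.ofReal_mul, Complex.ofReal_sum, Finset.mul_sum]
  refine Finset.sum_congr rfl fun n hn => ?_
  rw [integral_sum_of_continuous fun m _ => by fun_prop, Finset.sum_eq_single_of_mem n hn]
  · rw [intervalIntegral.integral_const_mul, integral_exp_int_mul hω, if_pos (sub_self n),
      Complex.mul_conj']
    push_cast
    ring
  · intro m _ hm
    rw [intervalIntegral.integral_const_mul, integral_exp_int_mul hω,
      if_neg (sub_ne_zero.2 hm.symm), mul_zero]

/-- If the coefficients `c` are square summable on every level set of the frequency, uniformly,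
then the oscillating sum maps `ℓ²` to `L²` in time: by orthogonality different levels decouple,
and the Cauchy-Schwarz inequality applies on each level. -/
theorem integral_sq_norm_oscillating_le {κ : Type*} {ω B : ℝ} (hω : 0 < ω) (Z : Finset κ)
    (c : κ → ℂ) (n : κ → ℤ)
    (hB : ∀ σ, ∑ z ∈ Z with n z = σ, ‖c z‖ ^ 2 ≤ B) (F : κ → ℂ) (s : ℝ)
    {δ : ℝ} (hδ : 0 ≤ δ) (hδω : δ ≤ 2 * Real.pi / ω) :
    ∫ t in s..(s + δ), ‖∑ z ∈ Z, Complex.exp (Complex.I * t * (ω * n z : ℝ)) * c z * F z‖ ^ 2 ≤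
      2 * Real.pi / ω * B * ∑ z ∈ Z, ‖F z‖ ^ 2 := by
  classical
  have e : ∀ t : ℝ, ∑ z ∈ Z, Complex.exp (Complex.I * t * (ω * n z : ℝ)) * c z * F z =
      ∑ σ ∈ Z.image n, (∑ z ∈ Z with n z = σ, c z * F z) *
        Complex.exp (Complex.I * t * (ω * σ : ℝ)) := by
    intro t
    rw [← Finset.sum_fiberwise_of_maps_to (t := Z.image n) (g := n)
      fun z hz => Finset.mem_image_of_mem n hz]
    refine Finset.sum_congr rfl fun σ _ => ?_
    rw [Finset.sum_mul]
    refine Finset.sum_congr rfl fun z hz => ?_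
    rw [(Finset.mem_filter.1 hz).2]
    ring
  simp only [e]
  refine (integral_sq_norm_trigPoly_le hω _ _ s hδ hδω).trans ?_
  rw [mul_assoc]
  refine mul_le_mul_of_nonneg_left ?_ (by positivity)
  rw [← Finset.sum_fiberwise_of_maps_to (t := Z.image n) (g := n)
      fun z hz => Finset.mem_image_of_mem n hz, Finset.mul_sum]
  refine Finset.sum_le_sum fun σ _ => ?_
  calc ‖∑ z ∈ Z with n z = σ, c z * F z‖ ^ 2
      ≤ (∑ z ∈ Z with n z = σ, ‖c z‖ * ‖F z‖) ^ 2 := by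
        gcongr
        exact (norm_sum_le _ _).trans (le_of_eq (by simp only [norm_mul]))
    _ ≤ (∑ z ∈ Z with n z = σ, ‖c z‖ ^ 2) * ∑ z ∈ Z with n z = σ, ‖F z‖ ^ 2 :=
        Finset.sum_mul_sq_le_sq_mul_sq _ _ _
    _ ≤ _ := by
        gcongr
        exact hB σ

end GPHierarchy

namespace GPHierarchy

/-! ### The space-time estimate for the collision operator -/

theorem laplaceEigenvalue_nonneg (L : ℝ) (n : Fin 2 → ℤ) : 0 ≤ laplaceEigenvalue L n := by
  unfold laplaceEigenvalue; positivity

/-- The bracket is equivalent to the Sobolev weight `(1 + |π n / L| ^ 2) ^ (1 / 2)`. -/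
theorem exists_bracket_sq_le {L : ℝ} (hL : 0 < L) : ∃ Q : ℝ, 0 < Q ∧ ∀ n : Fin 2 → ℤ,
    (bracket n : ℝ) ^ 2 ≤ Q * (1 + laplaceEigenvalue L n) ∧
      1 + laplaceEigenvalue L n ≤ Q * (bracket n : ℝ) ^ 2 := by
  have hπ := Real.pi_pos
  set a : ℝ := (Real.pi / L) ^ 2 with ha
  have ha0 : 0 < a := by positivity
  refine ⟨1 + 2 * a + 2 + 2 * a⁻¹, by positivity, fun n => ?_⟩
  have hlam : laplaceEigenvalue L n = a * ((n 0 : ℝ) ^ 2 + (n 1 : ℝ) ^ 2) := by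
    simp only [laplaceEigenvalue, Fin.sum_univ_two, ha]
    ring
  set N : ℝ := (supNorm n : ℝ) with hN
  have hbr : (bracket n : ℝ) = 1 + N := by rw [bracket]; push_cast; rfl
  have hN0 : 0 ≤ N := by positivity
  have hle : ∀ c, (n c : ℝ) ^ 2 ≤ N ^ 2 := fun c => by
    rw [← sq_abs]
    have h1 : |n c| ≤ (supNorm n : ℤ) := by
      fin_cases c <;> simp [supNorm]
    have h2 : |(n c : ℝ)| ≤ N := by
      rw [hN]; exact_mod_cast h1
    gcongr
  have hge : N ^ 2 ≤ (n 0 : ℝ) ^ 2 + (n 1 : ℝ) ^ 2 := by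
    have h1 : (supNorm n : ℤ) = |n 0| ∨ (supNorm n : ℤ) = |n 1| := by
      rcases le_total (n 0).natAbs (n 1).natAbs with h | h
      · right
        rw [supNorm, max_eq_right h, Int.natCast_natAbs]
      · left
        rw [supNorm, max_eq_left h, Int.natCast_natAbs]
    have h2 : N = |(n 0 : ℝ)| ∨ N = |(n 1 : ℝ)| := by
      rw [hN]
      rcases h1 with h | h
      · left; exact_mod_cast h
      · right; exact_mod_cast h
    rcases h2 with h | h <;> rw [h, sq_abs] <;>
      nlinarith [sq_nonneg (n 0 : ℝ), sq_nonneg (n 1 : ℝ)]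
  set X := (n 0 : ℝ) ^ 2 + (n 1 : ℝ) ^ 2 with hX
  have hX2 : X ≤ 2 * N ^ 2 := by linarith [hle 0, hle 1]
  have hai : a⁻¹ * (a * X) = X := by field_simp
  have hX0 : 0 ≤ X := by positivity
  rw [hlam, hbr]
  constructor
  · have h1 : (1 + N) ^ 2 ≤ 2 + 2 * X := by nlinarith [sq_nonneg (1 - N)]
    have h2 : 0 ≤ a⁻¹ := by positivity
    have h3 : 0 ≤ a * X := by positivity
    nlinarith [mul_nonneg ha0.le h3]
  · have h2 : 0 ≤ a⁻¹ := by positivity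
    have h3 : a * X ≤ a * (2 * N ^ 2) := by gcongr
    have h4 : 0 ≤ a * N := by positivity
    nlinarith [mul_nonneg h2 (sq_nonneg (1 + N))]

noncomputable section Kernel

/-- The index of one particle in the Fourier expansion of a kernel: its momenta in `x` and `x'`. -/
abbrev Mode : Type := (Fin 2 → ℤ) × (Fin 2 → ℤ)

/-- The frequency of a mode under the free evolution. -/
def modeFreq (L : ℝ) (q : Mode) : ℝ := laplaceEigenvalue L q.1 - laplaceEigenvalue L q.2

/-- The Sobolev weight of a mode. -/
def modeWeight (L α : ℝ) (q : Mode) : ℝ :=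
  (1 + laplaceEigenvalue L q.1) ^ (α / 2) * (1 + laplaceEigenvalue L q.2) ^ (α / 2)

theorem modeWeight_pos (L α : ℝ) (q : Mode) : 0 < modeWeight L α q := by
  have h1 := laplaceEigenvalue_nonneg L q.1
  have h2 := laplaceEigenvalue_nonneg L q.2
  unfold modeWeight
  positivity

/-- The pairs of modes which the first term of the commutator in the collision operator brings to
the mode `q`, parametrized by `z = (r, l)`: the momentum `r` of the particle which is traced out,
and the momentum `l` which is exchanged. -/
def leftPair (q : Mode) (z : Mode) : Mode × Mode := ((q.1 + z.2, q.2), (z.1 - z.2, z.1))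

/-- The pairs of modes which the second term of the commutator brings to the mode `q`. -/
def rightPair (q : Mode) (z : Mode) : Mode × Mode := ((q.1, q.2 + z.2), (z.1, z.1 - z.2))

theorem leftPair_injective : Function.Injective fun p : Mode × Mode => leftPair p.1 p.2 := by
  rintro ⟨⟨q1, q2⟩, ⟨r, l⟩⟩ ⟨⟨q1', q2'⟩, ⟨r', l'⟩⟩ h
  simp only [leftPair, Prod.mk.injEq] at h ⊢
  obtain ⟨⟨h1, h2⟩, h3, h4⟩ := h
  subst h4
  have h5 : l = l' := by simpa using h3
  subst h5
  exact ⟨⟨by simpa using h1, h2⟩, rfl, rfl⟩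

theorem rightPair_injective : Function.Injective fun p : Mode × Mode => rightPair p.1 p.2 := by
  rintro ⟨⟨q1, q2⟩, ⟨r, l⟩⟩ ⟨⟨q1', q2'⟩, ⟨r', l'⟩⟩ h
  simp only [rightPair, Prod.mk.injEq] at h ⊢
  obtain ⟨⟨h1, h2⟩, h3, h4⟩ := h
  subst h3
  have h5 : l = l' := by simpa using h4
  subst h5
  exact ⟨⟨h1, by simpa using h2⟩, rfl, rfl⟩

/-- The coefficient of a pair `(x, y)` of modes in the collision operator, in the interaction
picture and relative to the Sobolev weights. -/
def collisionAmp (L α t : ℝ) (q x y : Mode) : ℂ :=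
  Complex.exp (Complex.I * t * (modeFreq L q - modeFreq L x - modeFreq L y : ℝ)) *
    ((((2 * L) ^ 2)⁻¹ * (modeWeight L α q / (modeWeight L α x * modeWeight L α y)) : ℝ) : ℂ)

theorem continuous_collisionAmp (L α : ℝ) (q x y : Mode) :
    Continuous fun t => collisionAmp L α t q x y := by
  unfold collisionAmp; fun_prop

variable {L α : ℝ}

theorem rpow_quotient_le {A0 A1 A2 A3 B0 B1 B2 B3 Q β : ℝ} (hQ : 0 < Q) (hβ : 0 ≤ β)
    (hA0 : 0 < A0) (hA1 : 0 < A1) (hA2 : 0 < A2) (hA3 : 0 < A3)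
    (hB0 : 0 < B0) (hB1 : 0 < B1) (hB2 : 0 < B2) (hB3 : 0 < B3)
    (h0 : A0 ≤ Q * B0 ^ 2) (h1 : B1 ^ 2 ≤ Q * A1) (h2 : B2 ^ 2 ≤ Q * A2) (h3 : B3 ^ 2 ≤ Q * A3) :
    A0 ^ β / (A1 ^ β * A2 ^ β * A3 ^ β) ≤ (Q ^ β) ^ 4 *
      (B0 ^ (2 * β) * B1 ^ (-(2 * β)) * B2 ^ (-(2 * β)) * B3 ^ (-(2 * β))) := by
  have hsq : ∀ {B : ℝ}, 0 < B → B ^ (2 * β) = (B ^ 2) ^ β := fun {B} hB => by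
    rw [Real.rpow_mul hB.le]; norm_cast
  have hlow : ∀ {A B : ℝ}, 0 < A → 0 < B → B ^ 2 ≤ Q * A →
      (A ^ β)⁻¹ ≤ Q ^ β * B ^ (-(2 * β)) := by
    intro A B hA hB h
    rw [Real.rpow_neg hB.le, hsq hB, ← div_eq_mul_inv, inv_le_comm₀ (by positivity)
      (by positivity), inv_div, div_le_iff₀ (by positivity), mul_comm,
      ← Real.mul_rpow hQ.le hA.le]
    exact Real.rpow_le_rpow (by positivity) h hβ
  have hup : A0 ^ β ≤ Q ^ β * B0 ^ (2 * β) := by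
    rw [hsq hB0, ← Real.mul_rpow hQ.le (by positivity)]
    exact Real.rpow_le_rpow hA0.le h0 hβ
  calc A0 ^ β / (A1 ^ β * A2 ^ β * A3 ^ β)
      = A0 ^ β * (A1 ^ β)⁻¹ * (A2 ^ β)⁻¹ * (A3 ^ β)⁻¹ := by
        rw [div_eq_mul_inv, mul_inv, mul_inv]; ring
    _ ≤ (Q ^ β * B0 ^ (2 * β)) * (Q ^ β * B1 ^ (-(2 * β))) * (Q ^ β * B2 ^ (-(2 * β))) *
        (Q ^ β * B3 ^ (-(2 * β))) := by
        gcongr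
        · exact hlow hA1 hB1 h1
        · exact hlow hA2 hB2 h2
        · exact hlow hA3 hB3 h3
    _ = _ := by ring

/-- The squared Sobolev weights in a collision are bounded by the summand of the resonance sum with
exponent `2 α`. -/
theorem exists_sq_weight_quotient_le (hL : 0 < L) (hα : 0 ≤ α) : ∃ Q : ℝ, 0 < Q ∧
    ∀ p x y z : Fin 2 → ℤ,
      ((1 + laplaceEigenvalue L p) ^ (α / 2) / ((1 + laplaceEigenvalue L x) ^ (α / 2) *
        (1 + laplaceEigenvalue L y) ^ (α / 2) * (1 + laplaceEigenvalue L z) ^ (α / 2))) ^ 2 ≤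
      Q * resonanceTerm (2 * α) p x y z := by
  obtain ⟨Q, hQ, h⟩ := exists_bracket_sq_le hL
  refine ⟨(Q ^ α) ^ 4, by positivity, fun p x y z => ?_⟩
  have hpos : ∀ n, 0 < 1 + laplaceEigenvalue L n := fun n => by
    linarith [laplaceEigenvalue_nonneg L n]
  have hsq : ∀ n, ((1 + laplaceEigenvalue L n) ^ (α / 2)) ^ 2 =
      (1 + laplaceEigenvalue L n) ^ α := fun n => by
    rw [← Real.rpow_natCast, ← Real.rpow_mul (hpos n).le]
    congr 1
    push_cast
    ring
  rw [div_pow, mul_pow, mul_pow, hsq, hsq, hsq, hsq, resonanceTerm]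
  exact rpow_quotient_le hQ hα (hpos p) (hpos x) (hpos y) (hpos z) (bracket_pos p) (bracket_pos x)
    (bracket_pos y) (bracket_pos z) (h p).2 (h x).1 (h y).1 (h z).1

/-- The weight of the momentum that the collision leaves unchanged cancels. -/
theorem modeWeight_leftPair (q z : Mode) :
    modeWeight L α q / (modeWeight L α (leftPair q z).1 * modeWeight L α (leftPair q z).2) =
      (1 + laplaceEigenvalue L q.1) ^ (α / 2) / ((1 + laplaceEigenvalue L (q.1 + z.2)) ^ (α / 2) *
        (1 + laplaceEigenvalue L (z.1 - z.2)) ^ (α / 2) *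
        (1 + laplaceEigenvalue L z.1) ^ (α / 2)) := by
  have hpos : ∀ n, 0 < (1 + laplaceEigenvalue L n) ^ (α / 2) := fun n =>
    Real.rpow_pos_of_pos (by linarith [laplaceEigenvalue_nonneg L n]) _
  have h1 := (hpos q.2).ne'
  have h2 := (hpos (q.1 + z.2)).ne'
  have h3 := (hpos (z.1 - z.2)).ne'
  have h4 := (hpos z.1).ne'
  simp only [modeWeight, leftPair]
  field_simp

theorem modeWeight_rightPair (q z : Mode) :
    modeWeight L α q / (modeWeight L α (rightPair q z).1 * modeWeight L α (rightPair q z).2) =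
      (1 + laplaceEigenvalue L q.2) ^ (α / 2) / ((1 + laplaceEigenvalue L (q.2 + z.2)) ^ (α / 2) *
        (1 + laplaceEigenvalue L (z.1 - z.2)) ^ (α / 2) *
        (1 + laplaceEigenvalue L z.1) ^ (α / 2)) := by
  have hpos : ∀ n, 0 < (1 + laplaceEigenvalue L n) ^ (α / 2) := fun n =>
    Real.rpow_pos_of_pos (by linarith [laplaceEigenvalue_nonneg L n]) _
  have h1 := (hpos q.1).ne'
  have h2 := (hpos (q.2 + z.2)).ne'
  have h3 := (hpos (z.1 - z.2)).ne'
  have h4 := (hpos z.1).ne'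
  simp only [modeWeight, rightPair]
  field_simp

/-- The resonance function of a collision: `(p - p₁) · (p - p₂)` for the momenta `p₁ = p + l` and
`p₂ = r - l`, where `z = (r, l)`. -/
def resonance (p : Fin 2 → ℤ) (z : Mode) : ℤ :=
  (p - (p + z.2)) 0 * (p - (z.1 - z.2)) 0 + (p - (p + z.2)) 1 * (p - (z.1 - z.2)) 1

theorem modeFreq_leftPair (hL : 0 < L) (q z : Mode) :
    modeFreq L q - modeFreq L (leftPair q z).1 - modeFreq L (leftPair q z).2 =
      2 * (Real.pi / L) ^ 2 * resonance q.1 z := by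
  simp only [modeFreq, leftPair, laplaceEigenvalue, Fin.sum_univ_two, resonance, Pi.add_apply,
    Pi.sub_apply]
  push_cast
  field_simp
  ring

theorem modeFreq_rightPair (hL : 0 < L) (q z : Mode) :
    modeFreq L q - modeFreq L (rightPair q z).1 - modeFreq L (rightPair q z).2 =
      2 * (Real.pi / L) ^ 2 * (-resonance q.2 z : ℤ) := by
  simp only [modeFreq, rightPair, laplaceEigenvalue, Fin.sum_univ_two, resonance, Pi.add_apply,
    Pi.sub_apply]
  push_cast
  field_simp
  ring

theorem exists_sum_resonance_pair_le {s : ℝ} (hs : 1 < s) : ∃ C : ℝ, 0 < C ∧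
    ∀ (p : Fin 2 → ℤ) (σ : ℤ) (Z : Finset Mode), (∀ z ∈ Z, resonance p z = σ) →
      ∑ z ∈ Z, resonanceTerm s p (p + z.2) (z.1 - z.2) z.1 ≤ C := by
  obtain ⟨C, hC, h⟩ := exists_sum_resonance_le hs
  refine ⟨C, hC, fun p σ Z hZ => ?_⟩
  set f : Mode → Mode := fun z => (p + z.2, z.1 - z.2) with hf
  have hinj : Function.Injective f := by
    rintro ⟨r, l⟩ ⟨r', l'⟩ h
    simp only [hf, Prod.mk.injEq, add_right_inj] at h ⊢
    obtain ⟨rfl, h⟩ := h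
    exact ⟨by simpa using h, rfl⟩
  have := h p σ (Z.map ⟨f, hinj⟩) (by
    intro z hz
    obtain ⟨w, hw, rfl⟩ := Finset.mem_map.1 hz
    exact hZ w hw)
  rw [Finset.sum_map] at this
  refine (Finset.sum_le_sum fun z _ => le_of_eq ?_).trans this
  simp only [Function.Embedding.coeFn_mk, hf]
  congr 1
  abel

/-- The space-time estimate for the two terms of the collision operator and one fixed outgoing
mode, over times up to the common period of all the phases: the frequencies are integer multiples
of `2 (π / L) ^ 2`, and the resonance sum bounds the squared coefficients of each frequency. -/
theorem exists_spaceTime_pair (hL : 0 < L) (hα : 1 / 2 < α) : ∃ C : ℝ, 0 < C ∧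
    ∀ (q : Mode) (Z : Finset Mode) (F : Mode → ℂ) (s δ : ℝ), 0 ≤ δ → δ ≤ L ^ 2 / Real.pi →
      (∫ t in s..(s + δ), ‖∑ z ∈ Z,
          collisionAmp L α t q (leftPair q z).1 (leftPair q z).2 * F z‖ ^ 2 ≤
        C * ∑ z ∈ Z, ‖F z‖ ^ 2) ∧
      (∫ t in s..(s + δ), ‖∑ z ∈ Z,
          collisionAmp L α t q (rightPair q z).1 (rightPair q z).2 * F z‖ ^ 2 ≤
        C * ∑ z ∈ Z, ‖F z‖ ^ 2) := by
  obtain ⟨Q, hQ, hQw⟩ := exists_sq_weight_quotient_le (α := α) hL (by linarith)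
  obtain ⟨C, hC, hres⟩ := exists_sum_resonance_pair_le (s := 2 * α) (by linarith)
  have hπ := Real.pi_pos
  set ω : ℝ := 2 * (Real.pi / L) ^ 2 with hω
  have hω0 : 0 < ω := by positivity
  have hT : 2 * Real.pi / ω = L ^ 2 / Real.pi := by
    rw [hω]; field_simp
  set c : ℝ := ((2 * L) ^ 2)⁻¹ with hc
  have hc0 : 0 < c := by positivity
  have key : ∀ (p : Fin 2 → ℤ) (Z : Finset Mode) (σ : ℤ),
      ∑ z ∈ Z with resonance p z = σ, ‖((c * ((1 + laplaceEigenvalue L p) ^ (α / 2) /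
        ((1 + laplaceEigenvalue L (p + z.2)) ^ (α / 2) *
        (1 + laplaceEigenvalue L (z.1 - z.2)) ^ (α / 2) *
        (1 + laplaceEigenvalue L z.1) ^ (α / 2))) : ℝ) : ℂ)‖ ^ 2 ≤ c ^ 2 * Q * C := by
    intro p Z σ
    have h1 := hres p σ (Z.filter fun z => resonance p z = σ) fun z hz =>
      (Finset.mem_filter.1 hz).2
    refine le_trans ?_ (mul_le_mul_of_nonneg_left h1 (by positivity))
    rw [Finset.mul_sum]
    refine Finset.sum_le_sum fun z _ => ?_
    rw [Complex.norm_real, Real.norm_eq_abs, sq_abs, mul_pow, mul_assoc (c ^ 2) Q]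
    exact mul_le_mul_of_nonneg_left (hQw _ _ _ _) (sq_nonneg _)
  refine ⟨2 * Real.pi / ω * (c ^ 2 * Q * C), by positivity, fun q Z F s δ hδ hδT => ⟨?_, ?_⟩⟩
  · simp only [collisionAmp, modeFreq_leftPair hL, modeWeight_leftPair]
    exact integral_sq_norm_oscillating_le hω0 Z _ (fun z => resonance q.1 z) (key q.1 Z) F s hδ
      (by rwa [hT])
  · simp only [collisionAmp, modeFreq_rightPair hL, modeWeight_rightPair]
    refine integral_sq_norm_oscillating_le hω0 Z _ (fun z => -resonance q.2 z) (fun σ => ?_) F s hδ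
      (by rwa [hT])
    simp only [neg_eq_iff_eq_neg]
    exact key q.2 Z (-σ)

open Classical in
/-- The kernel of the collision operator, in the interaction picture and relative to the Sobolev
weights. -/
def collisionKernel (L α t : ℝ) (q x y : Mode) : ℂ :=
  (if (x, y) ∈ range (leftPair q) then collisionAmp L α t q x y else 0) -
    if (x, y) ∈ range (rightPair q) then collisionAmp L α t q x y else 0

theorem continuous_collisionKernel (L α : ℝ) (q x y : Mode) :
    Continuous fun t => collisionKernel L α t q x y := by
  unfold collisionKernel
  have := continuous_collisionAmp L α q x y
  split_ifs <;> fun_prop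

theorem leftPair_injective_right (q : Mode) : Function.Injective (leftPair q) := fun z z' h => by
  have := @leftPair_injective (q, z) (q, z') h
  exact (Prod.mk.inj this).2

theorem rightPair_injective_right (q : Mode) : Function.Injective (rightPair q) := fun z z' h => by
  have := @rightPair_injective (q, z) (q, z') h
  exact (Prod.mk.inj this).2

variable (K : Finset Mode)

/-- The parameters of the pairs in `K × K` which the first term brings to `q`. -/
def leftSet (q : Mode) : Finset Mode :=
  (K ×ˢ K).preimage (leftPair q) (leftPair_injective_right q).injOn

/-- The parameters of the pairs in `K × K` which the second term brings to `q`. -/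
def rightSet (q : Mode) : Finset Mode :=
  (K ×ˢ K).preimage (rightPair q) (rightPair_injective_right q).injOn

theorem sum_collisionKernel (t : ℝ) (q : Mode) (F : Mode → Mode → ℂ) :
    ∑ x ∈ K, ∑ y ∈ K, collisionKernel L α t q x y * F x y =
      (∑ z ∈ leftSet K q, collisionAmp L α t q (leftPair q z).1 (leftPair q z).2 *
        F (leftPair q z).1 (leftPair q z).2) -
      ∑ z ∈ rightSet K q, collisionAmp L α t q (rightPair q z).1 (rightPair q z).2 *
        F (rightPair q z).1 (rightPair q z).2 := by
  classical
  rw [leftSet, rightSet,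
    Finset.sum_preimage' (leftPair q) (K ×ˢ K) (leftPair_injective_right q).injOn
      fun p => collisionAmp L α t q p.1 p.2 * F p.1 p.2,
    Finset.sum_preimage' (rightPair q) (K ×ˢ K) (rightPair_injective_right q).injOn
      fun p => collisionAmp L α t q p.1 p.2 * F p.1 p.2,
    Finset.sum_filter, Finset.sum_filter, Finset.sum_product, Finset.sum_product,
    ← Finset.sum_sub_distrib]
  refine Finset.sum_congr rfl fun x _ => ?_
  rw [← Finset.sum_sub_distrib]
  refine Finset.sum_congr rfl fun y _ => ?_
  simp only [collisionKernel, sub_mul, ite_mul, zero_mul]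

/-- Different outgoing modes and parameters belong to different pairs of modes. -/
theorem sum_pair_le {f : Mode → Mode → Mode × Mode}
    (hf : Function.Injective fun p : Mode × Mode => f p.1 p.2) (Z : Mode → Finset Mode)
    (hZ : ∀ q, ∀ z ∈ Z q, f q z ∈ K ×ˢ K) (g : Mode × Mode → ℝ) (hg : ∀ p, 0 ≤ g p) :
    ∑ q ∈ K, ∑ z ∈ Z q, g (f q z) ≤ ∑ x ∈ K, ∑ y ∈ K, g (x, y) := by
  classical
  rw [Finset.sum_sigma', ← Finset.sum_product' (f := fun x y => g (x, y))]
  have hinj : Function.Injective fun p : (_ : Mode) × Mode => f p.1 p.2 := by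
    rintro ⟨q, z⟩ ⟨q', z'⟩ h
    have := @hf (q, z) (q', z') h
    cases this
    rfl
  rw [← Finset.sum_image (f := g) (g := fun p : (_ : Mode) × Mode => f p.1 p.2)
    hinj.injOn]
  refine Finset.sum_le_sum_of_subset_of_nonneg ?_ fun p _ _ => hg p
  intro p hp
  obtain ⟨⟨q, z⟩, hqz, rfl⟩ := Finset.mem_image.1 hp
  exact hZ q z (Finset.mem_sigma.1 hqz).2

theorem sq_norm_sub_le (z w : ℂ) : ‖z - w‖ ^ 2 ≤ 2 * ‖z‖ ^ 2 + 2 * ‖w‖ ^ 2 := by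
  simpa [sub_eq_add_neg] using sq_norm_add_le z (-w)

/-- The space-time estimate for the collision operator, from the one for its two terms. -/
theorem spaceTimeBound_collisionKernel {C δ : ℝ} (hC : 0 ≤ C) (hδ : 0 ≤ δ)
    (h : ∀ (q : Mode) (Z : Finset Mode) (F : Mode → ℂ) (s : ℝ),
      (∫ t in s..(s + δ), ‖∑ z ∈ Z,
          collisionAmp L α t q (leftPair q z).1 (leftPair q z).2 * F z‖ ^ 2 ≤
        C * ∑ z ∈ Z, ‖F z‖ ^ 2) ∧
      (∫ t in s..(s + δ), ‖∑ z ∈ Z,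
          collisionAmp L α t q (rightPair q z).1 (rightPair q z).2 * F z‖ ^ 2 ≤
        C * ∑ z ∈ Z, ‖F z‖ ^ 2)) :
    SpaceTimeBound K (collisionKernel L α) δ (4 * C) := by
  intro s F
  set u : Mode → ℝ → ℂ := fun q t => ∑ z ∈ leftSet K q,
    collisionAmp L α t q (leftPair q z).1 (leftPair q z).2 *
      F (leftPair q z).1 (leftPair q z).2 with hu
  set v : Mode → ℝ → ℂ := fun q t => ∑ z ∈ rightSet K q,
    collisionAmp L α t q (rightPair q z).1 (rightPair q z).2 *
      F (rightPair q z).1 (rightPair q z).2 with hv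
  have huc : ∀ q, Continuous (u q) := fun q => continuous_finsetSum _ fun z _ =>
    (continuous_collisionAmp L α _ _ _).mul continuous_const
  have hvc : ∀ q, Continuous (v q) := fun q => continuous_finsetSum _ fun z _ =>
    (continuous_collisionAmp L α _ _ _).mul continuous_const
  simp only [sum_collisionKernel]
  change ∫ t in s..(s + δ), ∑ q ∈ K, ‖u q t - v q t‖ ^ 2 ≤ _
  have hN : 0 ≤ ∑ x ∈ K, ∑ y ∈ K, ‖F x y‖ ^ 2 := by positivity
  have h1 : ∀ q, ∫ t in s..(s + δ), ‖u q t - v q t‖ ^ 2 ≤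
      2 * C * (∑ z ∈ leftSet K q, ‖F (leftPair q z).1 (leftPair q z).2‖ ^ 2) +
      2 * C * ∑ z ∈ rightSet K q, ‖F (rightPair q z).1 (rightPair q z).2‖ ^ 2 := by
    intro q
    have h2 := (h q (leftSet K q) (fun z => F (leftPair q z).1 (leftPair q z).2) s).1
    have h3 := (h q (rightSet K q) (fun z => F (rightPair q z).1 (rightPair q z).2) s).2
    have h4 : ∫ t in s..(s + δ), ‖u q t - v q t‖ ^ 2 ≤
        ∫ t in s..(s + δ), (2 * ‖u q t‖ ^ 2 + 2 * ‖v q t‖ ^ 2) := by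
      have := huc q
      have := hvc q
      exact intervalIntegral.integral_mono_on (by linarith)
        (Continuous.intervalIntegrable (by fun_prop) _ _)
        (Continuous.intervalIntegrable (by fun_prop) _ _) fun t _ => sq_norm_sub_le _ _
    have h5 : ∫ t in s..(s + δ), (2 * ‖u q t‖ ^ 2 + 2 * ‖v q t‖ ^ 2) =
        2 * (∫ t in s..(s + δ), ‖u q t‖ ^ 2) + 2 * ∫ t in s..(s + δ), ‖v q t‖ ^ 2 := by
      have := huc q
      have := hvc q
      rw [intervalIntegral.integral_add (Continuous.intervalIntegrable (by fun_prop) _ _)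
        (Continuous.intervalIntegrable (by fun_prop) _ _), intervalIntegral.integral_const_mul,
        intervalIntegral.integral_const_mul]
    linarith
  rw [integral_sum_of_continuous]
  swap
  · exact fun q _ => ((huc q).sub (hvc q)).norm.pow 2
  refine (Finset.sum_le_sum fun q _ => h1 q).trans ?_
  rw [Finset.sum_add_distrib, ← Finset.mul_sum, ← Finset.mul_sum]
  have h2 := sum_pair_le K leftPair_injective (leftSet K)
    (fun q z hz => Finset.mem_preimage.1 hz) (fun p => ‖F p.1 p.2‖ ^ 2) fun _ => sq_nonneg _
  have h3 := sum_pair_le K rightPair_injective (rightSet K)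
    (fun q z hz => Finset.mem_preimage.1 hz) (fun p => ‖F p.1 p.2‖ ^ 2) fun _ => sq_nonneg _
  have h4 := mul_le_mul_of_nonneg_left h2 hC
  have h5 := mul_le_mul_of_nonneg_left h3 hC
  simp only at h4 h5
  linarith

end Kernel

end GPHierarchy

namespace GPHierarchy

/-! ### Plane waves -/

noncomputable section Characters

/-- A family of continuous functions which contains `1`, is closed under products and conjugation
and separates the points spans a dense subspace. -/
theorem span_range_topologicalClosure_eq_top {X κ : Type*} [TopologicalSpace X] [CompactSpace X]
    (χ : κ → C(X, ℂ)) (h1 : ∃ i, χ i = 1) (hmul : ∀ i j, ∃ m, χ m = χ i * χ j)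
    (hstar : ∀ i, ∃ m, χ m = star (χ i)) (hsep : ∀ x y : X, x ≠ y → ∃ i, χ i x ≠ χ i y) :
    (Submodule.span ℂ (range χ)).topologicalClosure = ⊤ := by
  let S : StarSubalgebra ℂ C(X, ℂ) :=
    { toSubalgebra := Algebra.adjoin ℂ (range χ)
      star_mem' := by
        change Algebra.adjoin ℂ (range χ) ≤ star (Algebra.adjoin ℂ (range χ))
        refine Algebra.adjoin_le ?_
        rintro _ ⟨i, rfl⟩
        obtain ⟨m, hm⟩ := hstar i
        exact Algebra.subset_adjoin ⟨m, hm⟩ }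
  have hS : S.toSubalgebra.toSubmodule = Submodule.span ℂ (range χ) := by
    refine Algebra.adjoin_eq_span_of_subset ℂ fun x hx => Submodule.subset_span ?_
    induction hx using Submonoid.closure_induction with
    | mem x hx => exact hx
    | one => exact h1
    | mul x y _ _ hx hy =>
      obtain ⟨⟨i, rfl⟩, j, rfl⟩ := And.intro hx hy
      exact hmul i j
  have hsepS : S.SeparatesPoints := by
    intro x y hxy
    obtain ⟨i, hi⟩ := hsep x y hxy
    exact ⟨_, ⟨χ i, Algebra.subset_adjoin ⟨i, rfl⟩, rfl⟩, hi⟩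
  rw [← hS]
  exact congr_arg (Subalgebra.toSubmodule <| StarSubalgebra.toSubalgebra ·)
    (ContinuousMap.starSubalgebra_topologicalClosure_eq_top_of_separatesPoints S hsepS)

/-- The character `exp(i π m · x / L)` of `Λ`. -/
def boxChar (L : ℝ) (m : Fin 2 → ℤ) : C(Box L, ℂ) where
  toFun x := ∏ c : Fin 2, fourier (m c) (x c)
  continuous_toFun := by fun_prop

/-- The character `∏ⱼ exp(i π pⱼ · xⱼ / L)` of `Λᵏ`. -/
def confChar (L : ℝ) {k : ℕ} (p : Mom k) : C(Conf L k, ℂ) where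
  toFun x := ∏ j, boxChar L (p j) (x j)
  continuous_toFun := by fun_prop

variable {L : ℝ}

theorem boxChar_apply (m : Fin 2 → ℤ) (x : Box L) :
    boxChar L m x = ∏ c : Fin 2, fourier (m c) (x c) := rfl

theorem boxChar_add (m n : Fin 2 → ℤ) (x : Box L) :
    boxChar L (m + n) x = boxChar L m x * boxChar L n x := by
  simp only [boxChar_apply, Pi.add_apply, fourier_add, Finset.prod_mul_distrib]

theorem boxChar_zero (x : Box L) : boxChar L 0 x = 1 := by
  simp [boxChar_apply]

theorem boxChar_neg (m : Fin 2 → ℤ) (x : Box L) : boxChar L (-m) x = conj (boxChar L m x) := by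
  simp only [boxChar_apply, Pi.neg_apply, fourier_neg, map_prod]

theorem boxChar_apply_sub (m : Fin 2 → ℤ) (x y : Box L) :
    boxChar L m (x - y) = boxChar L m x * boxChar L (-m) y := by
  simp only [boxChar_apply, Pi.sub_apply, Pi.neg_apply, ← Finset.prod_mul_distrib]
  refine Finset.prod_congr rfl fun c _ => ?_
  rw [fourier_apply, fourier_apply, fourier_apply, smul_sub, neg_smul, sub_eq_add_neg,
    AddCircle.toCircle_add, Circle.coe_mul]

theorem norm_boxChar (m : Fin 2 → ℤ) (x : Box L) : ‖boxChar L m x‖ = 1 := by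
  simp only [boxChar_apply, fourier_apply, norm_prod, Circle.norm_coe, Finset.prod_const_one]

theorem confChar_apply {k : ℕ} (p : Mom k) (x : Conf L k) :
    confChar L p x = ∏ j, boxChar L (p j) (x j) := rfl

theorem planeWaveFun_apply {k : ℕ} (p : Mom k) (x : Conf L k) :
    planeWaveFun L p x = (((2 * L : ℝ) : ℂ)⁻¹) ^ k * confChar L p x := by
  change ∏ j : Fin k, (((2 * L : ℝ) : ℂ)⁻¹ * ∏ c : Fin 2, fourier (p j c) (x j c)) = _
  rw [Finset.prod_mul_distrib, Finset.prod_const, Finset.card_univ, Fintype.card_fin]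
  rfl

variable [hL : Fact (0 < L)]

theorem exists_boxChar_ne {x y : Box L} (hxy : x ≠ y) : ∃ m, boxChar L m x ≠ boxChar L m y := by
  obtain ⟨c, hc⟩ := Function.ne_iff.1 hxy
  have e : ∀ z : Box L, boxChar L (Pi.single c 1) z = fourier 1 (z c) := by
    intro z
    rw [boxChar_apply, Finset.prod_eq_single c]
    · simp
    · intro d _ hd
      simp [Pi.single_eq_of_ne hd]
    · simp
  refine ⟨Pi.single c 1, fun h => hc ?_⟩
  rw [e, e, fourier_one, fourier_one] at h
  exact AddCircle.injective_toCircle (mul_pos two_pos hL.out).ne' (Circle.coe_injective h)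

theorem span_boxChar_topologicalClosure :
    (Submodule.span ℂ (range (boxChar L))).topologicalClosure = ⊤ := by
  refine span_range_topologicalClosure_eq_top _ ⟨0, ?_⟩ (fun m n => ⟨m + n, ?_⟩)
    (fun m => ⟨-m, ?_⟩) fun x y => exists_boxChar_ne
  · ext x; exact boxChar_zero x
  · ext x; exact boxChar_add m n x
  · ext x; exact boxChar_neg m x

theorem span_confChar_topologicalClosure (k : ℕ) :
    (Submodule.span ℂ (range (confChar L (k := k)))).topologicalClosure = ⊤ := by
  refine span_range_topologicalClosure_eq_top _ ⟨0, ?_⟩ (fun m n => ⟨m + n, ?_⟩)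
    (fun m => ⟨-m, ?_⟩) fun x y hxy => ?_
  · ext x
    simp [confChar_apply, boxChar_zero]
  · ext x
    simp [confChar_apply, boxChar_add, Finset.prod_mul_distrib]
  · ext x
    simp [confChar_apply, boxChar_neg]
  · obtain ⟨j, hj⟩ := Function.ne_iff.1 hxy
    obtain ⟨m, hm⟩ := exists_boxChar_ne hj
    have e : ∀ z : Conf L k, confChar L (Pi.single j m : Mom k) z = boxChar L m (z j) := by
      intro z
      rw [confChar_apply, Finset.prod_eq_single j]
      · simp
      · intro i _ hi
        rw [Pi.single_eq_of_ne hi, boxChar_zero]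
      · simp
    exact ⟨Pi.single j m, by rwa [e, e]⟩

theorem integral_fourier (n : ℤ) :
    ∫ x : AddCircle (2 * L), (fourier n x : ℂ) = if n = 0 then ((2 * L : ℝ) : ℂ) else 0 := by
  have hT : (2 * L) ≠ 0 := (mul_pos two_pos hL.out).ne'
  have h := congr_fun (fourierCoeff_fourier (T := 2 * L) n) 0
  rw [fourierCoeff, AddCircle.integral_haarAddCircle, inv_smul_eq_iff₀ hT] at h
  simp only [neg_zero, fourier_zero, one_smul] at h
  rw [h]
  by_cases hn : n = 0
  · subst hn
    simp
  · simp [hn]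

theorem integral_boxChar (m : Fin 2 → ℤ) :
    ∫ x : Box L, boxChar L m x = if m = 0 then (((2 * L) ^ 2 : ℝ) : ℂ) else 0 := by
  simp only [boxChar_apply]
  rw [integral_fintype_prod_volume_eq_prod (fun c x => (fourier (m c) x : ℂ))]
  simp only [integral_fourier]
  split_ifs with h
  · subst h
    simp
  · obtain ⟨c, hc⟩ := Function.ne_iff.1 h
    exact Finset.prod_eq_zero (Finset.mem_univ c) (if_neg hc)

theorem integral_confChar {k : ℕ} (p : Mom k) :
    ∫ x : Conf L k, confChar L p x = if p = 0 then (((2 * L) ^ 2 : ℝ) : ℂ) ^ k else 0 := by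
  simp only [confChar_apply]
  rw [integral_fintype_prod_volume_eq_prod (fun j x => boxChar L (p j) x)]
  simp only [integral_boxChar]
  split_ifs with h
  · subst h
    simp
  · obtain ⟨c, hc⟩ := Function.ne_iff.1 h
    exact Finset.prod_eq_zero (Finset.mem_univ c) (if_neg hc)

theorem integral_planeWaveFun_mul_conj {k : ℕ} (p q : Mom k) :
    ∫ x : Conf L k, planeWaveFun L q x * conj (planeWaveFun L p x) = if p = q then 1 else 0 := by
  have hT : ((2 * L : ℝ) : ℂ) ≠ 0 := by
    exact_mod_cast (mul_pos two_pos hL.out).ne'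
  have e : ∀ x : Conf L k, planeWaveFun L q x * conj (planeWaveFun L p x) =
      (((2 * L : ℝ) : ℂ)⁻¹) ^ k * (((2 * L : ℝ) : ℂ)⁻¹) ^ k * confChar L (q - p) x := by
    intro x
    have h1 : confChar L (q - p) x = confChar L q x * conj (confChar L p x) := by
      simp only [confChar_apply, map_prod, ← boxChar_neg, ← Finset.prod_mul_distrib,
        ← boxChar_add, sub_eq_add_neg]
      rfl
    rw [planeWaveFun_apply, planeWaveFun_apply, h1, map_mul, map_pow, map_inv₀, Complex.conj_ofReal]
    ring
  simp only [e]
  rw [integral_const_mul, integral_confChar]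
  by_cases h : p = q
  · subst h
    rw [if_pos (sub_self p), if_pos rfl, ← mul_pow, ← mul_pow]
    have h1 : ((2 * L : ℝ) : ℂ)⁻¹ * ((2 * L : ℝ) : ℂ)⁻¹ * (((2 * L) ^ 2 : ℝ) : ℂ) = 1 := by
      rw [Complex.ofReal_pow, sq, mul_mul_mul_comm, inv_mul_cancel₀ hT, mul_one]
    rw [h1, one_pow]
  · rw [if_neg (sub_ne_zero.2 (Ne.symm h)), if_neg h, mul_zero]

theorem orthonormal_planeWave (k : ℕ) : Orthonormal ℂ (planeWave L (k := k)) := by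
  rw [orthonormal_iff_ite]
  intro p q
  rw [planeWave, planeWave, ContinuousMap.inner_toLp, integral_planeWaveFun_mul_conj]

theorem span_planeWave_topologicalClosure (k : ℕ) :
    (Submodule.span ℂ (range (planeWave L (k := k)))).topologicalClosure = ⊤ := by
  have hT : ((2 * L : ℝ) : ℂ) ≠ 0 := by
    exact_mod_cast (mul_pos two_pos hL.out).ne'
  have h1 := (ContinuousMap.toLp_denseRange ℂ (volume : Measure (Conf L k)) ℂ
    (p := 2) (by simp)).topologicalClosure_map_submodule (span_confChar_topologicalClosure k)
  rw [eq_top_iff, ← h1]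
  refine Submodule.topologicalClosure_mono ?_
  rw [Submodule.map_span, Submodule.span_le]
  rintro _ ⟨_, ⟨p, rfl⟩, rfl⟩
  have h2 : confChar L p = (((2 * L : ℝ) : ℂ)) ^ k • planeWaveFun L p := by
    ext x
    rw [ContinuousMap.smul_apply, planeWaveFun_apply, smul_eq_mul, ← mul_assoc, ← mul_pow,
      mul_inv_cancel₀ hT, one_pow, one_mul]
  rw [h2, ContinuousLinearMap.coe_coe, map_smul]
  exact Submodule.smul_mem _ _ (Submodule.subset_span ⟨p, rfl⟩)

/-- The plane waves as a Hilbert basis of `L²(Λᵏ)`. -/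
def planeWaveBasis (L : ℝ) [Fact (0 < L)] (k : ℕ) : HilbertBasis (Mom k) ℂ (HSpace L k) :=
  HilbertBasis.mk (orthonormal_planeWave k) (span_planeWave_topologicalClosure k).ge

theorem planeWaveBasis_apply {k : ℕ} (p : Mom k) : planeWaveBasis L k p = planeWave L p :=
  congr_fun (HilbertBasis.coe_mk _ _) p

theorem orthonormal_kernelWave (k : ℕ) :
    Orthonormal ℂ fun pp : Mom k × Mom k => kernelWave (L := L) pp.1 pp.2 := by
  rw [orthonormal_iff_ite]
  rintro ⟨p, p'⟩ ⟨q, q'⟩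
  rw [kernelWave, kernelWave, ContinuousMap.inner_toLp]
  have e : ∀ z : Conf L k × Conf L k,
      (planeWaveFun L q z.1 * conj (planeWaveFun L q' z.2)) *
        conj (planeWaveFun L p z.1 * conj (planeWaveFun L p' z.2)) =
      (planeWaveFun L q z.1 * conj (planeWaveFun L p z.1)) *
        (planeWaveFun L p' z.2 * conj (planeWaveFun L q' z.2)) := by
    intro z
    rw [map_mul, Complex.conj_conj]
    ring
  simp only [ContinuousMap.coe_mk, e]
  rw [Measure.volume_eq_prod, integral_prod_mul
    (fun x => planeWaveFun L q x * conj (planeWaveFun L p x))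
    (fun x => planeWaveFun L p' x * conj (planeWaveFun L q' x)),
    integral_planeWaveFun_mul_conj, integral_planeWaveFun_mul_conj]
  by_cases h1 : p = q <;> by_cases h2 : p' = q' <;> simp [h1, h2, eq_comm]

/-- Bessel's inequality for the Fourier coefficients of a kernel. -/
theorem HasL2NormLE.sum_sq_le {k : ℕ} {b : Mom k → Mom k → ℂ} {M : ℝ} (h : HasL2NormLE L b M)
    (S : Finset (Mom k × Mom k)) : ∑ pp ∈ S, ‖b pp.1 pp.2‖ ^ 2 ≤ M ^ 2 := by
  obtain ⟨F, hF, hM⟩ := h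
  simp only [← hF]
  refine ((orthonormal_kernelWave k).sum_inner_products_le F).trans ?_
  gcongr

/-- An operator is determined by its matrix elements between plane waves. -/
theorem op_ext {k : ℕ} {A B : Op L k} (h : ∀ p p', matrixElement A p p' = matrixElement B p p') :
    A = B := by
  refine ContinuousLinearMap.ext_on (s := range (planeWave L (k := k))) ?_ ?_
  · rw [Submodule.dense_iff_topologicalClosure_eq_top, span_planeWave_topologicalClosure]
  · rintro _ ⟨p', rfl⟩
    refine (planeWaveBasis L k).repr.injective ?_
    ext p
    rw [HilbertBasis.repr_apply_apply, HilbertBasis.repr_apply_apply, planeWaveBasis_apply]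
    exact h p p'

end Characters

end GPHierarchy

namespace GPHierarchy

/-! ### Momentum exchange by multiplication operators -/

noncomputable section Multiplication

variable {L : ℝ} {k : ℕ}

/-- Momenta after the exchange of the momentum `l` between the particle `j` and the last one. -/
def shiftMom (j : Fin k) (p : Mom k) (r l : Fin 2 → ℤ) : Mom (k + 1) :=
  Fin.snoc (α := fun _ => Fin 2 → ℤ) (Function.update p j (p j + l)) (r - l)

theorem shiftMom_injective (j : Fin k) (p : Mom k) (r : Fin 2 → ℤ) :
    Function.Injective (shiftMom j p r) := by
  intro l l' h
  have h1 := congr_fun h (Fin.last k)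
  simp only [shiftMom, Fin.snoc_last, sub_right_inj] at h1
  exact h1

/-- The character `m` of `x_j - x_{k+1}` acts on plane waves by exchanging the momentum `m`. -/
theorem boxChar_mul_planeWaveFun (j : Fin k) (p : Mom k) (r m : Fin 2 → ℤ) (x : Conf L (k + 1)) :
    boxChar L m (x j.castSucc - x (Fin.last k)) *
      planeWaveFun L (Fin.snoc (α := fun _ => Fin 2 → ℤ) p r : Mom (k + 1)) x =
      planeWaveFun L (shiftMom j p r m) x := by
  have h1 : ∀ i, boxChar L (Function.update p j (p j + m) i) (x i.castSucc) =
      (if i = j then boxChar L m (x j.castSucc) else 1) * boxChar L (p i) (x i.castSucc) := by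
    intro i
    by_cases h : i = j
    · subst h
      rw [Function.update_self, if_pos rfl, boxChar_add, mul_comm]
    · rw [Function.update_of_ne h, if_neg h, one_mul]
  rw [planeWaveFun_apply, planeWaveFun_apply, confChar_apply, confChar_apply, shiftMom,
    Fin.prod_univ_castSucc, Fin.prod_univ_castSucc]
  simp only [Fin.snoc_castSucc, Fin.snoc_last]
  simp only [h1]
  rw [Finset.prod_mul_distrib, Finset.prod_ite_eq' Finset.univ j, if_pos (Finset.mem_univ j),
    boxChar_apply_sub, sub_eq_add_neg, boxChar_add]
  ring

variable [hL : Fact (0 < L)]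

theorem coeFn_mulOp (f : C(Conf L k, ℂ)) (v : HSpace L k) :
    mulOp f v =ᵐ[volume] fun x => f x * v x := by
  have h1 := ContinuousLinearMap.coeFn_holder (r := 2) (ContinuousLinearMap.mul ℂ ℂ)
    (ContinuousMap.toLp ∞ (volume : Measure (Conf L k)) ℂ f) v
  have h2 := ContinuousMap.coeFn_toLp (p := ∞) (𝕜 := ℂ) (volume : Measure (Conf L k)) f
  have h3 : mulOp f v = (ContinuousLinearMap.mul ℂ ℂ).holder 2
      (ContinuousMap.toLp ∞ (volume : Measure (Conf L k)) ℂ f) v := by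
    rw [mulOp, ContinuousLinearMap.holderL_apply_apply]
  rw [h3]
  filter_upwards [h1, h2] with x hx1 hx2
  rw [hx1, hx2]
  rfl

theorem inner_mulOp_planeWave (f : C(Conf L k, ℂ)) (p q : Mom k) :
    inner ℂ (planeWave L q) (mulOp f (planeWave L p)) =
      ∫ x, f x * (planeWaveFun L p x * conj (planeWaveFun L q x)) := by
  rw [L2.inner_def]
  refine integral_congr_ae ?_
  filter_upwards [coeFn_mulOp f (planeWave L p),
    ContinuousMap.coeFn_toLp (p := 2) (𝕜 := ℂ) (volume : Measure (Conf L k)) (planeWaveFun L p),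
    ContinuousMap.coeFn_toLp (p := 2) (𝕜 := ℂ) (volume : Measure (Conf L k)) (planeWaveFun L q)]
    with x h1 h2 h3
  rw [h1, planeWave, planeWave, h2, h3, RCLike.inner_apply]
  ring

theorem inner_mulOp_left (f : C(Conf L k, ℂ)) (hf : ∀ x, conj (f x) = f x) (u v : HSpace L k) :
    inner ℂ (mulOp f u) v = inner ℂ u (mulOp f v) := by
  rw [L2.inner_def, L2.inner_def]
  refine integral_congr_ae ?_
  filter_upwards [coeFn_mulOp f u, coeFn_mulOp f v] with x h1 h2
  rw [h1, h2, RCLike.inner_apply, RCLike.inner_apply, map_mul, hf]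
  ring

theorem inner_mulOp_pairFun_left (φ : C(Box L, ℝ)) (j : Fin k) (u v : HSpace L (k + 1)) :
    inner ℂ (mulOp (pairFun φ j) u) v = inner ℂ u (mulOp (pairFun φ j) v) :=
  inner_mulOp_left _ (fun _ => Complex.conj_ofReal _) u v

/-- The functional `f ↦ ∫ f(d(x)) w(x) dx`. -/
def integralAgainst {X : Type*} [TopologicalSpace X] [CompactSpace X] [MeasureSpace X]
    [BorelSpace X] [IsFiniteMeasure (volume : Measure X)] (d : C(X, Box L)) (w : C(X, ℂ)) :
    C(Box L, ℂ) →L[ℂ] ℂ :=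
  have hint : ∀ f : C(X, ℂ), Integrable f volume := fun f =>
    f.continuous.integrable_of_hasCompactSupport (HasCompactSupport.of_compactSpace _)
  LinearMap.mkContinuous
    { toFun := fun f => ∫ x, f (d x) * w x
      map_add' := fun f g => by
        simp only [ContinuousMap.add_apply, add_mul]
        exact integral_add (hint (f.comp d * w)) (hint (g.comp d * w))
      map_smul' := fun c f => by
        simp only [ContinuousMap.smul_apply, smul_eq_mul, mul_assoc, RingHom.id_apply]
        exact integral_const_mul _ _ }
    (∫ x, ‖w x‖) fun f => by
      refine (norm_integral_le_integral_norm _).trans ?_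
      rw [← integral_mul_const]
      refine integral_mono (hint (f.comp d * w)).norm ((hint w).norm.mul_const _) fun x => ?_
      simp only [norm_mul, mul_comm ‖w x‖]
      gcongr
      exact f.norm_coe_le_norm _

theorem integralAgainst_apply {X : Type*} [TopologicalSpace X] [CompactSpace X] [MeasureSpace X]
    [BorelSpace X] [IsFiniteMeasure (volume : Measure X)] (d : C(X, Box L)) (w : C(X, ℂ))
    (f : C(Box L, ℂ)) : integralAgainst d w f = ∫ x, f (d x) * w x := rfl

/-- The Fourier coefficients of a function on `Λ`, not normalized. -/
def deltaCoeff (φ : C(Box L, ℝ)) (l : Fin 2 → ℤ) : ℂ := ∫ x, (φ x : ℂ) * conj (boxChar L l x)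

/-- The complexification of a real valued function. -/
def complexify (φ : C(Box L, ℝ)) : C(Box L, ℂ) := ⟨fun x => (φ x : ℂ), by fun_prop⟩

theorem integral_boxChar_mul_conj (m l : Fin 2 → ℤ) :
    ∫ x : Box L, boxChar L m x * conj (boxChar L l x) =
      if m = l then (((2 * L) ^ 2 : ℝ) : ℂ) else 0 := by
  simp only [← boxChar_neg, ← boxChar_add, integral_boxChar, ← sub_eq_add_neg, sub_eq_zero]

/-- A continuous functional on `C(Λ)` is determined by its values on the characters, which span a
dense subspace. -/
theorem clm_ext_boxChar {Λ₁ Λ₂ : C(Box L, ℂ) →L[ℂ] ℂ}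
    (h : ∀ m, Λ₁ (boxChar L m) = Λ₂ (boxChar L m)) : Λ₁ = Λ₂ := by
  refine ContinuousLinearMap.ext_on (s := range (boxChar L)) ?_ ?_
  · rw [Submodule.dense_iff_topologicalClosure_eq_top, span_boxChar_topologicalClosure]
  · rintro _ ⟨m, rfl⟩
    exact h m

/-- The difference `x_j - x_{k+1}`. -/
def pairDiff (L : ℝ) (j : Fin k) : C(Conf L (k + 1), Box L) :=
  ⟨fun x => x j.castSucc - x (Fin.last k), by fun_prop⟩

theorem inner_planeWave_mulOp_pairFun (φ : C(Box L, ℝ)) (j : Fin k) (p : Mom k)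
    (r : Fin 2 → ℤ) (Q : Mom (k + 1)) :
    inner ℂ (planeWave L Q) (mulOp (pairFun φ j)
      (planeWave L (Fin.snoc (α := fun _ => Fin 2 → ℤ) p r : Mom (k + 1)))) =
      ∫ x, complexify φ (pairDiff L j x) *
        (planeWaveFun L (Fin.snoc (α := fun _ => Fin 2 → ℤ) p r : Mom (k + 1)) x *
          conj (planeWaveFun L Q x)) :=
  inner_mulOp_planeWave _ _ _

theorem integralAgainst_pairDiff_boxChar (j : Fin k) (p : Mom k) (r m : Fin 2 → ℤ)
    (Q : Mom (k + 1)) : ∫ x, boxChar L m (pairDiff L j x) *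
        (planeWaveFun L (Fin.snoc (α := fun _ => Fin 2 → ℤ) p r : Mom (k + 1)) x *
          conj (planeWaveFun L Q x)) = if Q = shiftMom j p r m then 1 else 0 := by
  rw [← integral_planeWaveFun_mul_conj (L := L)]
  refine integral_congr_ae (Eventually.of_forall fun x => ?_)
  simp only
  rw [← boxChar_mul_planeWaveFun, mul_assoc]
  rfl

/-- The matrix elements of `φ(x_j - x_{k+1})` between momenta that differ by an exchange of `l` are
Fourier coefficients of `φ`. Both sides are continuous in `φ`, and are compared on characters. -/
theorem inner_planeWave_mulOp_pairFun_shift (φ : C(Box L, ℝ)) (j : Fin k) (p : Mom k)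
    (r l : Fin 2 → ℤ) :
    inner ℂ (planeWave L (shiftMom j p r l)) (mulOp (pairFun φ j)
      (planeWave L (Fin.snoc (α := fun _ => Fin 2 → ℤ) p r : Mom (k + 1)))) =
      (((2 * L) ^ 2 : ℝ) : ℂ)⁻¹ * deltaCoeff φ l := by
  have hT : (((2 * L) ^ 2 : ℝ) : ℂ) ≠ 0 := by
    exact_mod_cast (pow_pos (mul_pos two_pos hL.out) 2).ne'
  rw [inner_planeWave_mulOp_pairFun]
  have key : integralAgainst (pairDiff L j)
      ⟨fun x => planeWaveFun L (Fin.snoc (α := fun _ => Fin 2 → ℤ) p r : Mom (k + 1)) x *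
        conj (planeWaveFun L (shiftMom j p r l) x), by fun_prop⟩ =
      (((2 * L) ^ 2 : ℝ) : ℂ)⁻¹ • integralAgainst (ContinuousMap.id (Box L))
        ⟨fun x => conj (boxChar L l x), by fun_prop⟩ := by
    refine clm_ext_boxChar fun m => ?_
    rw [_root_.smul_apply, integralAgainst_apply, integralAgainst_apply]
    simp only [ContinuousMap.coe_mk, ContinuousMap.id_apply]
    rw [integralAgainst_pairDiff_boxChar, integral_boxChar_mul_conj]
    by_cases h : m = l
    · subst h
      rw [if_pos rfl, if_pos rfl, smul_eq_mul, inv_mul_cancel₀ hT]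
    · rw [if_neg fun h' => h (shiftMom_injective j p r h').symm, if_neg h, smul_zero]
  exact congrArg (fun Λ : C(Box L, ℂ) →L[ℂ] ℂ => Λ (complexify φ)) key

theorem inner_planeWave_mulOp_pairFun_eq_zero (φ : C(Box L, ℝ)) (j : Fin k) (p : Mom k)
    (r : Fin 2 → ℤ) {Q : Mom (k + 1)} (hQ : Q ∉ range (shiftMom j p r)) :
    inner ℂ (planeWave L Q) (mulOp (pairFun φ j)
      (planeWave L (Fin.snoc (α := fun _ => Fin 2 → ℤ) p r : Mom (k + 1)))) = 0 := by
  rw [inner_planeWave_mulOp_pairFun]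
  have key : integralAgainst (pairDiff L j)
      ⟨fun x => planeWaveFun L (Fin.snoc (α := fun _ => Fin 2 → ℤ) p r : Mom (k + 1)) x *
        conj (planeWaveFun L Q x), by fun_prop⟩ = 0 := by
    refine clm_ext_boxChar fun m => ?_
    rw [integralAgainst_apply]
    simp only [ContinuousMap.coe_mk]
    rw [integralAgainst_pairDiff_boxChar, if_neg fun h => hQ ⟨m, h.symm⟩]
    rfl
  exact congrArg (fun Λ : C(Box L, ℂ) →L[ℂ] ℂ => Λ (complexify φ)) key

theorem hasSum_matrixElement_mulOp_comp (φ : C(Box L, ℝ)) (j : Fin k) (A : Op L (k + 1))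
    (p : Mom k) (r : Fin 2 → ℤ) (P' : Mom (k + 1)) :
    HasSum (fun l => (((2 * L) ^ 2 : ℝ) : ℂ)⁻¹ * conj (deltaCoeff φ l) *
        matrixElement A (shiftMom j p r l) P')
      (matrixElement (mulOp (pairFun φ j) ∘L A)
        (Fin.snoc (α := fun _ => Fin 2 → ℤ) p r) P') := by
  have h := (planeWaveBasis L (k + 1)).hasSum_inner_mul_inner (mulOp (pairFun φ j)
    (planeWave L (Fin.snoc (α := fun _ => Fin 2 → ℤ) p r : Mom (k + 1)))) (A (planeWave L P'))
  rw [inner_mulOp_pairFun_left, ← (shiftMom_injective j p r).hasSum_iff] at h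
  · refine Eq.mp (congrArg₂ HasSum (funext fun l => ?_) rfl) h
    simp only [Function.comp_apply, planeWaveBasis_apply]
    rw [← inner_conj_symm, inner_planeWave_mulOp_pairFun_shift, map_mul, map_inv₀,
      Complex.conj_ofReal]
    rfl
  · intro Q hQ
    rw [planeWaveBasis_apply, ← inner_conj_symm,
      inner_planeWave_mulOp_pairFun_eq_zero φ j p r hQ, map_zero, zero_mul]

theorem hasSum_matrixElement_comp_mulOp (φ : C(Box L, ℝ)) (j : Fin k) (A : Op L (k + 1))
    (P : Mom (k + 1)) (p' : Mom k) (r : Fin 2 → ℤ) :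
    HasSum (fun l => (((2 * L) ^ 2 : ℝ) : ℂ)⁻¹ * deltaCoeff φ l *
        matrixElement A P (shiftMom j p' r l))
      (matrixElement (A ∘L mulOp (pairFun φ j)) P
        (Fin.snoc (α := fun _ => Fin 2 → ℤ) p' r)) := by
  have h := (planeWaveBasis L (k + 1)).hasSum_inner_mul_inner
    (ContinuousLinearMap.adjoint A (planeWave L P)) (mulOp (pairFun φ j)
    (planeWave L (Fin.snoc (α := fun _ => Fin 2 → ℤ) p' r : Mom (k + 1))))
  rw [ContinuousLinearMap.adjoint_inner_left, ← (shiftMom_injective j p' r).hasSum_iff] at h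
  · refine Eq.mp (congrArg₂ HasSum (funext fun l => ?_) rfl) h
    simp only [Function.comp_apply, planeWaveBasis_apply]
    rw [ContinuousLinearMap.adjoint_inner_left, inner_planeWave_mulOp_pairFun_shift, mul_comm]
    rfl
  · intro Q hQ
    rw [planeWaveBasis_apply, inner_planeWave_mulOp_pairFun_eq_zero φ j p' r hQ, mul_zero]

/-! ### Approximations of the delta function -/

theorem norm_deltaCoeff_le {φ : ℕ → C(Box L, ℝ)} (hφ : IsApproxDelta φ) (n : ℕ)
    (l : Fin 2 → ℤ) : ‖deltaCoeff (φ n) l‖ ≤ 1 := by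
  refine (norm_integral_le_integral_norm _).trans (le_of_eq ?_)
  rw [← hφ.integral_eq_one n]
  refine integral_congr_ae (Eventually.of_forall fun x => ?_)
  simp only [norm_mul, RCLike.norm_conj, norm_boxChar, mul_one, Complex.norm_real]
  exact Real.norm_of_nonneg (hφ.nonneg n x)

/-- The Fourier coefficients of the approximations tend to those of the delta function: the
character is close to `1` near the origin, and the mass elsewhere tends to zero. -/
theorem tendsto_deltaCoeff {φ : ℕ → C(Box L, ℝ)} (hφ : IsApproxDelta φ) (l : Fin 2 → ℤ) :
    Tendsto (fun n => deltaCoeff (φ n) l) atTop (𝓝 1) := by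
  rw [Metric.tendsto_atTop]
  intro ε hε
  set χ : Box L → ℂ := fun x => conj (boxChar L l x) with hχ
  have hχc : Continuous χ := by fun_prop
  set U : Set (Box L) := {x | ‖χ x - 1‖ < ε / 2} with hU
  have hUo : IsOpen U := isOpen_lt (by fun_prop) continuous_const
  have h0 : (0 : Box L) ∈ U := by
    change ‖χ 0 - 1‖ < ε / 2
    have : χ 0 = 1 := by simp [hχ, boxChar_apply]
    rw [this, sub_self, norm_zero]
    positivity
  obtain ⟨N, hN⟩ := (Metric.tendsto_atTop.1 (hφ.concentrates U hUo h0)) (ε / 4) (by positivity)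
  refine ⟨N, fun n hn => ?_⟩
  have hint : ∀ f : Box L → ℂ, Continuous f → Integrable f volume := fun f hf =>
    hf.integrable_of_hasCompactSupport (HasCompactSupport.of_compactSpace _)
  have hintR : ∀ f : Box L → ℝ, Continuous f → Integrable f volume := fun f hf =>
    hf.integrable_of_hasCompactSupport (HasCompactSupport.of_compactSpace _)
  have h1 : deltaCoeff (φ n) l - 1 = ∫ x, (φ n x : ℂ) * (χ x - 1) := by
    have h2 : (1 : ℂ) = ∫ x, (φ n x : ℂ) := by
      rw [integral_complex_ofReal, hφ.integral_eq_one n, Complex.ofReal_one]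
    conv_lhs => rw [h2]
    rw [deltaCoeff, ← integral_sub (hint _ (by fun_prop)) (hint _ (by fun_prop))]
    simp only [mul_sub, mul_one, hχ]
  have hbd : ∀ x, ‖χ x - 1‖ ≤ 2 := fun x => by
    refine (norm_sub_le _ _).trans ?_
    rw [hχ, RCLike.norm_conj, norm_boxChar, norm_one]
    norm_num
  have hφU : ∫ x in Uᶜ, φ n x < ε / 4 := by
    have := hN n hn
    rw [Real.dist_eq, sub_zero] at this
    exact (le_abs_self _).trans_lt this
  rw [dist_eq_norm, h1]
  calc ‖∫ x, (φ n x : ℂ) * (χ x - 1)‖ ≤ ∫ x, ‖(φ n x : ℂ) * (χ x - 1)‖ :=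
        norm_integral_le_integral_norm _
    _ = (∫ x in U, ‖(φ n x : ℂ) * (χ x - 1)‖) + ∫ x in Uᶜ, ‖(φ n x : ℂ) * (χ x - 1)‖ :=
        (integral_add_compl hUo.measurableSet (hintR _ (by fun_prop))).symm
    _ ≤ (∫ x in U, φ n x * (ε / 2)) + ∫ x in Uᶜ, φ n x * 2 := by
        refine add_le_add (setIntegral_mono_on (hintR _ (by fun_prop)).integrableOn
          (hintR _ (by fun_prop)).integrableOn hUo.measurableSet fun x hx => ?_)
          (setIntegral_mono_on (hintR _ (by fun_prop)).integrableOn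
          (hintR _ (by fun_prop)).integrableOn hUo.measurableSet.compl fun x _ => ?_)
        · rw [norm_mul, Complex.norm_real, Real.norm_of_nonneg (hφ.nonneg n x)]
          exact mul_le_mul_of_nonneg_left (le_of_lt hx) (hφ.nonneg n x)
        · rw [norm_mul, Complex.norm_real, Real.norm_of_nonneg (hφ.nonneg n x)]
          exact mul_le_mul_of_nonneg_left (hbd x) (hφ.nonneg n x)
    _ ≤ ε / 2 + (∫ x in Uᶜ, φ n x) * 2 := by
        rw [integral_mul_const, integral_mul_const]
        have h3 : ∫ x in U, φ n x ≤ 1 := by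
          rw [← hφ.integral_eq_one n]
          exact setIntegral_le_integral (hintR _ (by fun_prop))
            (Eventually.of_forall (hφ.nonneg n))
        nlinarith
    _ < ε := by linarith

end Multiplication

end GPHierarchy

namespace GPHierarchy

/-! ### Trace class operators -/

section TraceClass

variable {H : Type*} [NormedAddCommGroup H] [InnerProductSpace ℂ H]

theorem IsTraceClass.comp_left {A : H →L[ℂ] H} (hA : IsTraceClass A) (M : H →L[ℂ] H) :
    IsTraceClass (M ∘L A) := by
  obtain ⟨f, g, hs, h⟩ := hA
  refine ⟨fun n => M (f n), g, ?_, fun x => ?_⟩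
  · refine Summable.of_nonneg_of_le (fun n => by positivity) (fun n => ?_) (hs.mul_left ‖M‖)
    rw [← mul_assoc]
    gcongr
    exact M.le_opNorm _
  · have := (h x).mapL M
    simp only [map_smul] at this
    exact this

theorem IsTraceClass.comp_right [CompleteSpace H] {A : H →L[ℂ] H} (hA : IsTraceClass A)
    (M : H →L[ℂ] H) : IsTraceClass (A ∘L M) := by
  obtain ⟨f, g, hs, h⟩ := hA
  refine ⟨f, fun n => ContinuousLinearMap.adjoint M (g n), ?_, fun x => ?_⟩
  · refine Summable.of_nonneg_of_le (fun n => by positivity) (fun n => ?_)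
      (hs.mul_left ‖ContinuousLinearMap.adjoint M‖)
    rw [mul_left_comm]
    gcongr
    exact (ContinuousLinearMap.adjoint M).le_opNorm _
  · simp only [ContinuousLinearMap.adjoint_inner_left]
    exact h (M x)

/-- The matrix elements of a trace class operator between two orthonormal families are absolutely
summable, by the Cauchy-Schwarz inequality and Bessel's inequality for each `fₙ` and `gₙ`. -/
theorem IsTraceClass.summable_inner {A : H →L[ℂ] H} (hA : IsTraceClass A) {κ : Type*}
    {u v : κ → H} (hu : Orthonormal ℂ u) (hv : Orthonormal ℂ v) :
    Summable fun i => inner ℂ (u i) (A (v i)) := by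
  obtain ⟨f, g, hs, h⟩ := hA
  refine Summable.of_norm (summable_of_sum_le (c := ∑' n, ‖f n‖ * ‖g n‖)
    (fun _ => norm_nonneg _) fun S => ?_)
  have h1 : ∀ i, HasSum (fun n => inner ℂ (g n) (v i) * inner ℂ (u i) (f n))
      (inner ℂ (u i) (A (v i))) := by
    intro i
    have := (h (v i)).mapL (innerSL ℂ (u i))
    simpa only [innerSL_apply_apply, inner_smul_right] using this
  have hle : ∀ i n, ‖inner ℂ (g n) (v i) * inner ℂ (u i) (f n)‖ ≤ ‖f n‖ * ‖g n‖ := by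
    intro i n
    have h2 := norm_inner_le_norm (𝕜 := ℂ) (g n) (v i)
    have h3 := norm_inner_le_norm (𝕜 := ℂ) (u i) (f n)
    rw [hv.1 i, mul_one] at h2
    rw [hu.1 i, one_mul] at h3
    rw [norm_mul, mul_comm]
    gcongr
  have hsum : ∀ i, Summable fun n => ‖inner ℂ (g n) (v i) * inner ℂ (u i) (f n)‖ := fun i =>
    Summable.of_nonneg_of_le (fun _ => norm_nonneg _) (hle i) hs
  calc ∑ i ∈ S, ‖inner ℂ (u i) (A (v i))‖
      ≤ ∑ i ∈ S, ∑' n, ‖inner ℂ (g n) (v i) * inner ℂ (u i) (f n)‖ := by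
        refine Finset.sum_le_sum fun i _ => ?_
        rw [← (h1 i).tsum_eq]
        exact norm_tsum_le_tsum_norm (hsum i)
    _ = ∑' n, ∑ i ∈ S, ‖inner ℂ (g n) (v i) * inner ℂ (u i) (f n)‖ :=
        (Summable.tsum_finsetSum fun i _ => hsum i).symm
    _ ≤ ∑' n, ‖f n‖ * ‖g n‖ := by
        refine Summable.tsum_le_tsum (fun n => ?_) (summable_sum fun i _ => hsum i) hs
        calc ∑ i ∈ S, ‖inner ℂ (g n) (v i) * inner ℂ (u i) (f n)‖
            = ∑ i ∈ S, ‖inner ℂ (u i) (f n)‖ * ‖inner ℂ (v i) (g n)‖ := by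
              refine Finset.sum_congr rfl fun i _ => ?_
              rw [norm_mul, norm_inner_symm, mul_comm]
          _ ≤ √(∑ i ∈ S, ‖inner ℂ (u i) (f n)‖ ^ 2) * √(∑ i ∈ S, ‖inner ℂ (v i) (g n)‖ ^ 2) :=
              Real.sum_mul_le_sqrt_mul_sqrt _ _ _
          _ ≤ ‖f n‖ * ‖g n‖ := by
              gcongr
              · exact Real.sqrt_le_iff.2 ⟨norm_nonneg _, hu.sum_inner_products_le _⟩
              · exact Real.sqrt_le_iff.2 ⟨norm_nonneg _, hv.sum_inner_products_le _⟩

end TraceClass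

variable {L : ℝ} [hL : Fact (0 < L)] {k : ℕ}

theorem snoc_injective_right (p : Mom k) : Function.Injective fun r : Fin 2 → ℤ =>
    (Fin.snoc (α := fun _ => Fin 2 → ℤ) p r : Mom (k + 1)) := fun r r' h => by
  have := congr_fun h (Fin.last k)
  simpa using this

theorem summable_partialTrace {A : Op L (k + 1)} (hA : IsTraceClass A) (p p' : Mom k) :
    Summable fun r : Fin 2 → ℤ => matrixElement A (Fin.snoc (α := fun _ => Fin 2 → ℤ) p r)
      (Fin.snoc (α := fun _ => Fin 2 → ℤ) p' r) :=
  hA.summable_inner ((orthonormal_planeWave (k + 1)).comp _ (snoc_injective_right p))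
    ((orthonormal_planeWave (k + 1)).comp _ (snoc_injective_right p'))

theorem matrixElement_sub (A B : Op L k) (p p' : Mom k) :
    matrixElement (A - B) p p' = matrixElement A p p' - matrixElement B p p' := by
  simp only [matrixElement, sub_apply, inner_sub_right]

/-- The partial trace of a commutator with a trace class operator, as a convergent sum. -/
theorem hasSum_regCollision (φ : C(Box L, ℝ)) (j : Fin k) {A : Op L (k + 1)}
    (hA : IsTraceClass A) (p p' : Mom k) :
    HasSum (fun r : Fin 2 → ℤ =>
      matrixElement (mulOp (pairFun φ j) ∘L A) (Fin.snoc (α := fun _ => Fin 2 → ℤ) p r)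
        (Fin.snoc (α := fun _ => Fin 2 → ℤ) p' r) -
      matrixElement (A ∘L mulOp (pairFun φ j)) (Fin.snoc (α := fun _ => Fin 2 → ℤ) p r)
        (Fin.snoc (α := fun _ => Fin 2 → ℤ) p' r)) (regCollision φ j A p p') := by
  have h1 := summable_partialTrace (hA.comp_left (mulOp (pairFun φ j))) p p'
  have h2 := summable_partialTrace (hA.comp_right (mulOp (pairFun φ j))) p p'
  have h3 := (h1.sub h2).hasSum
  simp only [regCollision, partialTraceElement, matrixElement_sub]
  exact h3

/-- The difference of two regularized collision terms as one convergent sum. -/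
theorem hasSum_regCollision_sub (φ : C(Box L, ℝ)) (j : Fin k) {A A' : Op L (k + 1)}
    (hA : IsTraceClass A) (hA' : IsTraceClass A') (p p' : Mom k) :
    HasSum (fun r : Fin 2 → ℤ =>
      matrixElement (mulOp (pairFun φ j) ∘L (A - A')) (Fin.snoc (α := fun _ => Fin 2 → ℤ) p r)
        (Fin.snoc (α := fun _ => Fin 2 → ℤ) p' r) -
      matrixElement ((A - A') ∘L mulOp (pairFun φ j)) (Fin.snoc (α := fun _ => Fin 2 → ℤ) p r)
        (Fin.snoc (α := fun _ => Fin 2 → ℤ) p' r))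
      (regCollision φ j A p p' - regCollision φ j A' p p') := by
  refine Eq.mp (congrArg₂ HasSum (funext fun r => ?_) rfl)
    ((hasSum_regCollision φ j hA p p').sub (hasSum_regCollision φ j hA' p p'))
  rw [ContinuousLinearMap.comp_sub, ContinuousLinearMap.sub_comp, matrixElement_sub,
    matrixElement_sub]
  ring

theorem CollisionExists.tendsto {φ : ℕ → C(Box L, ℝ)} {j : Fin k} {A : Op L (k + 1)}
    (h : CollisionExists φ j A) (p p' : Mom k) :
    Tendsto (fun n => regCollision (φ n) j A p p') atTop (𝓝 (collision φ j A p p')) :=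
  tendsto_nhds_limUnder (h p p')

/-! ### Permutation symmetry of the matrix elements -/

theorem permOp_planeWave (σ : Equiv.Perm (Fin k)) (p : Mom k) :
    permOp σ (planeWave L p) = planeWave L (p ∘ σ.symm) := by
  refine Lp.ext ?_
  have h1 := Lp.coeFn_compMeasurePreserving (planeWave L p) (measurePreserving_perm σ)
  have h2 := ContinuousMap.coeFn_toLp (p := 2) (𝕜 := ℂ) (volume : Measure (Conf L k))
    (planeWaveFun L (p ∘ σ.symm))
  have h3 := (measurePreserving_perm (L := L) σ).quasiMeasurePreserving.ae_eq_comp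
    (ContinuousMap.coeFn_toLp (p := 2) (𝕜 := ℂ) (volume : Measure (Conf L k)) (planeWaveFun L p))
  filter_upwards [h1, h2, h3] with x hx1 hx2 hx3
  refine hx1.trans (Eq.trans ?_ hx2.symm)
  refine hx3.trans ?_
  change planeWaveFun L p (x ∘ σ) = planeWaveFun L (p ∘ σ.symm) x
  rw [planeWaveFun_apply, planeWaveFun_apply, confChar_apply, confChar_apply]
  congr 1
  rw [← Equiv.prod_comp σ fun i => boxChar L ((p ∘ σ.symm) i) (x i)]
  simp

theorem IsPermSymmetric.matrixElement_comp {A : Op L k} (hA : IsPermSymmetric A)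
    (σ : Equiv.Perm (Fin k)) (p p' : Mom k) :
    matrixElement A (p ∘ σ) (p' ∘ σ) = matrixElement A p p' := by
  have h1 : ∀ q : Mom k, permOp (L := L) σ.symm (planeWave L q) = planeWave L (q ∘ σ) := fun q =>
    permOp_planeWave σ.symm q
  have h2 : ∀ u v : HSpace L k, inner ℂ (permOp σ.symm u) (permOp σ.symm v) = inner ℂ u v :=
    fun u v => LinearIsometry.inner_map_map _ u v
  have h3 : A (permOp σ.symm (planeWave L p')) = permOp σ.symm (A (planeWave L p')) :=
    (congrArg (fun B : Op L k => B (planeWave L p')) (hA σ.symm)).symm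
  rw [matrixElement, ← h1, ← h1, h3, h2, matrixElement]

end GPHierarchy

namespace GPHierarchy

/-! ### Bounded measurable functions on an interval -/

/-- Fatou's lemma along a countably generated filter. -/
theorem lintegral_le_of_tendsto_of_le {X κ : Type*} [MeasurableSpace X] {μ : Measure X}
    {l : Filter κ} [l.NeBot] [l.IsCountablyGenerated] {f : κ → X → ℝ≥0∞} {g : X → ℝ≥0∞}
    {B : κ → ℝ≥0∞} {B₀ : ℝ≥0∞} (hf : ∀ i, AEMeasurable (f i) μ)
    (hlim : ∀ᵐ x ∂μ, Tendsto (fun i => f i x) l (𝓝 (g x)))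
    (hB : ∀ᶠ i in l, ∫⁻ x, f i x ∂μ ≤ B i) (hB₀ : Tendsto B l (𝓝 B₀)) :
    ∫⁻ x, g x ∂μ ≤ B₀ := by
  obtain ⟨u, hu⟩ := exists_seq_tendsto l
  calc ∫⁻ x, g x ∂μ = ∫⁻ x, liminf (fun n => f (u n) x) atTop ∂μ := by
        refine lintegral_congr_ae ?_
        filter_upwards [hlim] with x hx
        exact (hx.comp hu).liminf_eq.symm
    _ ≤ liminf (fun n => ∫⁻ x, f (u n) x ∂μ) atTop := lintegral_liminf_le' fun n => hf (u n)
    _ ≤ liminf (fun n => B (u n)) atTop := liminf_le_liminf (hu.eventually hB)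
    _ = B₀ := (hB₀.comp hu).liminf_eq

theorem enorm_sq_eq_ofReal (z : ℂ) : ‖z‖ₑ ^ 2 = ENNReal.ofReal (‖z‖ ^ 2) := by
  rw [← ofReal_norm, ENNReal.ofReal_pow (norm_nonneg _)]

theorem ofReal_intervalIntegral_eq_lintegral {a b : ℝ} (hab : a ≤ b) {f : ℝ → ℝ}
    (hf : IntervalIntegrable f volume a b) (h0 : ∀ x, 0 ≤ f x) :
    ENNReal.ofReal (∫ x in a..b, f x) = ∫⁻ x in Ioc a b, ENNReal.ofReal (f x) := by
  rw [intervalIntegral.integral_of_le hab]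
  exact ofReal_integral_eq_lintegral_ofReal hf.1 (Eventually.of_forall h0)

/-- Bounded measurable functions on the interval `(a, b]`. -/
structure BoundedMeasurableOn (a b : ℝ) (u : ℝ → ℂ) : Prop where
  aestronglyMeasurable : AEStronglyMeasurable u (volume.restrict (Ioc a b))
  bounded : ∃ M, ∀ t ∈ Ioc a b, ‖u t‖ ≤ M

namespace BoundedMeasurableOn

variable {a b : ℝ} {u v : ℝ → ℂ}

theorem mul (hu : BoundedMeasurableOn a b u) (hv : BoundedMeasurableOn a b v) :
    BoundedMeasurableOn a b fun t => u t * v t := by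
  obtain ⟨M, hM⟩ := hu.bounded
  obtain ⟨N, hN⟩ := hv.bounded
  refine ⟨hu.1.mul hv.1, M * N, fun t ht => ?_⟩
  rw [norm_mul]
  exact mul_le_mul (hM t ht) (hN t ht) (norm_nonneg _) ((norm_nonneg _).trans (hM t ht))

theorem sub (hu : BoundedMeasurableOn a b u) (hv : BoundedMeasurableOn a b v) :
    BoundedMeasurableOn a b fun t => u t - v t := by
  obtain ⟨M, hM⟩ := hu.bounded
  obtain ⟨N, hN⟩ := hv.bounded
  exact ⟨hu.1.sub hv.1, M + N, fun t ht =>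
    (norm_sub_le _ _).trans (add_le_add (hM t ht) (hN t ht))⟩

theorem sum {κ : Type*} {S : Finset κ} {f : κ → ℝ → ℂ}
    (hf : ∀ i ∈ S, BoundedMeasurableOn a b (f i)) :
    BoundedMeasurableOn a b fun t => ∑ i ∈ S, f i t := by
  classical
  induction S using Finset.induction_on with
  | empty =>
    simp only [Finset.sum_empty]
    exact ⟨aestronglyMeasurable_const, 0, fun t _ => norm_zero.le⟩
  | insert i S hi ih =>
    simp only [Finset.sum_insert hi]
    have h1 := hf i (Finset.mem_insert_self i S)
    have h2 := ih fun j hj => hf j (Finset.mem_insert_of_mem hj)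
    obtain ⟨M, hM⟩ := h1.bounded
    obtain ⟨N, hN⟩ := h2.bounded
    exact ⟨h1.1.add h2.1, M + N, fun t ht =>
      (norm_add_le _ _).trans (add_le_add (hM t ht) (hN t ht))⟩

theorem of_continuousOn (hu : ContinuousOn u (Icc a b)) : BoundedMeasurableOn a b u := by
  obtain ⟨M, hM⟩ := isCompact_Icc.exists_bound_of_continuousOn hu
  exact ⟨(hu.mono Ioc_subset_Icc_self).aestronglyMeasurable measurableSet_Ioc, M,
    fun t ht => hM t (Ioc_subset_Icc_self ht)⟩

theorem const (c : ℂ) : BoundedMeasurableOn a b fun _ => c := of_continuousOn continuousOn_const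

theorem integrableOn (hu : BoundedMeasurableOn a b u) : IntegrableOn u (Ioc a b) := by
  obtain ⟨M, hM⟩ := hu.bounded
  exact Integrable.of_bound hu.1 M
    ((ae_restrict_iff' measurableSet_Ioc).2 (Eventually.of_forall hM))

theorem intervalIntegrable (hu : BoundedMeasurableOn a b u) (hab : a ≤ b) :
    IntervalIntegrable u volume a b :=
  (intervalIntegrable_iff_integrableOn_Ioc_of_le hab).2 hu.integrableOn

theorem intervalIntegrable_sq (hu : BoundedMeasurableOn a b u) (hab : a ≤ b) :
    IntervalIntegrable (fun t => ‖u t‖ ^ 2) volume a b := by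
  obtain ⟨M, hM⟩ := hu.bounded
  refine (intervalIntegrable_iff_integrableOn_Ioc_of_le hab).2 (Integrable.of_bound
    (hu.1.norm.pow 2) (M ^ 2) ((ae_restrict_iff' measurableSet_Ioc).2
      (Eventually.of_forall fun t ht => ?_)))
  rw [Real.norm_of_nonneg (sq_nonneg _)]
  gcongr
  exact hM t ht

theorem integral (hu : BoundedMeasurableOn a b u) (hab : a ≤ b) :
    BoundedMeasurableOn a b fun t => ∫ s in a..t, u s := by
  refine of_continuousOn ?_
  have := intervalIntegral.continuousOn_primitive_interval (μ := volume) (a := a) (b := b) (f := u)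
    (by rw [uIcc_of_le hab, integrableOn_Icc_iff_integrableOn_Ioc]; exact hu.integrableOn)
  rwa [uIcc_of_le hab] at this

theorem aemeasurable_enorm_sq (hu : BoundedMeasurableOn a b u) :
    AEMeasurable (fun t => ‖u t‖ₑ ^ 2) (volume.restrict (Ioc a b)) :=
  hu.1.enorm.pow_const 2

end BoundedMeasurableOn

/-- The space-time estimate, for functions which are time integrals. As in the estimate for trees,
the Cauchy-Schwarz inequality makes the function independent of the time `s` of the collision. -/
theorem lintegral_sq_sum_mul_integral_le {κ : Type*} (Z : Finset κ) {a δ C : ℝ} (hδ : 0 < δ)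
    (hC : 0 ≤ C) {A : κ → ℝ → ℂ} (hA : ∀ z, Continuous (A z)) {h : κ → ℝ → ℂ}
    (hh : ∀ z, BoundedMeasurableOn a (a + δ) (h z))
    (hST : ∀ F : κ → ℂ, ∫ s in a..(a + δ), ‖∑ z ∈ Z, A z s * F z‖ ^ 2 ≤ C * ∑ z ∈ Z, ‖F z‖ ^ 2)
    (ν : κ → ℂ) (ε : ℂ) :
    ∫⁻ s in Ioc a (a + δ), ‖∑ z ∈ Z, ν z * (A z s * (ε * ∫ τ in a..s, h z τ))‖ₑ ^ 2 ≤
      ENNReal.ofReal (‖ε‖ ^ 2 * δ * C) *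
        ∑ z ∈ Z, ‖ν z‖ₑ ^ 2 * ∫⁻ τ in Ioc a (a + δ), ‖h z τ‖ₑ ^ 2 := by
  have haδ : a ≤ a + δ := by linarith
  set μ := (volume : Measure ℝ).restrict (Ioc a (a + δ)) with hμ
  set P : ℝ → ℝ → ℂ := fun s τ => ∑ z ∈ Z, A z s * (ν z * h z τ) with hP
  have hPb : ∀ s, BoundedMeasurableOn a (a + δ) (P s) := fun s =>
    BoundedMeasurableOn.sum fun z _ => (BoundedMeasurableOn.const _).mul
      ((BoundedMeasurableOn.const _).mul (hh z))
  have hPm : AEMeasurable (Function.uncurry fun s τ => ‖P s τ‖ₑ ^ 2) (μ.prod μ) := by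
    have : AEStronglyMeasurable (Function.uncurry P) (μ.prod μ) := by
      simp only [hP, Function.uncurry_def]
      refine Finset.aestronglyMeasurable_fun_sum _ fun z _ => ?_
      exact ((hA z).comp continuous_fst).aestronglyMeasurable.mul
        (((hh z).1.comp_snd).const_mul _)
    exact this.enorm.pow_const 2
  have h1 : ∀ s ∈ Ioc a (a + δ),
      ‖∑ z ∈ Z, ν z * (A z s * (ε * ∫ τ in a..s, h z τ))‖ₑ ^ 2 ≤
        ENNReal.ofReal (‖ε‖ ^ 2 * δ) * ∫⁻ τ, ‖P s τ‖ₑ ^ 2 ∂μ := by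
    intro s hs
    have hss : IntervalIntegrable (P s) volume a s :=
      ((hPb s).intervalIntegrable haδ).mono_set (uIcc_subset_uIcc left_mem_uIcc
        (by rw [uIcc_of_le haδ]; exact Ioc_subset_Icc_self hs))
    have e : ∑ z ∈ Z, ν z * (A z s * (ε * ∫ τ in a..s, h z τ)) = ε * ∫ τ in a..s, P s τ := by
      rw [intervalIntegral.integral_finsetSum, Finset.mul_sum]
      · refine Finset.sum_congr rfl fun z _ => ?_
        rw [intervalIntegral.integral_const_mul, intervalIntegral.integral_const_mul]
        ring
      · intro z _
        refine (((hh z).intervalIntegrable haδ).mono_set (uIcc_subset_uIcc left_mem_uIcc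
          (by rw [uIcc_of_le haδ]; exact Ioc_subset_Icc_self hs))).const_mul _ |>.const_mul _
    have h2 := sq_norm_intervalIntegral_le hs.1.le hs.2 hδ ((hPb s).intervalIntegrable haδ)
      ((hPb s).intervalIntegrable_sq haδ)
    rw [e, enorm_sq_eq_ofReal, norm_mul, mul_pow]
    simp only [enorm_sq_eq_ofReal]
    rw [hμ, ← ofReal_intervalIntegral_eq_lintegral haδ ((hPb s).intervalIntegrable_sq haδ)
      (fun _ => sq_nonneg _), ← ENNReal.ofReal_mul (by positivity)]
    refine ENNReal.ofReal_le_ofReal ?_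
    rw [mul_assoc]
    gcongr
  have h3 : ∀ τ, ∫⁻ s, ‖P s τ‖ₑ ^ 2 ∂μ ≤
      ENNReal.ofReal C * ∑ z ∈ Z, ‖ν z‖ₑ ^ 2 * ‖h z τ‖ₑ ^ 2 := by
    intro τ
    have hc : Continuous fun s => P s τ :=
      continuous_finsetSum _ fun z _ => (hA z).mul continuous_const
    have h4 := hST fun z => ν z * h z τ
    simp only [enorm_sq_eq_ofReal]
    rw [hμ, ← ofReal_intervalIntegral_eq_lintegral haδ (Continuous.intervalIntegrable
      (by fun_prop) _ _) (fun _ => sq_nonneg _)]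
    refine (ENNReal.ofReal_le_ofReal h4).trans (le_of_eq ?_)
    rw [ENNReal.ofReal_mul hC, ENNReal.ofReal_sum_of_nonneg fun _ _ => sq_nonneg _]
    congr 1
    refine Finset.sum_congr rfl fun z _ => ?_
    rw [norm_mul, mul_pow, ENNReal.ofReal_mul (sq_nonneg _)]
  calc ∫⁻ s, ‖∑ z ∈ Z, ν z * (A z s * (ε * ∫ τ in a..s, h z τ))‖ₑ ^ 2 ∂μ
      ≤ ∫⁻ s, ENNReal.ofReal (‖ε‖ ^ 2 * δ) * ∫⁻ τ, ‖P s τ‖ₑ ^ 2 ∂μ ∂μ :=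
        setLIntegral_mono' measurableSet_Ioc h1
    _ = ENNReal.ofReal (‖ε‖ ^ 2 * δ) * ∫⁻ τ, ∫⁻ s, ‖P s τ‖ₑ ^ 2 ∂μ ∂μ := by
        rw [lintegral_const_mul' _ _ ENNReal.ofReal_ne_top, lintegral_lintegral_swap hPm]
    _ ≤ ENNReal.ofReal (‖ε‖ ^ 2 * δ) *
        ∫⁻ τ, ENNReal.ofReal C * ∑ z ∈ Z, ‖ν z‖ₑ ^ 2 * ‖h z τ‖ₑ ^ 2 ∂μ := by
        gcongr with τ
        exact h3 τ
    _ = _ := by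
        rw [lintegral_const_mul' _ _ ENNReal.ofReal_ne_top, ← mul_assoc,
          ← ENNReal.ofReal_mul (by positivity), lintegral_finsetSum']
        · congr 1
          refine Finset.sum_congr rfl fun z _ => ?_
          rw [lintegral_const_mul' _ _ (by finiteness)]
        · exact fun z _ => (hh z).aemeasurable_enorm_sq.const_mul _

end GPHierarchy

namespace GPHierarchy

/-! ### Collision terms as limits of finite sums -/

theorem HasSum.tendsto_finset {κ E : Type*} [AddCommMonoid E] [TopologicalSpace E] {f : κ → E}
    {x : E} (h : HasSum f x) : Tendsto (fun S : Finset κ => ∑ i ∈ S, f i) atTop (𝓝 x) := by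
  simpa [HasSum, SummationFilter.unconditional_filter] using h

theorem enorm_sub_sq_le (z w : ℂ) : ‖z - w‖ₑ ^ 2 ≤ 2 * (‖z‖ₑ ^ 2 + ‖w‖ₑ ^ 2) := by
  rw [enorm_sq_eq_ofReal, enorm_sq_eq_ofReal, enorm_sq_eq_ofReal,
    ← ENNReal.ofReal_add (sq_nonneg _) (sq_nonneg _), ← ENNReal.ofReal_ofNat,
    ← ENNReal.ofReal_mul (by norm_num)]
  refine ENNReal.ofReal_le_ofReal ?_
  linarith [sq_norm_sub_le z w]

/-- The weights of a multiplier `m` after the terms of `Z` have been subtracted. -/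
theorem sum_sub_sum_eq {m : (Fin 2 → ℤ) → ℂ} {Z W : Finset Mode} (hZ : Z ⊆ W) (G : Mode → ℂ) :
    ∑ z ∈ W, m z.2 * G z - ∑ z ∈ Z, G z =
      ∑ z ∈ W, (m z.2 - if z ∈ Z then 1 else 0) * G z := by
  classical
  simp only [sub_mul, Finset.sum_sub_distrib, ite_mul, one_mul, zero_mul]
  congr 1
  rw [← Finset.sum_filter, Finset.filter_mem_eq_inter, Finset.inter_eq_right.2 hZ]

theorem tendsto_sum_multiplier {m : ℕ → (Fin 2 → ℤ) → ℂ}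
    (hm : ∀ l, Tendsto (fun n => m n l) atTop (𝓝 1)) (Z : Finset Mode) {N : Mode → ℝ≥0∞}
    (hN : ∀ z, N z ≠ ∞) :
    Tendsto (fun n => ∑ z ∈ Z, ‖m n z.2 - 1‖ₑ ^ 2 * N z) atTop (𝓝 0) := by
  have h : ∀ z ∈ Z, Tendsto (fun n => ‖m n z.2 - 1‖ₑ ^ 2 * N z) atTop (𝓝 0) := by
    intro z _
    have h1 : Tendsto (fun n => m n z.2 - 1) atTop (𝓝 0) := by
      simpa using (hm z.2).sub_const 1
    have h2 : Tendsto (fun n => ‖m n z.2 - 1‖ₑ ^ 2) atTop (𝓝 0) := by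
      have h3 := ((ENNReal.continuous_pow 2).tendsto _).comp h1.enorm
      simpa [Function.comp_def] using h3
    simpa using ENNReal.Tendsto.mul_const h2 (Or.inr (hN z))
  simpa using tendsto_finsetSum Z h

/-- The weights inside `Z` are small once the multiplier is close to one, those outside `Z` are
bounded by one. -/
theorem sum_multiplier_le {m : (Fin 2 → ℤ) → ℂ} (hm : ∀ l, ‖m l‖ ≤ 1) (Z W : Finset Mode)
    (N : Mode → ℝ≥0∞) :
    ∑ z ∈ W, ‖m z.2 - if z ∈ Z then 1 else 0‖ₑ ^ 2 * N z ≤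
      (∑ z ∈ Z, ‖m z.2 - 1‖ₑ ^ 2 * N z) + ∑' z, if z ∈ Z then 0 else N z := by
  classical
  rw [← Finset.sum_filter_add_sum_filter_not W (· ∈ Z)]
  refine add_le_add ?_ ?_
  · calc ∑ z ∈ W with z ∈ Z, ‖m z.2 - if z ∈ Z then 1 else 0‖ₑ ^ 2 * N z
        = ∑ z ∈ W with z ∈ Z, ‖m z.2 - 1‖ₑ ^ 2 * N z :=
          Finset.sum_congr rfl fun z hz => by rw [if_pos (Finset.mem_filter.1 hz).2]
      _ ≤ _ := Finset.sum_le_sum_of_subset fun z hz => (Finset.mem_filter.1 hz).2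
  · refine le_trans (Finset.sum_le_sum fun z hz => ?_)
      (ENNReal.sum_le_tsum (W.filter fun z => z ∉ Z))
    have hz' := (Finset.mem_filter.1 hz).2
    rw [if_neg hz', if_neg hz', sub_zero]
    have : ‖m z.2‖ₑ ≤ 1 := by
      rw [← ofReal_norm]
      exact ENNReal.ofReal_le_one.2 (hm _)
    calc ‖m z.2‖ₑ ^ 2 * N z ≤ 1 ^ 2 * N z := by gcongr
      _ = N z := by rw [one_pow, one_mul]

/-- The collision term of one particle, obtained from regularized collision terms by three limits
(the two sums over the momenta, and the removal of the regularization), is approximated in `L²` in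
time by finite sums. The error is controlled by the terms which are left out: the space-time
estimate holds for all finite sums with the same constant, and Fatou's lemma carries it through the
limits. -/
theorem lintegral_collision_sub_le {a δ C : ℝ} (hδ : 0 < δ) (hC : 0 ≤ C)
    {A A' : Mode → ℝ → ℂ} (hA : ∀ z, Continuous (A z)) (hA' : ∀ z, Continuous (A' z))
    {h h' : Mode → ℝ → ℂ} (hh : ∀ z, BoundedMeasurableOn a (a + δ) (h z))
    (hh' : ∀ z, BoundedMeasurableOn a (a + δ) (h' z))
    (hST : ∀ (Z : Finset Mode) (F : Mode → ℂ),
      ∫ s in a..(a + δ), ‖∑ z ∈ Z, A z s * F z‖ ^ 2 ≤ C * ∑ z ∈ Z, ‖F z‖ ^ 2)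
    (hST' : ∀ (Z : Finset Mode) (F : Mode → ℂ),
      ∫ s in a..(a + δ), ‖∑ z ∈ Z, A' z s * F z‖ ^ 2 ≤ C * ∑ z ∈ Z, ‖F z‖ ^ 2)
    (ε : ℂ) {m m' : ℕ → (Fin 2 → ℤ) → ℂ} (hm1 : ∀ n l, ‖m n l‖ ≤ 1) (hm1' : ∀ n l, ‖m' n l‖ ≤ 1)
    (hm : ∀ l, Tendsto (fun n => m n l) atTop (𝓝 1))
    (hm' : ∀ l, Tendsto (fun n => m' n l) atTop (𝓝 1))
    {X Y : ℕ → (Fin 2 → ℤ) → ℝ → ℂ} {R : ℕ → ℝ → ℂ} {H : ℝ → ℂ}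
    (hX : ∀ n r, ∀ s ∈ Ioc a (a + δ),
      HasSum (fun l => m n l * (A (r, l) s * (ε * ∫ τ in a..s, h (r, l) τ))) (X n r s))
    (hY : ∀ n r, ∀ s ∈ Ioc a (a + δ),
      HasSum (fun l => m' n l * (A' (r, l) s * (ε * ∫ τ in a..s, h' (r, l) τ))) (Y n r s))
    (hR : ∀ n, ∀ s ∈ Ioc a (a + δ), HasSum (fun r => X n r s - Y n r s) (R n s))
    (hH : ∀ s ∈ Ioc a (a + δ), Tendsto (fun n => R n s) atTop (𝓝 (H s)))
    (Z Z' : Finset Mode) :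
    ∫⁻ s in Ioc a (a + δ), ‖H s - ((∑ z ∈ Z, A z s * (ε * ∫ τ in a..s, h z τ)) -
        ∑ z ∈ Z', A' z s * (ε * ∫ τ in a..s, h' z τ))‖ₑ ^ 2 ≤
      2 * ENNReal.ofReal (‖ε‖ ^ 2 * δ * C) *
        ((∑' z, if z ∈ Z then 0 else ∫⁻ τ in Ioc a (a + δ), ‖h z τ‖ₑ ^ 2) +
          ∑' z, if z ∈ Z' then 0 else ∫⁻ τ in Ioc a (a + δ), ‖h' z τ‖ₑ ^ 2) := by
  classical
  have haδ : a ≤ a + δ := by linarith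
  set μ := (volume : Measure ℝ).restrict (Ioc a (a + δ)) with hμ
  set N : Mode → ℝ≥0∞ := fun z => ∫⁻ τ, ‖h z τ‖ₑ ^ 2 ∂μ with hN
  set N' : Mode → ℝ≥0∞ := fun z => ∫⁻ τ, ‖h' z τ‖ₑ ^ 2 ∂μ with hN'
  have hfin : ∀ {u : ℝ → ℂ}, BoundedMeasurableOn a (a + δ) u → ∫⁻ τ, ‖u τ‖ₑ ^ 2 ∂μ ≠ ∞ := by
    intro u hu
    simp only [enorm_sq_eq_ofReal]
    rw [hμ, ← ofReal_intervalIntegral_eq_lintegral haδ (hu.intervalIntegrable_sq haδ)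
      fun _ => sq_nonneg _]
    exact ENNReal.ofReal_ne_top
  set G : Mode → ℝ → ℂ := fun z s => A z s * (ε * ∫ τ in a..s, h z τ) with hG
  set G' : Mode → ℝ → ℂ := fun z s => A' z s * (ε * ∫ τ in a..s, h' z τ) with hG'
  have hGb : ∀ z, BoundedMeasurableOn a (a + δ) (G z) := fun z =>
    (BoundedMeasurableOn.of_continuousOn (hA z).continuousOn).mul
      ((BoundedMeasurableOn.const ε).mul ((hh z).integral haδ))
  have hGb' : ∀ z, BoundedMeasurableOn a (a + δ) (G' z) := fun z =>
    (BoundedMeasurableOn.of_continuousOn (hA' z).continuousOn).mul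
      ((BoundedMeasurableOn.const ε).mul ((hh' z).integral haδ))
  set E : ℝ → ℂ := fun s => (∑ z ∈ Z, G z s) - ∑ z ∈ Z', G' z s with hE
  have hEb : BoundedMeasurableOn a (a + δ) E :=
    (BoundedMeasurableOn.sum fun z _ => hGb z).sub (BoundedMeasurableOn.sum fun z _ => hGb' z)
  set c := 2 * ENNReal.ofReal (‖ε‖ ^ 2 * δ * C) with hc
  have hctop : c ≠ ∞ := by rw [hc]; finiteness
  set T := ∑' z, if z ∈ Z then 0 else N z with hT
  set T' := ∑' z, if z ∈ Z' then 0 else N' z with hT'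
  set B : ℕ → ℝ≥0∞ := fun n => c * (((∑ z ∈ Z, ‖m n z.2 - 1‖ₑ ^ 2 * N z) + T) +
    ((∑ z ∈ Z', ‖m' n z.2 - 1‖ₑ ^ 2 * N' z) + T')) with hB
  -- The finite sums over `r ∈ P` and `l ∈ Q`.
  set U : ℕ → Finset (Fin 2 → ℤ) → Finset (Fin 2 → ℤ) → ℝ → ℂ := fun n P Q s =>
    ∑ r ∈ P, ∑ l ∈ Q, (m n l * G (r, l) s - m' n l * G' (r, l) s) - E s with hU
  have hUb : ∀ n P Q, BoundedMeasurableOn a (a + δ) (U n P Q) := fun n P Q =>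
    (BoundedMeasurableOn.sum fun r _ => BoundedMeasurableOn.sum fun l _ =>
      ((BoundedMeasurableOn.const _).mul (hGb _)).sub
        ((BoundedMeasurableOn.const _).mul (hGb' _))).sub hEb
  have hU1 : ∀ n (P Q : Finset (Fin 2 → ℤ)), Z ∪ Z' ⊆ P ×ˢ Q →
      ∫⁻ s, ‖U n P Q s‖ₑ ^ 2 ∂μ ≤ B n := by
    intro n P Q hPQ
    have e : ∀ s, U n P Q s =
        (∑ z ∈ P ×ˢ Q, (m n z.2 - if z ∈ Z then 1 else 0) * G z s) -
          ∑ z ∈ P ×ˢ Q, (m' n z.2 - if z ∈ Z' then 1 else 0) * G' z s := by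
      intro s
      rw [← sum_sub_sum_eq (Finset.union_subset_left hPQ) fun z => G z s,
        ← sum_sub_sum_eq (Finset.union_subset_right hPQ) fun z => G' z s]
      simp only [hU, hE]
      rw [← Finset.sum_product' (f := fun r l => m n l * G (r, l) s - m' n l * G' (r, l) s),
        Finset.sum_sub_distrib]
      ring
    have e1 := lintegral_sq_sum_mul_integral_le (P ×ˢ Q) hδ hC hA hh (hST _)
      (fun z => m n z.2 - if z ∈ Z then 1 else 0) ε
    have e2 := lintegral_sq_sum_mul_integral_le (P ×ˢ Q) hδ hC hA' hh' (hST' _)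
      (fun z => m' n z.2 - if z ∈ Z' then 1 else 0) ε
    calc ∫⁻ s, ‖U n P Q s‖ₑ ^ 2 ∂μ
        ≤ ∫⁻ s, 2 * (‖∑ z ∈ P ×ˢ Q, (m n z.2 - if z ∈ Z then 1 else 0) * G z s‖ₑ ^ 2 +
            ‖∑ z ∈ P ×ˢ Q, (m' n z.2 - if z ∈ Z' then 1 else 0) * G' z s‖ₑ ^ 2) ∂μ := by
          refine lintegral_mono fun s => ?_
          rw [e]
          exact enorm_sub_sq_le _ _
      _ = 2 * ((∫⁻ s, ‖∑ z ∈ P ×ˢ Q, (m n z.2 - if z ∈ Z then 1 else 0) * G z s‖ₑ ^ 2 ∂μ) +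
            ∫⁻ s, ‖∑ z ∈ P ×ˢ Q, (m' n z.2 - if z ∈ Z' then 1 else 0) * G' z s‖ₑ ^ 2 ∂μ) := by
          rw [lintegral_const_mul' _ _ (by finiteness), lintegral_add_left']
          exact BoundedMeasurableOn.aemeasurable_enorm_sq
            (BoundedMeasurableOn.sum fun z _ => (BoundedMeasurableOn.const _).mul (hGb z))
      _ ≤ 2 * (ENNReal.ofReal (‖ε‖ ^ 2 * δ * C) * ((∑ z ∈ Z, ‖m n z.2 - 1‖ₑ ^ 2 * N z) + T) +
            ENNReal.ofReal (‖ε‖ ^ 2 * δ * C) *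
              ((∑ z ∈ Z', ‖m' n z.2 - 1‖ₑ ^ 2 * N' z) + T')) := by
          gcongr
          · exact e1.trans (mul_le_mul_right (sum_multiplier_le (hm1 n) Z _ N) _)
          · exact e2.trans (mul_le_mul_right (sum_multiplier_le (hm1' n) Z' _ N') _)
      _ = B n := by
          rw [← mul_add, ← mul_assoc]
  -- The sum over `l`.
  set V : ℕ → Finset (Fin 2 → ℤ) → ℝ → ℂ := fun n P s =>
    ∑ r ∈ P, (X n r s - Y n r s) - E s with hV
  have hUV : ∀ n P, ∀ᵐ s ∂μ, Tendsto (fun Q => U n P Q s) atTop (𝓝 (V n P s)) := by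
    intro n P
    refine (ae_restrict_iff' measurableSet_Ioc).2 (Eventually.of_forall fun s hs => ?_)
    refine Tendsto.sub_const ?_ _
    exact tendsto_finsetSum _ fun r _ => HasSum.tendsto_finset ((hX n r s hs).sub (hY n r s hs))
  have hVm : ∀ n P, AEMeasurable (V n P) μ := fun n P =>
    aemeasurable_of_tendsto_metrizable_ae atTop (fun Q => (hUb n P Q).1.aemeasurable) (hUV n P)
  have henorm : ∀ {κ : Type} {l : Filter κ} {u : κ → ℂ} {z : ℂ}, Tendsto u l (𝓝 z) →
      Tendsto (fun i => ‖u i‖ₑ ^ 2) l (𝓝 (‖z‖ₑ ^ 2)) := fun hu =>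
    (ENNReal.continuous_pow 2).tendsto _ |>.comp hu.enorm
  have hV1 : ∀ n (P : Finset (Fin 2 → ℤ)), (Z ∪ Z').image Prod.fst ⊆ P →
      ∫⁻ s, ‖V n P s‖ₑ ^ 2 ∂μ ≤ B n := by
    intro n P hP
    refine lintegral_le_of_tendsto_of_le (l := atTop) (f := fun Q s => ‖U n P Q s‖ₑ ^ 2)
      (B := fun _ => B n) (fun Q => (hUb n P Q).aemeasurable_enorm_sq) ?_ ?_ tendsto_const_nhds
    · filter_upwards [hUV n P] with s hs
      exact henorm hs
    · filter_upwards [eventually_ge_atTop ((Z ∪ Z').image Prod.snd)] with Q hQ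
      refine hU1 n P Q fun z hz => Finset.mem_product.2
        ⟨hP (Finset.mem_image_of_mem _ hz), hQ (Finset.mem_image_of_mem _ hz)⟩
  -- The sum over `r`.
  have hVR : ∀ n, ∀ᵐ s ∂μ, Tendsto (fun P => V n P s) atTop (𝓝 (R n s - E s)) := by
    intro n
    refine (ae_restrict_iff' measurableSet_Ioc).2 (Eventually.of_forall fun s hs => ?_)
    exact Tendsto.sub_const (HasSum.tendsto_finset (hR n s hs)) _
  have hRm : ∀ n, AEMeasurable (fun s => R n s - E s) μ := fun n =>
    aemeasurable_of_tendsto_metrizable_ae atTop (fun P => hVm n P) (hVR n)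
  have hR1 : ∀ n, ∫⁻ s, ‖R n s - E s‖ₑ ^ 2 ∂μ ≤ B n := by
    intro n
    refine lintegral_le_of_tendsto_of_le (l := atTop) (f := fun P s => ‖V n P s‖ₑ ^ 2)
      (B := fun _ => B n) (fun P => (hVm n P).enorm.pow_const 2) ?_ ?_ tendsto_const_nhds
    · filter_upwards [hVR n] with s hs
      exact henorm hs
    · filter_upwards [eventually_ge_atTop ((Z ∪ Z').image Prod.fst)] with P hP
      exact hV1 n P hP
  -- The removal of the regularization.
  refine lintegral_le_of_tendsto_of_le (l := atTop) (f := fun n s => ‖R n s - E s‖ₑ ^ 2) (B := B)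
    (fun n => (hRm n).enorm.pow_const 2) ?_ (Eventually.of_forall hR1) ?_
  · refine (ae_restrict_iff' measurableSet_Ioc).2 (Eventually.of_forall fun s hs => ?_)
    exact henorm ((hH s hs).sub_const _)
  · have h1 := (tendsto_sum_multiplier hm Z (N := N) fun z => hfin (hh z)).add_const T
    have h2 := (tendsto_sum_multiplier hm' Z' (N := N') fun z => hfin (hh' z)).add_const T'
    rw [zero_add] at h1 h2
    exact ENNReal.Tendsto.const_mul (h1.add h2) (Or.inr hctop)

end GPHierarchy

namespace GPHierarchy

/-! ### The truncation error -/

/-- The list `l` with its entry number `j` replaced by the two entries of `p`. -/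
def replacePair (l : List Mode) (j : ℕ) (p : Mode × Mode) : List Mode :=
  l.take j ++ p.1 :: p.2 :: l.drop (j + 1)

theorem length_replacePair {l : List Mode} {j : ℕ} (hj : j < l.length) (p : Mode × Mode) :
    (replacePair l j p).length = l.length + 1 := by
  simp only [replacePair, List.length_append, List.length_take, List.length_cons, List.length_drop]
  omega

theorem replacePair_inj {l l' : List Mode} {j : ℕ} (hj : j < l.length) (hj' : j < l'.length)
    {p p' : Mode × Mode} (h : replacePair l j p = replacePair l' j p') :
    l.take j = l'.take j ∧ p = p' ∧ l.drop (j + 1) = l'.drop (j + 1) := by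
  have := List.append_inj h (by simp; omega)
  obtain ⟨h1, h2⟩ := this
  simp only [List.cons.injEq] at h2
  exact ⟨h1, Prod.ext h2.1 h2.2.1, h2.2.2⟩

/-- Lists of `n` modes together with the parameter of a pair are determined by the list in which
the entry number `j` is replaced by the pair. -/
theorem injective_replacePair {P : Mode → Mode → Mode × Mode}
    (hP : Function.Injective fun p : Mode × Mode => P p.1 p.2) {l l' : List Mode} {j : ℕ}
    (hj : j < l.length) (hj' : j < l'.length) {z z' : Mode}
    (h : replacePair l j (P l[j] z) = replacePair l' j (P l'[j] z')) : l = l' ∧ z = z' := by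
  obtain ⟨h1, h2, h3⟩ := replacePair_inj hj hj' h
  have h4 := @hP (l[j], z) (l'[j], z') h2
  simp only [Prod.mk.injEq] at h4
  refine ⟨?_, h4.2⟩
  rw [← List.take_append_drop j l, ← List.take_append_drop j l', h1,
    List.drop_eq_getElem_cons hj, List.drop_eq_getElem_cons hj', h3, h4.1]

/-- The part of the sum of `N` over the lists of length `n` which is not carried by `K`. -/
noncomputable def listTail (K : Finset Mode) (n : ℕ) (N : List Mode → ℝ≥0∞) : ℝ≥0∞ :=
  open Classical in ∑' l : List Mode, if l.length = n ∧ l ∉ listsOf K n then N l else 0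

/-- A pair which does not belong to `K × K` leads to a list which is not carried by `K`, and
different lists and pairs lead to different lists. -/
theorem sum_tsum_replacePair_le {P : Mode → Mode → Mode × Mode}
    (hP : Function.Injective fun p : Mode × Mode => P p.1 p.2) (K : Finset Mode)
    {k j : ℕ} (hj : j < k) (Z : Mode → Finset Mode) (hZ : ∀ q z, z ∉ Z q → P q z ∉ K ×ˢ K)
    (N : List Mode → ℝ≥0∞) :
    ∑ l ∈ listsOf K k, ∑' z, (if z ∈ Z (l.getD j 0) then 0 else
      N (replacePair l j (P (l.getD j 0) z))) ≤ listTail K (k + 1) N := by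
  classical
  set Φ : {l // l ∈ listsOf K k} × Mode → List Mode :=
    fun p => replacePair p.1.1 j (P (p.1.1.getD j 0) p.2) with hΦ
  have hlen : ∀ l : {l // l ∈ listsOf K k}, j < l.1.length := fun l => by
    rw [length_of_mem_listsOf l.2]; exact hj
  have hget : ∀ l : {l // l ∈ listsOf K k}, l.1.getD j 0 = l.1[j]'(hlen l) := fun l =>
    List.getD_eq_getElem _ _ (hlen l)
  have hinj : Function.Injective Φ := by
    rintro ⟨l, z⟩ ⟨l', z'⟩ h
    simp only [hΦ, hget] at h
    obtain ⟨h1, h2⟩ := injective_replacePair hP (hlen l) (hlen l') h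
    exact Prod.ext (Subtype.ext h1) h2
  rw [← Finset.sum_attach, listTail]
  calc _ = ∑' l : {l // l ∈ listsOf K k}, ∑' z, (if z ∈ Z (l.1.getD j 0) then 0 else
        N (replacePair l.1 j (P (l.1.getD j 0) z))) := by
        rw [tsum_fintype, Finset.univ_eq_attach]
    _ = ∑' p : {l // l ∈ listsOf K k} × Mode, (if p.2 ∈ Z (p.1.1.getD j 0) then 0 else
        N (Φ p)) := by rw [ENNReal.tsum_prod']
    _ ≤ ∑' p : {l // l ∈ listsOf K k} × Mode,
        (fun l => if l.length = k + 1 ∧ l ∉ listsOf K (k + 1) then N l else 0) (Φ p) := by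
      refine ENNReal.tsum_le_tsum fun p => ?_
      by_cases h1 : p.2 ∈ Z (p.1.1.getD j 0)
      · rw [if_pos h1]
        exact bot_le
      have h3 : (Φ p).length = k + 1 := by
        rw [hΦ, length_replacePair (hlen p.1), length_of_mem_listsOf p.1.2]
      have h4 : Φ p ∉ listsOf K (k + 1) := by
        intro h4
        have h5 := (mem_listsOf.1 h4).2
        refine hZ _ _ h1 (Finset.mem_product.2 ⟨h5 _ ?_, h5 _ ?_⟩) <;> simp [hΦ, replacePair]
      rw [if_neg h1]
      exact (if_pos ⟨h3, h4⟩).ge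
    _ ≤ _ := ENNReal.tsum_comp_le_tsum_of_injective hinj _

/-- The tail of a summable function vanishes as `K` increases: a finite set of lists of length `n`
which carries the sum up to `ε` involves finitely many modes only. -/
theorem tendsto_listTail {n : ℕ} {N : List Mode → ℝ≥0∞} {B : ℝ≥0∞} (hB : B ≠ ∞)
    (hN : ∀ S : Finset (List Mode), (∀ l ∈ S, l.length = n) → ∑ l ∈ S, N l ≤ B) :
    Tendsto (fun K => listTail K n N) atTop (𝓝 0) := by
  classical
  set f : List Mode → ℝ≥0∞ := fun l => if l.length = n then N l else 0 with hf
  have hfB : ∑' l, f l ≤ B := by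
    rw [ENNReal.tsum_eq_iSup_sum]
    refine iSup_le fun S => ?_
    rw [hf, ← Finset.sum_filter]
    exact hN _ fun l hl => (Finset.mem_filter.1 hl).2
  have h1 := ENNReal.tendsto_tsum_compl_atTop_zero (ne_top_of_le_ne_top hB hfB)
  rw [ENNReal.tendsto_nhds_zero] at h1 ⊢
  intro ε hε
  obtain ⟨S, hS⟩ := (h1 ε hε).exists
  filter_upwards [eventually_ge_atTop (S.biUnion fun l => l.toFinset)] with K hK
  refine le_trans ?_ hS
  refine le_of_le_of_eq ?_ (tsum_subtype {l | l ∉ S} f).symm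
  rw [listTail]
  refine ENNReal.tsum_le_tsum fun l => ?_
  split_ifs with h2
  · have : l ∈ {l | l ∉ S} := by
      intro hl
      refine h2.2 (mem_listsOf.2 ⟨h2.1, fun x hx => hK ?_⟩)
      exact Finset.mem_biUnion.2 ⟨l, hl, List.mem_toFinset.2 hx⟩
    rw [indicator_of_mem this, hf]
    simp [h2.1]
  · exact bot_le

/-- The space-time estimate for the two terms of the collision operator on time intervals of length
`δ`, with constant `C`. -/
def PairEstimate (L α δ C : ℝ) : Prop :=
  ∀ (q : Mode) (Z : Finset Mode) (F : Mode → ℂ) (s : ℝ),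
    (∫ t in s..(s + δ), ‖∑ z ∈ Z,
        collisionAmp L α t q (leftPair q z).1 (leftPair q z).2 * F z‖ ^ 2 ≤
      C * ∑ z ∈ Z, ‖F z‖ ^ 2) ∧
    (∫ t in s..(s + δ), ‖∑ z ∈ Z,
        collisionAmp L α t q (rightPair q z).1 (rightPair q z).2 * F z‖ ^ 2 ≤
      C * ∑ z ∈ Z, ‖F z‖ ^ 2)

/-- A family `h`, indexed by lists of modes, which on `[a, a + δ]` satisfies the hierarchy
`h(s, l) = ε ∑ⱼ (collision of the particle j)(∫ₐˢ h)`, where the infinite sums over the momenta in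
the collision operator are understood as iterated limits: the sum over the momentum `z.2` which is
exchanged, with multipliers `m`, `m'`, then the sum over the momentum `z.1` of the particle which
is traced out, then the limit in which the multipliers tend to one. -/
structure IsHierarchyFamily (L α a δ : ℝ) (ε : ℂ) (m m' : ℕ → (Fin 2 → ℤ) → ℂ)
    (h : ℝ → List Mode → ℂ) : Prop where
  boundedMeasurable : ∀ l, BoundedMeasurableOn a (a + δ) fun s => h s l
  collision : ∀ l : List Mode, ∃ H : Fin l.length → ℝ → ℂ,
    (∀ s ∈ Ioc a (a + δ), h s l = ∑ j, H j s) ∧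
    ∀ j : Fin l.length, ∃ (X Y : ℕ → (Fin 2 → ℤ) → ℝ → ℂ) (R : ℕ → ℝ → ℂ),
      (∀ n r, ∀ s ∈ Ioc a (a + δ), HasSum (fun p => m n p *
        (collisionAmp L α s (l.get j) (leftPair (l.get j) (r, p)).1 (leftPair (l.get j) (r, p)).2 *
          (ε * ∫ τ in a..s, h τ (replacePair l j (leftPair (l.get j) (r, p)))))) (X n r s)) ∧
      (∀ n r, ∀ s ∈ Ioc a (a + δ), HasSum (fun p => m' n p *
        (collisionAmp L α s (l.get j) (rightPair (l.get j) (r, p)).1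
            (rightPair (l.get j) (r, p)).2 *
          (ε * ∫ τ in a..s, h τ (replacePair l j (rightPair (l.get j) (r, p)))))) (Y n r s)) ∧
      (∀ n, ∀ s ∈ Ioc a (a + δ), HasSum (fun r => X n r s - Y n r s) (R n s)) ∧
      ∀ s ∈ Ioc a (a + δ), Tendsto (fun n => R n s) atTop (𝓝 (H j s))

theorem enorm_sum_sq_le {κ : Type*} (S : Finset κ) (f : κ → ℂ) :
    ‖∑ i ∈ S, f i‖ₑ ^ 2 ≤ S.card * ∑ i ∈ S, ‖f i‖ₑ ^ 2 := by
  simp only [enorm_sq_eq_ofReal]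
  rw [← ENNReal.ofReal_sum_of_nonneg fun _ _ => sq_nonneg _, ← ENNReal.ofReal_natCast,
    ← ENNReal.ofReal_mul (Nat.cast_nonneg _)]
  refine ENNReal.ofReal_le_ofReal ?_
  calc ‖∑ i ∈ S, f i‖ ^ 2 ≤ (∑ i ∈ S, ‖f i‖) ^ 2 := by gcongr; exact norm_sum_le _ _
    _ ≤ _ := sq_sum_le_card_mul_sum_sq

theorem aemeasurable_of_hasSum {κ : Type*} [Countable κ] {a b : ℝ} {f : κ → ℝ → ℂ} {X : ℝ → ℂ}
    (hf : ∀ i, AEMeasurable (f i) (volume.restrict (Ioc a b)))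
    (h : ∀ s ∈ Ioc a b, HasSum (fun i => f i s) (X s)) :
    AEMeasurable X (volume.restrict (Ioc a b)) :=
  aemeasurable_of_tendsto_metrizable_ae atTop
    (fun S : Finset κ => Finset.aemeasurable_fun_sum S fun i _ => hf i)
    ((ae_restrict_iff' measurableSet_Ioc).2 (Eventually.of_forall fun s hs =>
      HasSum.tendsto_finset (h s hs)))

namespace IsHierarchyFamily

variable {L α a δ C : ℝ} {ε : ℂ} {m m' : ℕ → (Fin 2 → ℤ) → ℂ} {h : ℝ → List Mode → ℂ}

theorem boundedMeasurable_duhamelError (hf : IsHierarchyFamily L α a δ ε m m' h) (hδ : 0 < δ)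
    (K : Finset Mode) (l : List Mode) :
    BoundedMeasurableOn a (a + δ) fun s => duhamelError K (collisionKernel L α) ε a h s l := by
  unfold duhamelError hierarchyOp
  refine (hf.boundedMeasurable l).sub ((BoundedMeasurableOn.const ε).mul ?_)
  refine BoundedMeasurableOn.sum fun i _ => BoundedMeasurableOn.sum fun x _ =>
    BoundedMeasurableOn.sum fun y _ => BoundedMeasurableOn.mul
      (BoundedMeasurableOn.of_continuousOn
        (continuous_collisionKernel L α _ _ _).continuousOn)
      ((hf.boundedMeasurable _).integral (by linarith))

theorem duhamelError_eq_sum (K : Finset Mode) (l : List Mode) {s : ℝ}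
    {H : Fin l.length → ℝ → ℂ} (hH : h s l = ∑ j, H j s) :
    duhamelError K (collisionKernel L α) ε a h s l =
      ∑ j : Fin l.length, (H j s -
        ((∑ z ∈ leftSet K (l.get j), collisionAmp L α s (l.get j) (leftPair (l.get j) z).1
            (leftPair (l.get j) z).2 *
            (ε * ∫ τ in a..s, h τ (replacePair l j (leftPair (l.get j) z)))) -
          ∑ z ∈ rightSet K (l.get j), collisionAmp L α s (l.get j) (rightPair (l.get j) z).1
            (rightPair (l.get j) z).2 *
            (ε * ∫ τ in a..s, h τ (replacePair l j (rightPair (l.get j) z))))) := by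
  unfold duhamelError hierarchyOp
  rw [Finset.sum_sub_distrib, hH, Finset.mul_sum]
  congr 1
  refine Finset.sum_congr rfl fun j _ => ?_
  rw [sum_collisionKernel K s (l.get j)
    fun x y => ∫ τ in a..s, h τ (l.take j ++ x :: y :: l.drop (j + 1)), mul_sub,
    Finset.mul_sum, Finset.mul_sum]
  congr 1 <;> refine Finset.sum_congr rfl fun z _ => ?_ <;> rw [replacePair] <;> ring

/-- The truncation error for one list, as a sum over the particles of the terms left out. -/
theorem lintegral_duhamelError_le (hf : IsHierarchyFamily L α a δ ε m m' h) (hδ : 0 < δ)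
    (hC : 0 ≤ C) (hST : PairEstimate L α δ C) (hm1 : ∀ n l, ‖m n l‖ ≤ 1)
    (hm1' : ∀ n l, ‖m' n l‖ ≤ 1) (hm : ∀ l, Tendsto (fun n => m n l) atTop (𝓝 1))
    (hm' : ∀ l, Tendsto (fun n => m' n l) atTop (𝓝 1)) (K : Finset Mode) (l : List Mode) :
    ∫⁻ s in Ioc a (a + δ), ‖duhamelError K (collisionKernel L α) ε a h s l‖ₑ ^ 2 ≤
      l.length * ∑ j : Fin l.length, 2 * ENNReal.ofReal (‖ε‖ ^ 2 * δ * C) *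
        ((∑' z, if z ∈ leftSet K (l.get j) then 0 else
            ∫⁻ τ in Ioc a (a + δ), ‖h τ (replacePair l j (leftPair (l.get j) z))‖ₑ ^ 2) +
          ∑' z, if z ∈ rightSet K (l.get j) then 0 else
            ∫⁻ τ in Ioc a (a + δ), ‖h τ (replacePair l j (rightPair (l.get j) z))‖ₑ ^ 2) := by
  obtain ⟨H, hH, hcol⟩ := hf.collision l
  have hA : ∀ (P : Mode → Mode × Mode) (q : Mode) (z : Mode),
      Continuous fun s => collisionAmp L α s q (P z).1 (P z).2 := fun P q z =>
    continuous_collisionAmp L α _ _ _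
  have hg : ∀ (P : Mode → Mode × Mode) (q : Mode) (z : Mode) (l : List Mode) (j : ℕ),
      BoundedMeasurableOn a (a + δ) fun s => collisionAmp L α s q (P z).1 (P z).2 *
        (ε * ∫ τ in a..s, h τ (replacePair l j (P z))) := fun P q z l j =>
    (BoundedMeasurableOn.of_continuousOn (hA P q z).continuousOn).mul
      ((BoundedMeasurableOn.const ε).mul ((hf.boundedMeasurable _).integral (by linarith)))
  set E : Fin l.length → ℝ → ℂ := fun j s => H j s -
        ((∑ z ∈ leftSet K (l.get j), collisionAmp L α s (l.get j) (leftPair (l.get j) z).1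
            (leftPair (l.get j) z).2 *
            (ε * ∫ τ in a..s, h τ (replacePair l j (leftPair (l.get j) z)))) -
          ∑ z ∈ rightSet K (l.get j), collisionAmp L α s (l.get j) (rightPair (l.get j) z).1
            (rightPair (l.get j) z).2 *
            (ε * ∫ τ in a..s, h τ (replacePair l j (rightPair (l.get j) z)))) with hE
  -- the collision terms are measurable as iterated limits of continuous functions
  have hEm : ∀ j, AEMeasurable (E j) (volume.restrict (Ioc a (a + δ))) := by
    intro j
    obtain ⟨X, Y, R, hX, hY, hR, hlim⟩ := hcol j
    have e : ∀ᵐ s ∂volume.restrict (Ioc a (a + δ)),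
        Tendsto (fun n => R n s) atTop (𝓝 (H j s)) :=
      (ae_restrict_iff' measurableSet_Ioc).2 (Eventually.of_forall hlim)
    have hXm : ∀ n r, AEMeasurable (X n r) (volume.restrict (Ioc a (a + δ))) := fun n r =>
      aemeasurable_of_hasSum (fun p => ((BoundedMeasurableOn.const (m n p)).mul
        (hg (leftPair (l.get j)) (l.get j) (r, p) l j)).1.aemeasurable) (hX n r)
    have hYm : ∀ n r, AEMeasurable (Y n r) (volume.restrict (Ioc a (a + δ))) := fun n r =>
      aemeasurable_of_hasSum (fun p => ((BoundedMeasurableOn.const (m' n p)).mul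
        (hg (rightPair (l.get j)) (l.get j) (r, p) l j)).1.aemeasurable) (hY n r)
    have hRm : ∀ n, AEMeasurable (R n) (volume.restrict (Ioc a (a + δ))) := fun n =>
      aemeasurable_of_hasSum (fun r => (hXm n r).sub (hYm n r)) (hR n)
    exact (aemeasurable_of_tendsto_metrizable_ae atTop hRm e).sub
      ((BoundedMeasurableOn.sum fun z _ => hg (leftPair (l.get j)) (l.get j) z l j).sub
        (BoundedMeasurableOn.sum fun z _ =>
          hg (rightPair (l.get j)) (l.get j) z l j)).1.aemeasurable
  calc ∫⁻ s in Ioc a (a + δ), ‖duhamelError K (collisionKernel L α) ε a h s l‖ₑ ^ 2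
      ≤ ∫⁻ s in Ioc a (a + δ), l.length * ∑ j, ‖E j s‖ₑ ^ 2 := by
        refine setLIntegral_mono' measurableSet_Ioc fun s hs => ?_
        rw [duhamelError_eq_sum K l (hH s hs)]
        refine (enorm_sum_sq_le Finset.univ fun j => E j s).trans (le_of_eq ?_)
        rw [Finset.card_univ, Fintype.card_fin]
    _ = l.length * ∑ j, ∫⁻ s in Ioc a (a + δ), ‖E j s‖ₑ ^ 2 := by
        rw [lintegral_const_mul' _ _ (ENNReal.natCast_ne_top _), lintegral_finsetSum']
        exact fun j _ => (hEm j).enorm.pow_const 2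
    _ ≤ _ := by
        gcongr with j
        obtain ⟨X, Y, R, hX, hY, hR, hlim⟩ := hcol j
        exact lintegral_collision_sub_le hδ hC (hA (leftPair (l.get j)) (l.get j))
          (hA (rightPair (l.get j)) (l.get j))
          (h := fun z τ => h τ (replacePair l j (leftPair (l.get j) z)))
          (h' := fun z τ => h τ (replacePair l j (rightPair (l.get j) z)))
          (fun z => hf.boundedMeasurable _) (fun z => hf.boundedMeasurable _)
          (fun Z F => (hST _ Z F a).1) (fun Z F => (hST _ Z F a).2) ε hm1 hm1' hm hm' hX hY hR
          hlim _ _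

/-- The error made by restricting the sums in the collision operator to the finite set `K` is
controlled by the tail of the square integrable family `h`. -/
theorem sum_lintegral_duhamelError_le (hf : IsHierarchyFamily L α a δ ε m m' h) (hδ : 0 < δ)
    (hC : 0 ≤ C) (hST : PairEstimate L α δ C) (hm1 : ∀ n l, ‖m n l‖ ≤ 1)
    (hm1' : ∀ n l, ‖m' n l‖ ≤ 1) (hm : ∀ l, Tendsto (fun n => m n l) atTop (𝓝 1))
    (hm' : ∀ l, Tendsto (fun n => m' n l) atTop (𝓝 1)) (K : Finset Mode) (k : ℕ) :
    ∑ l ∈ listsOf K k, ∫⁻ s in Ioc a (a + δ),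
        ‖duhamelError K (collisionKernel L α) ε a h s l‖ₑ ^ 2 ≤
      k * (k * (2 * ENNReal.ofReal (‖ε‖ ^ 2 * δ * C) *
        (2 * listTail K (k + 1) fun l => ∫⁻ τ in Ioc a (a + δ), ‖h τ l‖ₑ ^ 2))) := by
  set N : List Mode → ℝ≥0∞ := fun l => ∫⁻ τ in Ioc a (a + δ), ‖h τ l‖ₑ ^ 2 with hN
  set c := 2 * ENNReal.ofReal (‖ε‖ ^ 2 * δ * C) with hc
  have h1 : ∀ l ∈ listsOf K k, ∫⁻ s in Ioc a (a + δ),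
      ‖duhamelError K (collisionKernel L α) ε a h s l‖ₑ ^ 2 ≤
        k * ∑ j ∈ Finset.range k, c *
        ((∑' z, if z ∈ leftSet K (l.getD j 0) then 0 else
            N (replacePair l j (leftPair (l.getD j 0) z))) +
          ∑' z, if z ∈ rightSet K (l.getD j 0) then 0 else
            N (replacePair l j (rightPair (l.getD j 0) z))) := by
    intro l hl
    refine (hf.lintegral_duhamelError_le hδ hC hST hm1 hm1' hm hm' K l).trans (le_of_eq ?_)
    have hlen := length_of_mem_listsOf hl
    rw [← hlen, ← Fin.sum_univ_eq_sum_range (fun j => c *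
        ((∑' z, if z ∈ leftSet K (l.getD j 0) then 0 else
            N (replacePair l j (leftPair (l.getD j 0) z))) +
          ∑' z, if z ∈ rightSet K (l.getD j 0) then 0 else
            N (replacePair l j (rightPair (l.getD j 0) z)))) l.length]
    congr 1
    refine Finset.sum_congr rfl fun j _ => ?_
    have : l.getD j 0 = l.get j := by simp
    rw [this]
  calc _ ≤ ∑ l ∈ listsOf K k, k * ∑ j ∈ Finset.range k, c *
        ((∑' z, if z ∈ leftSet K (l.getD j 0) then 0 else
            N (replacePair l j (leftPair (l.getD j 0) z))) +
          ∑' z, if z ∈ rightSet K (l.getD j 0) then 0 else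
            N (replacePair l j (rightPair (l.getD j 0) z))) := Finset.sum_le_sum h1
    _ = k * ∑ j ∈ Finset.range k, c *
        ((∑ l ∈ listsOf K k, ∑' z, if z ∈ leftSet K (l.getD j 0) then 0 else
            N (replacePair l j (leftPair (l.getD j 0) z))) +
          ∑ l ∈ listsOf K k, ∑' z, if z ∈ rightSet K (l.getD j 0) then 0 else
            N (replacePair l j (rightPair (l.getD j 0) z))) := by
        rw [← Finset.mul_sum, Finset.sum_comm]
        simp only [← Finset.mul_sum, Finset.sum_add_distrib]
    _ ≤ k * ∑ j ∈ Finset.range k, c * (2 * listTail K (k + 1) N) := by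
        gcongr with j hj
        rw [two_mul]
        exact add_le_add
          (sum_tsum_replacePair_le leftPair_injective K (Finset.mem_range.1 hj) (leftSet K)
            (fun q z hz h => hz (Finset.mem_preimage.2 h)) N)
          (sum_tsum_replacePair_le rightPair_injective K (Finset.mem_range.1 hj) (rightSet K)
            (fun q z hz h => hz (Finset.mem_preimage.2 h)) N)
    _ = _ := by
        rw [Finset.sum_const, Finset.card_range, nsmul_eq_mul]

end IsHierarchyFamily

end GPHierarchy

namespace GPHierarchy

/-! ### Uniqueness on short time intervals -/

theorem ofReal_integral_sum_sq {κ : Type*} {a b : ℝ} (hab : a ≤ b) {f : ℝ → κ → ℂ}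
    (hf : ∀ i, BoundedMeasurableOn a b fun s => f s i) (S : Finset κ) :
    ENNReal.ofReal (∫ s in a..b, ∑ i ∈ S, ‖f s i‖ ^ 2) =
      ∑ i ∈ S, ∫⁻ s in Ioc a b, ‖f s i‖ₑ ^ 2 := by
  rw [intervalIntegral.integral_finsetSum fun i _ => (hf i).intervalIntegrable_sq hab,
    ENNReal.ofReal_sum_of_nonneg fun i _ =>
      intervalIntegral.integral_nonneg hab fun _ _ => sq_nonneg _]
  refine Finset.sum_congr rfl fun i _ => ?_
  simp only [enorm_sq_eq_ofReal]
  exact ofReal_intervalIntegral_eq_lintegral hab ((hf i).intervalIntegrable_sq hab)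
    fun _ => sq_nonneg _

theorem tendsto_zero_of_ofReal_le {κ : Type*} {l : Filter κ} {x : κ → ℝ} {B : κ → ℝ≥0∞}
    (hx : ∀ i, 0 ≤ x i) (h : ∀ i, ENNReal.ofReal (x i) ≤ B i) (hB : Tendsto B l (𝓝 0)) :
    Tendsto x l (𝓝 0) := by
  have h1 : Tendsto (fun i => ENNReal.ofReal (x i)) l (𝓝 0) :=
    tendsto_of_tendsto_of_tendsto_of_le_of_le tendsto_const_nhds hB (fun _ => bot_le) h
  have h2 := (ENNReal.tendsto_toReal ENNReal.zero_ne_top).comp h1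
  refine h2.congr fun i => ?_
  exact ENNReal.toReal_ofReal (hx i)

namespace IsHierarchyFamily

variable {L α a δ C : ℝ} {ε : ℂ} {m m' : ℕ → (Fin 2 → ℤ) → ℂ} {h : ℝ → List Mode → ℂ}

/-- The error made by restricting the sums in the collision operator to a finite set of modes tends
to zero as this set increases. -/
theorem tendsto_integral_duhamelError (hf : IsHierarchyFamily L α a δ ε m m' h) (hδ : 0 < δ)
    (hC : 0 ≤ C) (hST : PairEstimate L α δ C) (hm1 : ∀ n l, ‖m n l‖ ≤ 1)
    (hm1' : ∀ n l, ‖m' n l‖ ≤ 1) (hm : ∀ l, Tendsto (fun n => m n l) atTop (𝓝 1))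
    (hm' : ∀ l, Tendsto (fun n => m' n l) atTop (𝓝 1)) {M : ℝ}
    (hM : ∀ k (S : Finset (List Mode)), (∀ l ∈ S, l.length = k) → ∀ s ∈ Ioc a (a + δ),
      ∑ l ∈ S, ‖h s l‖ ^ 2 ≤ (M ^ k) ^ 2) (k : ℕ) :
    Tendsto (fun K => ∫ s in a..(a + δ), ∑ l ∈ listsOf K k,
      ‖duhamelError K (collisionKernel L α) ε a h s l‖ ^ 2) atTop (𝓝 0) := by
  have haδ : a ≤ a + δ := by linarith
  have htail : Tendsto (fun K => listTail K (k + 1) fun l =>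
      ∫⁻ τ in Ioc a (a + δ), ‖h τ l‖ₑ ^ 2) atTop (𝓝 0) := by
    refine tendsto_listTail (B := ENNReal.ofReal (δ * (M ^ (k + 1)) ^ 2)) ENNReal.ofReal_ne_top
      fun S hS => ?_
    rw [← ofReal_integral_sum_sq haδ hf.boundedMeasurable S]
    refine ENNReal.ofReal_le_ofReal ?_
    calc ∫ s in a..(a + δ), ∑ l ∈ S, ‖h s l‖ ^ 2
        ≤ ∫ _ in a..(a + δ), (M ^ (k + 1)) ^ 2 := by
          refine intervalIntegral.integral_mono_on_of_le_Ioo haδ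
            (intervalIntegrable_finsetSum fun l _ =>
              (hf.boundedMeasurable l).intervalIntegrable_sq haδ)
            intervalIntegrable_const fun s hs => ?_
          exact hM _ S hS s (Ioo_subset_Ioc_self hs)
      _ = δ * (M ^ (k + 1)) ^ 2 := by simp
  refine tendsto_zero_of_ofReal_le
    (fun K => intervalIntegral.integral_nonneg haδ fun _ _ =>
      Finset.sum_nonneg fun _ _ => sq_nonneg _)
    (fun K => ?_) (B := fun K => k * (k * (2 * ENNReal.ofReal (‖ε‖ ^ 2 * δ * C) *
        (2 * listTail K (k + 1) fun l => ∫⁻ τ in Ioc a (a + δ), ‖h τ l‖ₑ ^ 2)))) ?_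
  · rw [ofReal_integral_sum_sq haδ (hf.boundedMeasurable_duhamelError hδ K)]
    exact hf.sum_lintegral_duhamelError_le hδ hC hST hm1 hm1' hm hm' K k
  · have h2 : (2 : ℝ≥0∞) * ENNReal.ofReal (‖ε‖ ^ 2 * δ * C) ≠ ∞ := by finiteness
    have := ENNReal.Tendsto.const_mul (a := (k : ℝ≥0∞))
      (ENNReal.Tendsto.const_mul (a := (k : ℝ≥0∞))
        (ENNReal.Tendsto.const_mul (a := 2 * ENNReal.ofReal (‖ε‖ ^ 2 * δ * C))
        (ENNReal.Tendsto.const_mul (a := 2) htail (Or.inr (by finiteness))) (Or.inr h2))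
      (Or.inr (by finiteness))) (Or.inr (by finiteness))
    simpa using this

/-- On short time intervals, the time integrals of a hierarchy family of at most exponential growth
vanish. -/
theorem integral_eq_zero (hf : IsHierarchyFamily L α a δ ε m m' h) (hδ : 0 < δ)
    (hC : 0 ≤ C) (hST : PairEstimate L α δ C) (hm1 : ∀ n l, ‖m n l‖ ≤ 1)
    (hm1' : ∀ n l, ‖m' n l‖ ≤ 1) (hm : ∀ l, Tendsto (fun n => m n l) atTop (𝓝 1))
    (hm' : ∀ l, Tendsto (fun n => m' n l) atTop (𝓝 1)) {M : ℝ} (hM0 : 0 ≤ M)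
    (hM : ∀ k (S : Finset (List Mode)), (∀ l ∈ S, l.length = k) → ∀ s ∈ Ioc a (a + δ),
      ∑ l ∈ S, ‖h s l‖ ^ 2 ≤ (M ^ k) ^ 2) {θ : ℝ} (hθ : 0 < θ) (hθC : 4 * (4 * C) * δ ≤ θ ^ 2)
    (hr : ‖ε‖ * (4 * θ) * M < 1) (qs : List Mode) {t : ℝ} (ht : t ∈ Icc a (a + δ)) :
    ∫ s in a..t, h s qs = 0 := by
  have haδ : a ≤ a + δ := by linarith
  set k := qs.length with hk
  set D : ℕ → Finset Mode → ℝ := fun i K => ∫ s in a..(a + δ), ∑ l ∈ listsOf K (k + i),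
      ‖duhamelError K (collisionKernel L α) ε a h s l‖ ^ 2 with hD
  -- the Duhamel expansion with `n` collisions, all momenta being restricted to `K`
  have h1 : ∀ (n : ℕ) (K : Finset Mode), qs.toFinset ⊆ K → ‖∫ s in a..t, h s qs‖ ≤
      (∑ i ∈ Finset.range n, ‖ε‖ ^ i * ((i + 1) ^ k * (4 * θ) ^ i * √(δ * D i K))) +
        ‖ε‖ ^ n * ((n + 1) ^ k * (4 * θ) ^ n * √(δ * (δ * (M ^ (k + n)) ^ 2))) := by
    intro n K hK
    have hqs : qs ∈ listsOf K k := mem_listsOf.2 ⟨rfl, fun x hx => hK (List.mem_toFinset.2 hx)⟩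
    have hb : ∀ q x y, Continuous fun t => collisionKernel L α t q x y := fun q x y =>
      continuous_collisionKernel L α q x y
    have hST' : SpaceTimeBound K (collisionKernel L α) δ (4 * C) :=
      spaceTimeBound_collisionKernel K hC hδ.le hST
    have hE := hf.boundedMeasurable_duhamelError hδ K
    refine (norm_integral_le_of_treeKernelBound K hb ε hδ hθ
      (fun s m => (treeKernelBound_and_treeDerivBound K hb hδ (by positivity) hST' hθ hθC m).1)
      (fun l => (hf.boundedMeasurable l).intervalIntegrable haδ)
      (fun l => (hf.boundedMeasurable l).intervalIntegrable_sq haδ)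
      (fun l => (hE l).intervalIntegrable haδ) (fun l => (hE l).intervalIntegrable_sq haδ)
      n k hqs ht).trans ?_
    gcongr
    calc ∫ s in a..(a + δ), ∑ l ∈ listsOf K (k + n), ‖h s l‖ ^ 2
        ≤ ∫ _ in a..(a + δ), (M ^ (k + n)) ^ 2 := by
          refine intervalIntegral.integral_mono_on_of_le_Ioo haδ
            (intervalIntegrable_finsetSum fun l _ =>
              (hf.boundedMeasurable l).intervalIntegrable_sq haδ)
            intervalIntegrable_const fun s hs => ?_
          exact hM _ _ (fun l hl => length_of_mem_listsOf hl) s (Ioo_subset_Ioc_self hs)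
      _ = δ * (M ^ (k + n)) ^ 2 := by simp
  -- the limit of increasing `K`, for a fixed number of collisions
  have h2 : ∀ n : ℕ, ‖∫ s in a..t, h s qs‖ ≤
      ‖ε‖ ^ n * ((n + 1) ^ k * (4 * θ) ^ n * √(δ * (δ * (M ^ (k + n)) ^ 2))) := by
    intro n
    have hlim : Tendsto (fun K => (∑ i ∈ Finset.range n,
        ‖ε‖ ^ i * ((i + 1) ^ k * (4 * θ) ^ i * √(δ * D i K))) +
        ‖ε‖ ^ n * ((n + 1) ^ k * (4 * θ) ^ n * √(δ * (δ * (M ^ (k + n)) ^ 2)))) atTop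
        (𝓝 ((∑ i ∈ Finset.range n, ‖ε‖ ^ i * ((i + 1) ^ k * (4 * θ) ^ i * √(δ * 0))) +
          ‖ε‖ ^ n * ((n + 1) ^ k * (4 * θ) ^ n * √(δ * (δ * (M ^ (k + n)) ^ 2))))) := by
      refine Tendsto.add_const _ (tendsto_finsetSum _ fun i _ => ?_)
      refine Tendsto.const_mul _ (Tendsto.const_mul _ ?_)
      exact (Real.continuous_sqrt.tendsto _).comp
        ((hf.tendsto_integral_duhamelError hδ hC hST hm1 hm1' hm hm' hM (k + i)).const_mul δ)
    have := ge_of_tendsto hlim (by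
      filter_upwards [eventually_ge_atTop qs.toFinset] with K hK using h1 n K hK)
    simpa using this
  have h3 : ∀ n : ℕ, ‖∫ s in a..t, h s qs‖ ≤
      δ * M ^ k * (((n : ℝ) + 1) ^ k * (‖ε‖ * (4 * θ) * M) ^ n) := by
    intro n
    refine (h2 n).trans (le_of_eq ?_)
    have e : δ * (δ * (M ^ (k + n)) ^ 2) = (δ * M ^ (k + n)) ^ 2 := by ring
    rw [e, Real.sqrt_sq (by positivity), pow_add, mul_pow, mul_pow]
    ring
  -- the limit of many collisions
  have h4 : Tendsto (fun n : ℕ => ((n : ℝ) + 1) ^ k * (‖ε‖ * (4 * θ) * M) ^ n) atTop (𝓝 0) := by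
    set r := ‖ε‖ * (4 * θ) * M with hr'
    have hr0 : 0 ≤ r := by positivity
    have hb : Tendsto (fun n : ℕ => (2 : ℝ) ^ k * ((n : ℝ) ^ k * r ^ n)) atTop (𝓝 0) := by
      simpa using (tendsto_pow_const_mul_const_pow_of_lt_one k hr0 hr).const_mul ((2 : ℝ) ^ k)
    refine tendsto_of_tendsto_of_tendsto_of_le_of_le' tendsto_const_nhds hb
      (Eventually.of_forall fun n => by positivity) ?_
    filter_upwards [eventually_ge_atTop 1] with n hn
    have hn' : (1 : ℝ) ≤ n := by exact_mod_cast hn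
    rw [← mul_assoc, ← mul_pow]
    gcongr
    linarith
  have h5 := ge_of_tendsto' (h4.const_mul (δ * M ^ k)) h3
  rw [mul_zero] at h5
  exact norm_le_zero_iff.1 h5

end IsHierarchyFamily

/-- The length of the time intervals on which uniqueness is proved in one step. It depends on the
growth rate `M`, but not on the position of the interval. Each collision contributes a factor
`4 θ ‖ε‖ M ≤ 1 / 2`. -/
theorem exists_forall_integral_eq_zero {L α : ℝ} (hL : 0 < L) (hα : 1 / 2 < α) (ε : ℂ) {M : ℝ}
    (hM0 : 0 ≤ M) {m m' : ℕ → (Fin 2 → ℤ) → ℂ} (hm1 : ∀ n l, ‖m n l‖ ≤ 1)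
    (hm1' : ∀ n l, ‖m' n l‖ ≤ 1) (hm : ∀ l, Tendsto (fun n => m n l) atTop (𝓝 1))
    (hm' : ∀ l, Tendsto (fun n => m' n l) atTop (𝓝 1)) :
    ∃ δ₀ > 0, ∀ (a δ : ℝ) (h : ℝ → List Mode → ℂ), 0 < δ → δ ≤ δ₀ →
      IsHierarchyFamily L α a δ ε m m' h →
      (∀ k (S : Finset (List Mode)), (∀ l ∈ S, l.length = k) → ∀ s ∈ Ioc a (a + δ),
        ∑ l ∈ S, ‖h s l‖ ^ 2 ≤ (M ^ k) ^ 2) →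
      ∀ (qs : List Mode), ∀ t ∈ Icc a (a + δ), ∫ s in a..t, h s qs = 0 := by
  obtain ⟨C, hC, hpair⟩ := exists_spaceTime_pair hL hα
  set θ : ℝ := 1 / (8 * ((‖ε‖ + 1) * (M + 1))) with hθ
  have hθ0 : 0 < θ := by positivity
  refine ⟨min (L ^ 2 / Real.pi) (θ ^ 2 / (16 * C)), by positivity, ?_⟩
  intro a δ h hδ hδ0 hf hM qs t ht
  have h1 : δ ≤ L ^ 2 / Real.pi := hδ0.trans (min_le_left _ _)
  have h2 : δ ≤ θ ^ 2 / (16 * C) := hδ0.trans (min_le_right _ _)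
  refine hf.integral_eq_zero hδ hC.le (fun q Z F s => hpair q Z F s δ hδ.le h1) hm1 hm1' hm hm'
    hM0 hM hθ0 ?_ ?_ qs ht
  · rw [le_div_iff₀ (by positivity)] at h2
    linarith
  · have h3 : ‖ε‖ * M ≤ (‖ε‖ + 1) * (M + 1) := by
      gcongr <;> linarith
    have h4 : ‖ε‖ * (4 * θ) * M = ‖ε‖ * M / ((‖ε‖ + 1) * (M + 1)) / 2 := by
      rw [hθ]
      field_simp
      ring
    rw [h4]
    have h5 : ‖ε‖ * M / ((‖ε‖ + 1) * (M + 1)) ≤ 1 := div_le_one_of_le₀ h3 (by positivity)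
    linarith

end GPHierarchy

namespace GPHierarchy

/-! ### Lists of modes as indices of the Fourier coefficients of kernels -/

noncomputable section Lists

/-- The momenta of the first variables `x₁, …, xₙ`. -/
def firstMom (n : ℕ) (l : List Mode) : Mom n := fun i => (l.getD i 0).1

/-- The momenta of the second variables `x'₁, …, x'ₙ`. -/
def secondMom (n : ℕ) (l : List Mode) : Mom n := fun i => (l.getD i 0).2

theorem injOn_firstMom_secondMom (n : ℕ) :
    InjOn (fun l : List Mode => (firstMom n l, secondMom n l)) {l | l.length = n} := by
  intro l hl l' hl' h
  simp only [mem_ofPred_eq] at hl hl'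
  refine List.ext_getElem (hl.trans hl'.symm) fun i h1 h2 => ?_
  have e1 := congr_fun (congrArg Prod.fst h) ⟨i, hl ▸ h1⟩
  have e2 := congr_fun (congrArg Prod.snd h) ⟨i, hl ▸ h1⟩
  simp only [firstMom, secondMom] at e1 e2
  rw [List.getD_eq_getElem _ _ h1, List.getD_eq_getElem _ _ h2] at e1 e2
  exact Prod.ext e1 e2

theorem exists_firstMom_secondMom {n : ℕ} (p p' : Mom n) :
    ∃ l : List Mode, l.length = n ∧ firstMom n l = p ∧ secondMom n l = p' := by
  refine ⟨List.ofFn fun i => (p i, p' i), by simp, ?_, ?_⟩ <;>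
  · funext i
    simp [firstMom, secondMom]

theorem getD_replacePair {l : List Mode} {j : ℕ} (hj : j < l.length) (z : Mode × Mode) (i : ℕ) :
    (replacePair l j z).getD i 0 = if i < j then l.getD i 0 else if i = j then z.1 else
      if i = j + 1 then z.2 else l.getD (i - 1) 0 := by
  have ht : (l.take j).length = j := by simp; omega
  unfold replacePair
  rcases lt_trichotomy i j with h | h | h
  · rw [List.getD_append _ _ _ _ (by omega), if_pos h]
    simp [List.getD_eq_getElem?_getD, h]
  · subst h
    rw [List.getD_append_right _ _ _ _ (by omega), ht]
    simp
  · rw [List.getD_append_right _ _ _ _ (by omega), ht, if_neg (by omega), if_neg (by omega)]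
    split_ifs with h1
    · subst h1
      simp
    · obtain ⟨n, rfl⟩ : ∃ n, i = j + 2 + n := ⟨i - j - 2, by omega⟩
      have e1 : j + 2 + n - j = n + 2 := by omega
      have e2 : j + 2 + n - 1 = j + 1 + n := by omega
      rw [e1, e2]
      simp [List.getD_eq_getElem?_getD, List.getElem?_drop]

/-- The list in which the entry `j` is replaced by a pair is, up to a permutation which does not
depend on the list, the list in which the second entry of the pair is put at the end. -/
theorem exists_perm_replacePair {k : ℕ} (j : Fin k) :
    ∃ σ : Equiv.Perm (Fin (k + 1)), ∀ (l : List Mode) (z : Mode × Mode), l.length = k →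
      firstMom (k + 1) (replacePair l j z) = (Fin.snoc (α := fun _ => Fin 2 → ℤ)
        (Function.update (firstMom k l) j z.1.1) z.2.1 : Mom (k + 1)) ∘ σ ∧
      secondMom (k + 1) (replacePair l j z) = (Fin.snoc (α := fun _ => Fin 2 → ℤ)
        (Function.update (secondMom k l) j z.1.2) z.2.2 : Mom (k + 1)) ∘ σ := by
  have hj := j.2
  -- the permutation moves the position `j + 1` to the end
  set f : Fin (k + 1) → Fin (k + 1) := fun i =>
    if (i : ℕ) ≤ j then i else if (i : ℕ) = j + 1 then Fin.last k else
      ⟨i - 1, by omega⟩ with hf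
  have hval : ∀ i, (f i : ℕ) = if (i : ℕ) ≤ j then (i : ℕ) else if (i : ℕ) = j + 1 then k else
      i - 1 := by
    intro i
    rw [hf]
    dsimp only
    split_ifs <;> rfl
  have hinj : Function.Injective f := by
    intro i i' h
    have h1 := congrArg Fin.val h
    rw [hval, hval] at h1
    ext
    split_ifs at h1 <;> omega
  refine ⟨Equiv.ofBijective f (Finite.injective_iff_bijective.1 hinj), fun l z hl => ?_⟩
  have key : ∀ i : Fin (k + 1), (replacePair l j z).getD i 0 =
      (Fin.snoc (α := fun _ => Mode) (Function.update (fun i : Fin k => l.getD i 0) j z.1) z.2 :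
        Fin (k + 1) → Mode) (f i) := by
    intro i
    have hi := i.2
    rw [getD_replacePair (by omega)]
    have h1 := hval i
    by_cases h2 : (i : ℕ) = j + 1
    · rw [if_neg (by omega), if_neg (by omega), if_pos h2]
      rw [if_neg (by omega), if_pos h2] at h1
      have : f i = Fin.last k := Fin.ext h1
      rw [this, Fin.snoc_last]
    · have h3 : (f i : ℕ) < k := by
        rw [h1]; split_ifs <;> omega
      have h4 : f i = Fin.castSucc ⟨f i, h3⟩ := rfl
      rw [h4, Fin.snoc_castSucc, Function.update_apply]
      simp only [Fin.ext_iff]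
      rw [h1]
      split_ifs <;> first | rfl | omega
  constructor
  · funext i
    have := congrArg Prod.fst (key i)
    change ((replacePair l j z).getD i 0).1 = _
    rw [this]
    simp only [Function.comp_apply, Equiv.ofBijective_apply]
    refine Fin.lastCases ?_ (fun i' => ?_) (f i)
    · simp
    · simp only [Fin.snoc_castSucc, Function.update_apply]
      split_ifs <;> rfl
  · funext i
    have := congrArg Prod.snd (key i)
    change ((replacePair l j z).getD i 0).2 = _
    rw [this]
    simp only [Function.comp_apply, Equiv.ofBijective_apply]
    refine Fin.lastCases ?_ (fun i' => ?_) (f i)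
    · simp
    · simp only [Fin.snoc_castSucc, Function.update_apply]
      split_ifs <;> rfl

/-- The frequency of a list of modes. -/
def listFreq (L : ℝ) (l : List Mode) : ℝ := (l.map (modeFreq L)).sum

/-- The Sobolev weight of a list of modes. -/
def listWeight (L α : ℝ) (l : List Mode) : ℝ := (l.map (modeWeight L α)).prod

theorem listWeight_pos (L α : ℝ) (l : List Mode) : 0 < listWeight L α l := by
  refine List.prod_pos fun x hx => ?_
  obtain ⟨q, -, rfl⟩ := List.mem_map.1 hx
  exact modeWeight_pos L α q

theorem listFreq_eq (L : ℝ) (l : List Mode) :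
    listFreq L l = ∑ i, laplaceEigenvalue L (firstMom l.length l i) -
      ∑ i, laplaceEigenvalue L (secondMom l.length l i) := by
  rw [← Finset.sum_sub_distrib, listFreq, ← Fin.sum_univ_fun_getElem]
  simp [firstMom, secondMom, modeFreq]

theorem listWeight_eq (L α : ℝ) (l : List Mode) :
    listWeight L α l = ∏ i, ((1 + laplaceEigenvalue L (firstMom l.length l i)) ^ (α / 2) *
      (1 + laplaceEigenvalue L (secondMom l.length l i)) ^ (α / 2)) := by
  rw [listWeight, ← Fin.prod_univ_fun_getElem]
  simp [firstMom, secondMom, modeWeight]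

theorem listFreq_replacePair (L : ℝ) {l : List Mode} (j : Fin l.length) (z : Mode × Mode) :
    listFreq L l - listFreq L (replacePair l j z) =
      modeFreq L (l.get j) - modeFreq L z.1 - modeFreq L z.2 := by
  have h : l = l.take j ++ l.get j :: l.drop (j + 1) := by simp
  conv_lhs => enter [1]; rw [h]
  simp only [listFreq, replacePair, List.map_append, List.map_cons, List.sum_append,
    List.sum_cons]
  ring

theorem listWeight_replacePair (L α : ℝ) {l : List Mode} (j : Fin l.length) (z : Mode × Mode) :
    listWeight L α l = modeWeight L α (l.get j) / (modeWeight L α z.1 * modeWeight L α z.2) *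
      listWeight L α (replacePair l j z) := by
  have h : l = l.take j ++ l.get j :: l.drop (j + 1) := by simp
  have h1 := (modeWeight_pos L α z.1).ne'
  have h2 := (modeWeight_pos L α z.2).ne'
  conv_lhs => rw [h]
  simp only [listWeight, replacePair, List.map_append, List.map_cons, List.prod_append,
    List.prod_cons]
  field_simp

/-- The factor `exp(itΩ) w` which brings the coefficient with index `l` to the interaction picture
and to the Sobolev space. -/
def listFactor (L α t : ℝ) (l : List Mode) : ℂ :=
  Complex.exp (Complex.I * t * (listFreq L l : ℝ)) * (listWeight L α l : ℝ)

theorem listFactor_ne_zero (L α t : ℝ) (l : List Mode) : listFactor L α t l ≠ 0 :=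
  mul_ne_zero (Complex.exp_ne_zero _) (Complex.ofReal_ne_zero.2 (listWeight_pos L α l).ne')

theorem norm_listFactor (L α t : ℝ) (l : List Mode) : ‖listFactor L α t l‖ = listWeight L α l := by
  have : Complex.I * t * (listFreq L l : ℝ) = ((t * listFreq L l : ℝ) : ℂ) * Complex.I := by
    push_cast; ring
  rw [listFactor, norm_mul, this, Complex.norm_exp_ofReal_mul_I, one_mul, Complex.norm_real,
    Real.norm_of_nonneg (listWeight_pos L α l).le]

/-- In the interaction picture and with Sobolev weights, the coefficients of the collision operator
are `collisionAmp`. -/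
theorem listFactor_replacePair (L α t : ℝ) {l : List Mode} (j : Fin l.length) (z : Mode × Mode) :
    collisionAmp L α t (l.get j) z.1 z.2 * listFactor L α t (replacePair l j z) =
      listFactor L α t l * (((2 * L) ^ 2 : ℝ) : ℂ)⁻¹ := by
  have h1 := listFreq_replacePair L j z
  rw [listFactor, listFactor, collisionAmp, listWeight_replacePair L α j z, ← h1]
  have h2 : Complex.exp (Complex.I * t * (listFreq L l : ℝ)) =
      Complex.exp (Complex.I * t * (listFreq L l - listFreq L (replacePair l j z) : ℝ)) *
        Complex.exp (Complex.I * t * (listFreq L (replacePair l j z) : ℝ)) := by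
    rw [← Complex.exp_add]
    congr 1
    push_cast
    ring
  rw [h2]
  push_cast
  ring

/-- The free evolution is the multiplication by a phase in the interaction picture. -/
theorem listFactor_mul_freeEvolution (L α s t : ℝ) (l : List Mode)
    (b : Mom l.length → Mom l.length → ℂ) :
    listFactor L α t l * freeEvolution L (t - s) b (firstMom l.length l) (secondMom l.length l) =
      listFactor L α s l * b (firstMom l.length l) (secondMom l.length l) := by
  rw [freeEvolution, ← listFreq_eq, listFactor, listFactor]
  have h2 : Complex.exp (Complex.I * s * (listFreq L l : ℝ)) =
      Complex.exp (Complex.I * t * (listFreq L l : ℝ)) *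
        Complex.exp (-Complex.I * (t - s : ℝ) * (listFreq L l : ℝ)) := by
    rw [← Complex.exp_add]
    congr 1
    push_cast
    ring
  rw [h2]
  ring

theorem norm_listFactor_mul (L α s : ℝ) (l : List Mode)
    (b : Mom l.length → Mom l.length → ℂ) :
    ‖listFactor L α s l * b (firstMom l.length l) (secondMom l.length l)‖ =
      ‖sobolev L α b (firstMom l.length l) (secondMom l.length l)‖ := by
  rw [norm_mul, norm_listFactor, sobolev, ← listWeight_eq, norm_mul, Complex.norm_real,
    Real.norm_of_nonneg (listWeight_pos L α l).le]

end Lists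

end GPHierarchy

namespace GPHierarchy

/-! ### Uniqueness for the hierarchy -/

noncomputable section Instantiate

variable {L : ℝ} [hL : Fact (0 < L)]

/-- The collision terms of the difference of two families of densities, summed over the particles,
in the interaction picture and with Sobolev weights. -/
def collisionFamily (α : ℝ) (φ : ℕ → C(Box L, ℝ)) (γ γ' : ∀ k, ℝ → Op L k) (s : ℝ)
    (l : List Mode) : ℂ :=
  listFactor L α s l * ∑ j : Fin l.length,
    (collision φ j (γ (l.length + 1) s) (firstMom l.length l) (secondMom l.length l) -
      collision φ j (γ' (l.length + 1) s) (firstMom l.length l) (secondMom l.length l))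

/-- The difference of two families of densities, in the interaction picture and with Sobolev
weights. -/
def densityFamily (α : ℝ) (γ γ' : ∀ k, ℝ → Op L k) (t : ℝ) (l : List Mode) : ℂ :=
  listFactor L α t l *
    matrixElement (γ l.length t - γ' l.length t) (firstMom l.length l) (secondMom l.length l)

theorem collisionFamily_eq (α : ℝ) (φ : ℕ → C(Box L, ℝ)) (γ γ' : ∀ k, ℝ → Op L k) (s t : ℝ)
    (l : List Mode) :
    collisionFamily α φ γ γ' s l = listFactor L α t l * ∑ j : Fin l.length,
      (freeEvolution L (t - s) (collision φ j (γ (l.length + 1) s)) (firstMom l.length l)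
          (secondMom l.length l) -
        freeEvolution L (t - s) (collision φ j (γ' (l.length + 1) s)) (firstMom l.length l)
          (secondMom l.length l)) := by
  rw [collisionFamily, Finset.mul_sum, Finset.mul_sum]
  refine Finset.sum_congr rfl fun j _ => ?_
  rw [mul_sub, mul_sub, listFactor_mul_freeEvolution, listFactor_mul_freeEvolution]

variable {b₀ α T : ℝ} {J : ∀ k, ℕ → Op L k} {φ : ℕ → C(Box L, ℝ)} {Γ : ∀ k, Op L k}
  {γ γ' : ∀ k, ℝ → Op L k}

/-- The Duhamel formula for the difference of two solutions, in which the initial data cancel. -/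
theorem densityFamily_eq_integral (hγ : IsSolution b₀ α T J φ Γ γ)
    (hγ' : IsSolution b₀ α T J φ Γ γ') {l : List Mode} (hl : 1 ≤ l.length) {t : ℝ}
    (ht : t ∈ Icc 0 T) :
    densityFamily α γ γ' t l =
      -(Complex.I * b₀) * ∫ s in (0 : ℝ)..t, collisionFamily α φ γ γ' s l := by
  have h1 : ∀ j, IntervalIntegrable _ volume 0 t := fun j =>
    hγ.integrable _ hl j t ht (firstMom l.length l) (secondMom l.length l)
  have h2 : ∀ j, IntervalIntegrable _ volume 0 t := fun j =>
    hγ'.integrable _ hl j t ht (firstMom l.length l) (secondMom l.length l)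
  simp only [collisionFamily_eq α φ γ γ' _ t l]
  rw [intervalIntegral.integral_const_mul, intervalIntegral.integral_finsetSum fun j _ =>
    (h1 j).sub (h2 j)]
  simp only [intervalIntegral.integral_sub (h1 _) (h2 _)]
  rw [densityFamily, matrixElement_sub, hγ.duhamel _ hl t ht, hγ'.duhamel _ hl t ht,
    Finset.sum_sub_distrib]
  ring

theorem densityFamily_eq_of_length (α t : ℝ) (γ γ' : ∀ k, ℝ → Op L k) {l : List Mode} {n : ℕ}
    (h : l.length = n) : densityFamily α γ γ' t l =
      listFactor L α t l * matrixElement (γ n t - γ' n t) (firstMom n l) (secondMom n l) := by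
  subst h
  rfl

/-- By permutation symmetry the particle which is traced out may be put next to the one it collides
with. -/
theorem densityFamily_replacePair (hγ : IsSolution b₀ α T J φ Γ γ)
    (hγ' : IsSolution b₀ α T J φ Γ γ') {l : List Mode} (j : Fin l.length) (z : Mode × Mode)
    {t : ℝ} (ht : t ∈ Icc 0 T) :
    densityFamily α γ γ' t (replacePair l j z) = listFactor L α t (replacePair l j z) *
      matrixElement (γ (l.length + 1) t - γ' (l.length + 1) t)
        (Fin.snoc (α := fun _ => Fin 2 → ℤ)
          (Function.update (firstMom l.length l) j z.1.1) z.2.1)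
        (Fin.snoc (α := fun _ => Fin 2 → ℤ)
          (Function.update (secondMom l.length l) j z.1.2) z.2.2) := by
  obtain ⟨σ, hσ⟩ := exists_perm_replacePair j
  obtain ⟨e1, e2⟩ := hσ l z rfl
  rw [densityFamily_eq_of_length α t γ γ' (length_replacePair j.2 z), e1, e2, matrixElement_sub,
    matrixElement_sub, (hγ.symmetric _ (by omega) t ht).matrixElement_comp,
    (hγ'.symmetric _ (by omega) t ht).matrixElement_comp]

theorem sum_sq_norm_sobolev_le {k : ℕ} {b : Mom k → Mom k → ℂ} {M : ℝ}
    (hb : HasL2NormLE L (sobolev L α b) M) (S : Finset (List Mode))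
    (hS : ∀ l ∈ S, l.length = k) :
    ∑ l ∈ S, ‖sobolev L α b (firstMom k l) (secondMom k l)‖ ^ 2 ≤ M ^ 2 := by
  classical
  have hinj : InjOn (fun l : List Mode => (firstMom k l, secondMom k l)) S :=
    (injOn_firstMom_secondMom k).mono hS
  have := hb.sum_sq_le (S.image fun l : List Mode => (firstMom k l, secondMom k l))
  rwa [Finset.sum_image hinj] at this

/-- The bounds in `L²` of the two solutions give exponential growth in the number of particles for
the sum over `j` of the differences; the factor `2 k ^ 2 ≤ 16 ^ k` is absorbed into the rate. -/
theorem exists_sum_sq_norm_collisionFamily_le (hγ : IsSolution b₀ α T J φ Γ γ)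
    (hγ' : IsSolution b₀ α T J φ Γ γ') :
    ∃ M : ℝ, 0 ≤ M ∧ ∀ (k : ℕ) (S : Finset (List Mode)), (∀ l ∈ S, l.length = k) →
      ∀ s ∈ Icc 0 T, ∑ l ∈ S, ‖collisionFamily α φ γ γ' s l‖ ^ 2 ≤ (M ^ k) ^ 2 := by
  obtain ⟨C, hC⟩ := hγ.bound
  obtain ⟨C', hC'⟩ := hγ'.bound
  refine ⟨4 * (|C| + |C'|), by positivity, fun k S hS s hs => ?_⟩
  -- the solution is not constrained for `k = 0`, where there are no collisions
  rcases Nat.eq_zero_or_pos k with rfl | hk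
  · have : ∀ l ∈ S, ‖collisionFamily α φ γ γ' s l‖ ^ 2 = 0 := by
      intro l hl
      have := List.length_eq_zero_iff.1 (hS l hl)
      subst this
      simp [collisionFamily]
    rw [Finset.sum_eq_zero this]
    positivity
  have h1 : ∀ l ∈ S, ‖collisionFamily α φ γ γ' s l‖ ^ 2 ≤ k * ∑ j : Fin k,
      2 * (‖sobolev L α (collision φ j (γ (k + 1) s)) (firstMom k l) (secondMom k l)‖ ^ 2 +
        ‖sobolev L α (collision φ j (γ' (k + 1) s)) (firstMom k l) (secondMom k l)‖ ^ 2) := by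
    intro l hl
    have hlk := hS l hl
    subst hlk
    rw [collisionFamily, Finset.mul_sum]
    refine (pow_le_pow_left₀ (norm_nonneg _) (norm_sum_le _ _) 2).trans ?_
    refine (sq_sum_le_card_mul_sum_sq).trans ?_
    rw [Finset.card_univ, Fintype.card_fin]
    gcongr with j
    rw [mul_sub, ← norm_listFactor_mul L α s, ← norm_listFactor_mul L α s]
    exact (sq_norm_sub_le _ _).trans (by rw [mul_add])
  have h2 : ∀ j : Fin k, ∑ l ∈ S,
      2 * (‖sobolev L α (collision φ j (γ (k + 1) s)) (firstMom k l) (secondMom k l)‖ ^ 2 +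
        ‖sobolev L α (collision φ j (γ' (k + 1) s)) (firstMom k l) (secondMom k l)‖ ^ 2) ≤
      2 * ((C ^ k) ^ 2 + (C' ^ k) ^ 2) := by
    intro j
    rw [← Finset.mul_sum, Finset.sum_add_distrib]
    gcongr
    · exact sum_sq_norm_sobolev_le (hC k hk j s hs) S hS
    · exact sum_sq_norm_sobolev_le (hC' k hk j s hs) S hS
  have h3 : (C ^ k) ^ 2 + (C' ^ k) ^ 2 ≤ ((|C| + |C'|) ^ k) ^ 2 := by
    rw [← sq_abs (C ^ k), ← sq_abs (C' ^ k), abs_pow, abs_pow]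
    have h4 : |C| ^ k + |C'| ^ k ≤ (|C| + |C'|) ^ k :=
      pow_add_pow_le (abs_nonneg _) (abs_nonneg _) hk.ne'
    have h5 : 0 ≤ |C| ^ k := by positivity
    have h6 : 0 ≤ |C'| ^ k := by positivity
    nlinarith
  have h4 : (k : ℝ) ≤ 2 ^ k := by exact_mod_cast Nat.lt_two_pow_self.le
  have h5 : (2 : ℝ) ≤ 2 ^ k := by
    calc (2 : ℝ) = 2 ^ 1 := (pow_one _).symm
      _ ≤ 2 ^ k := pow_le_pow_right₀ one_le_two hk
  calc ∑ l ∈ S, ‖collisionFamily α φ γ γ' s l‖ ^ 2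
      ≤ ∑ l ∈ S, (k : ℝ) * ∑ j : Fin k,
        2 * (‖sobolev L α (collision φ j (γ (k + 1) s)) (firstMom k l) (secondMom k l)‖ ^ 2 +
        ‖sobolev L α (collision φ j (γ' (k + 1) s)) (firstMom k l) (secondMom k l)‖ ^ 2) :=
        Finset.sum_le_sum h1
    _ ≤ (k : ℝ) * ∑ _j : Fin k, 2 * ((C ^ k) ^ 2 + (C' ^ k) ^ 2) := by
        rw [← Finset.mul_sum, Finset.sum_comm]
        gcongr with j
        exact h2 j
    _ = (k : ℝ) * k * 2 * ((C ^ k) ^ 2 + (C' ^ k) ^ 2) := by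
        rw [Finset.sum_const, Finset.card_univ, Fintype.card_fin, nsmul_eq_mul]
        ring
    _ ≤ (2 : ℝ) ^ k * 2 ^ k * (2 ^ k * 2 ^ k) * ((|C| + |C'|) ^ k) ^ 2 := by
        gcongr
        exact h5.trans (le_mul_of_one_le_right (by positivity) (by linarith))
    _ = ((4 * (|C| + |C'|)) ^ k) ^ 2 := by
        have e : (4 : ℝ) ^ k = 2 ^ k * 2 ^ k := by rw [← mul_pow]; norm_num
        rw [mul_pow, e]
        ring

theorem boundedMeasurableOn_collisionFamily (hγ : IsSolution b₀ α T J φ Γ γ)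
    (hγ' : IsSolution b₀ α T J φ Γ γ') (hT : 0 ≤ T) (l : List Mode) {a b : ℝ} (ha : 0 ≤ a)
    (hb : b ≤ T) : BoundedMeasurableOn a b fun s => collisionFamily α φ γ γ' s l := by
  have hsub : Ioc a b ⊆ Ioc 0 T := Ioc_subset_Ioc ha hb
  constructor
  · simp only [collisionFamily_eq α φ γ γ' _ T l]
    refine AEStronglyMeasurable.const_mul ?_ _
    refine Finset.aestronglyMeasurable_fun_sum _ fun j _ => ?_
    have hl : 1 ≤ l.length := j.pos
    refine AEStronglyMeasurable.sub ?_ ?_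
    · exact (((intervalIntegrable_iff_integrableOn_Ioc_of_le hT).1
        (hγ.integrable _ hl j T ⟨hT, le_rfl⟩ _ _)).mono_set hsub).aestronglyMeasurable
    · exact (((intervalIntegrable_iff_integrableOn_Ioc_of_le hT).1
        (hγ'.integrable _ hl j T ⟨hT, le_rfl⟩ _ _)).mono_set hsub).aestronglyMeasurable
  · obtain ⟨M, hM, h⟩ := exists_sum_sq_norm_collisionFamily_le hγ hγ'
    refine ⟨M ^ l.length, fun s hs => ?_⟩
    have := h l.length {l} (by simp) s (Ioc_subset_Icc_self (hsub hs))
    rw [Finset.sum_singleton] at this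
    exact le_of_sq_le_sq this (by positivity)

/-- The collision terms of the difference of two solutions satisfy the hierarchy on every interval
at whose left end the difference vanishes; this last property is stated as the Duhamel formula
started at `a`. -/
theorem isHierarchyFamily_collisionFamily (hγ : IsSolution b₀ α T J φ Γ γ)
    (hγ' : IsSolution b₀ α T J φ Γ γ') (hT : 0 ≤ T) {a δ : ℝ} (ha : 0 ≤ a) (hδ : a + δ ≤ T)
    (hint : ∀ l : List Mode, 1 ≤ l.length → ∀ t ∈ Ioc a (a + δ), densityFamily α γ γ' t l =
      -(Complex.I * b₀) * ∫ s in a..t, collisionFamily α φ γ γ' s l) :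
    IsHierarchyFamily L α a δ (-(Complex.I * b₀)) (fun n l => conj (deltaCoeff (φ n) l))
      (fun n l => deltaCoeff (φ n) l) (collisionFamily α φ γ γ') := by
  refine ⟨fun l => boundedMeasurableOn_collisionFamily hγ hγ' hT l ha hδ, fun l => ?_⟩
  have hmem : ∀ s ∈ Ioc a (a + δ), s ∈ Icc 0 T := fun s hs =>
    ⟨ha.trans hs.1.le, hs.2.trans hδ⟩
  set p := firstMom l.length l with hp
  set p' := secondMom l.length l with hp'
  set D : ℝ → Op L (l.length + 1) := fun s => γ (l.length + 1) s - γ' (l.length + 1) s with hD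
  refine ⟨fun j s => listFactor L α s l * (collision φ j (γ (l.length + 1) s) p p' -
    collision φ j (γ' (l.length + 1) s) p p'), fun s _ => ?_, fun j => ?_⟩
  · rw [collisionFamily, Finset.mul_sum]
  have hl : 1 ≤ l.length := j.pos
  have hget : l.get j = (p j, p' j) := by
    simp [hp, hp', firstMom, secondMom]
  -- the matrix elements of the difference in terms of the time integral of the family
  have hterm : ∀ s ∈ Ioc a (a + δ), ∀ z : Mode × Mode,
      collisionAmp L α s (l.get j) z.1 z.2 *
        (-(Complex.I * b₀) * ∫ τ in a..s, collisionFamily α φ γ γ' τ (replacePair l j z)) =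
      listFactor L α s l * ((((2 * L) ^ 2 : ℝ) : ℂ)⁻¹ * matrixElement (D s)
        (Fin.snoc (α := fun _ => Fin 2 → ℤ) (Function.update p j z.1.1) z.2.1)
        (Fin.snoc (α := fun _ => Fin 2 → ℤ) (Function.update p' j z.1.2) z.2.2)) := by
    intro s hs z
    rw [← hint _ (by rw [length_replacePair j.2]; omega) s hs,
      densityFamily_replacePair hγ hγ' j z (hmem s hs), ← mul_assoc, listFactor_replacePair,
      mul_assoc]
  refine ⟨fun n r s => listFactor L α s l * matrixElement (mulOp (pairFun (φ n) j) ∘L D s)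
      (Fin.snoc (α := fun _ => Fin 2 → ℤ) p r) (Fin.snoc (α := fun _ => Fin 2 → ℤ) p' r),
    fun n r s => listFactor L α s l * matrixElement (D s ∘L mulOp (pairFun (φ n) j))
      (Fin.snoc (α := fun _ => Fin 2 → ℤ) p r) (Fin.snoc (α := fun _ => Fin 2 → ℤ) p' r),
    fun n s => listFactor L α s l * (regCollision (φ n) j (γ (l.length + 1) s) p p' -
      regCollision (φ n) j (γ' (l.length + 1) s) p p'), ?_, ?_, ?_, ?_⟩
  · intro n r s hs
    have h := (hasSum_matrixElement_mulOp_comp (φ n) j (D s) p r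
      (Fin.snoc (α := fun _ => Fin 2 → ℤ) p' r)).mul_left (listFactor L α s l)
    refine Eq.mp (congrArg₂ HasSum (funext fun q => ?_) rfl) h
    rw [hterm s hs, hget]
    simp only [leftPair, shiftMom, Function.update_eq_self]
    ring
  · intro n r s hs
    have h := (hasSum_matrixElement_comp_mulOp (φ n) j (D s)
      (Fin.snoc (α := fun _ => Fin 2 → ℤ) p r) p' r).mul_left (listFactor L α s l)
    refine Eq.mp (congrArg₂ HasSum (funext fun q => ?_) rfl) h
    rw [hterm s hs, hget]
    simp only [rightPair, shiftMom, Function.update_eq_self]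
    ring
  · intro n s hs
    have h := (hasSum_regCollision_sub (φ n) j ((hγ.curve _ (by omega)).traceClass s (hmem s hs))
      ((hγ'.curve _ (by omega)).traceClass s (hmem s hs)) p p').mul_left (listFactor L α s l)
    simpa only [mul_sub] using h
  · intro s hs
    exact (((hγ.collisionExists _ hl j s (hmem s hs)).tendsto p p').sub
      ((hγ'.collisionExists _ hl j s (hmem s hs)).tendsto p p')).const_mul _

/-- The difference of two solutions vanishes on `[0, T]`, one short interval after the other. -/
theorem integral_collisionFamily_eq_zero (hα : 1 / 2 < α) (hT : 0 < T) (hφ : IsApproxDelta φ)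
    (hγ : IsSolution b₀ α T J φ Γ γ) (hγ' : IsSolution b₀ α T J φ Γ γ') (l : List Mode) {t : ℝ}
    (ht : t ∈ Icc 0 T) : ∫ s in (0 : ℝ)..t, collisionFamily α φ γ γ' s l = 0 := by
  obtain ⟨M, hM0, hM⟩ := exists_sum_sq_norm_collisionFamily_le hγ hγ'
  have hm1 : ∀ n p, ‖conj (deltaCoeff (φ n) p)‖ ≤ 1 := fun n p => by
    rw [RCLike.norm_conj]; exact norm_deltaCoeff_le hφ n p
  have hm : ∀ p, Tendsto (fun n => conj (deltaCoeff (φ n) p)) atTop (𝓝 1) := fun p => by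
    simpa [Function.comp_def] using
      (Complex.continuous_conj.tendsto _).comp (tendsto_deltaCoeff hφ p)
  obtain ⟨δ₀, hδ₀, H⟩ := exists_forall_integral_eq_zero hL.out hα (-(Complex.I * b₀)) hM0 hm1
    (norm_deltaCoeff_le hφ) hm (tendsto_deltaCoeff hφ)
  -- The interval `[0, T]` is divided into `N` intervals of length `δ ≤ δ₀`.
  obtain ⟨N, hN⟩ := exists_nat_gt (T / δ₀)
  have hN0 : (0 : ℝ) < N := (by positivity : 0 < T / δ₀).trans hN
  set δ := T / N with hδ
  have hδ0 : 0 < δ := by positivity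
  have hδδ₀ : δ ≤ δ₀ := by
    rw [hδ, div_le_iff₀ hN0]
    rw [div_lt_iff₀ hδ₀] at hN
    linarith
  have hb : ∀ l, BoundedMeasurableOn 0 T fun s => collisionFamily α φ γ γ' s l := fun l =>
    boundedMeasurableOn_collisionFamily hγ hγ' hT.le l le_rfl le_rfl
  have hi : ∀ (l : List Mode) {x y : ℝ}, x ∈ Icc 0 T → y ∈ Icc 0 T →
      IntervalIntegrable (fun s => collisionFamily α φ γ γ' s l) volume x y := fun l x y hx hy =>
    ((hb l).intervalIntegrable hT.le).mono_set
      (uIcc_subset_uIcc (by rwa [uIcc_of_le hT.le]) (by rwa [uIcc_of_le hT.le]))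
  have hstep : ∀ n : ℕ, n ≤ N → ∀ l, ∀ t ∈ Icc 0 (n * δ),
      ∫ s in (0 : ℝ)..t, collisionFamily α φ γ γ' s l = 0 := by
    intro n
    induction n with
    | zero =>
      intro _ l t ht
      rw [Nat.cast_zero, zero_mul, Icc_self, mem_singleton_iff] at ht
      rw [ht, intervalIntegral.integral_same]
    | succ n ih =>
      intro hn l t ht
      have ih' := ih (by omega)
      set a := n * δ with ha
      have ha0 : 0 ≤ a := by positivity
      have haT : a + δ ≤ T := by
        have h1 : ((n : ℝ) + 1) ≤ N := by exact_mod_cast hn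
        have h2 : (N : ℝ) * δ = T := by rw [hδ]; field_simp
        nlinarith
      have haI : a ∈ Icc 0 T := ⟨ha0, by linarith⟩
      have hsplit : ∀ l, ∀ t ∈ Icc a (a + δ), ∫ s in (0 : ℝ)..t, collisionFamily α φ γ γ' s l =
          ∫ s in a..t, collisionFamily α φ γ γ' s l := by
        intro l t ht
        rw [← intervalIntegral.integral_add_adjacent_intervals
          (hi l ⟨le_rfl, hT.le⟩ haI) (hi l haI ⟨ha0.trans ht.1, ht.2.trans haT⟩),
          ih' l a ⟨ha0, le_rfl⟩, zero_add]
      rcases le_total t a with hta | hta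
      · exact ih' l t ⟨ht.1, hta⟩
      have ht' : t ∈ Icc a (a + δ) := ⟨hta, by
        have := ht.2
        push_cast at this
        linarith⟩
      rw [hsplit l t ht']
      refine H a δ (collisionFamily α φ γ γ') hδ0 hδδ₀
        (isHierarchyFamily_collisionFamily hγ hγ' hT.le ha0 haT fun l hl t ht => ?_)
        (fun k S hS s hs => hM k S hS s ⟨ha0.trans hs.1.le, hs.2.trans haT⟩) l t ht'
      rw [densityFamily_eq_integral hγ hγ' hl ⟨ha0.trans ht.1.le, ht.2.trans haT⟩,
        hsplit l t (Ioc_subset_Icc_self ht)]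
  refine hstep N le_rfl l t ⟨ht.1, ht.2.trans (le_of_eq ?_)⟩
  rw [hδ]
  field_simp

end Instantiate

end GPHierarchy

theorem mainTheorem2 (L : ℝ) [Fact (0 < L)] (b₀ α T : ℝ) (hα : 1 / 2 < α) (hT : 0 < T)
    (J : ∀ k, ℕ → GPHierarchy.Op L k)
    (hJ : ∀ k, 1 ≤ k → GPHierarchy.IsDenseInCompactBall (J k))
    (φ : ℕ → C(GPHierarchy.Box L, ℝ)) (hφ : GPHierarchy.IsApproxDelta φ)
    (Γ : ∀ k, GPHierarchy.Op L k) (hΓ : ∀ k, 1 ≤ k → GPHierarchy.IsTraceClass (Γ k))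
    (γ γ' : ∀ k, ℝ → GPHierarchy.Op L k)
    (hγ : GPHierarchy.IsSolution b₀ α T J φ Γ γ)
    (hγ' : GPHierarchy.IsSolution b₀ α T J φ Γ γ') :
    ∀ k, 1 ≤ k → ∀ t ∈ Set.Icc 0 T, γ k t = γ' k t := by
  intro k hk t ht
  refine GPHierarchy.op_ext fun p p' => ?_
  obtain ⟨l, rfl, rfl, rfl⟩ := GPHierarchy.exists_firstMom_secondMom p p'
  have h := GPHierarchy.densityFamily_eq_integral hγ hγ' hk ht
  rw [GPHierarchy.integral_collisionFamily_eq_zero hα hT hφ hγ hγ' l ht, mul_zero,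
    GPHierarchy.densityFamily, mul_eq_zero,
    or_iff_right (GPHierarchy.listFactor_ne_zero L α t l), GPHierarchy.matrixElement_sub,
    sub_eq_zero] at h
  exact h
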